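/- Let $g_0:\mathbb R\to\mathbb R$ be a $C^2$ function, put $\phi_0=g_0-g_0''$, and suppose that - $\sup_{y\in\mathbb R} y^2|\phi_0(y)|<\infty$, - $g_0(y)=\tfrac12\int_{\mathbb R}e^{-|y-y'|}\phi_0(y')\,dy'$ for all $y\in\mathbb R$ (equivalently, $g_0$ is bounded), - $\phi_0(y)\ge 0$ for all $y\in\mathbb R$. Then the Cauchy problem $$g_t-g_{tyy}+4g^2-4gg_{yy}=y\,g\,g_{yyy}-y\,g_y\,g_{yy},\qquad g(0,y)=g_0(y),$$ has a solution $g$ on $[0,\infty)\times\mathbb R$, and every solution on $[0,T)\times\mathbb R$, $T>0$, with the same initial data coincides with $g$ on $[0,T)\times\mathbb R$; that is, the solution with initial data $g_0$ exists globally in time. Here a solution on a time interval $I=[0,T)$ or $I=[0,\infty)$ is a function $g$ on $I\times\mathbb R$ such that, with $\phi=g-g_{yy}$: $g(t,\cdot)$ is $C^2$ for each $t\in I$ and $g,g_y,g_{yy}$ are continuous on $I\times\mathbb R$; $\sup_{0\le t\le\tau}\sup_{y} y^2|\phi(t,y)|<\infty$ for each $\tau\in I$; $g(t,y)=\tfrac12\int_{\mathbb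 R}e^{-|y-y'|}\phi(t,y')\,dy'$ for all $(t,y)\in I\times\mathbb R$; and the equation holds weakly in $y$: for every compactly supported $C^1$ function $\psi:\mathbb R\to\mathbb R$ and every $t\in I$ (with a one-sided derivative at $t=0$), $$\frac{d}{dt}\int_{\mathbb R}\phi\,\psi\,dy=\int_{\mathbb R}\Big[\big(-4g^2+4gg_{yy}-y\,g_y\,g_{yy}\big)\psi-(y\,g\,\psi)_y\,g_{yy}\Big]dy .$$ -/

import Mathlib

open Set MeasureTheory

noncomputable section

/-- The momentum `φ = f - f''` of a profile `f : ℝ → ℝ` (used for `f` of class `C²`). -/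
def momentum (f : ℝ → ℝ) (y : ℝ) : ℝ := f y - deriv (deriv f) y

/-- The potential `y ↦ ½ ∫ e^{-|y - y'|} φ(y') dy'`, by which the velocity is recovered from
its momentum. -/
def greenPotential (φ : ℝ → ℝ) (y : ℝ) : ℝ :=
  (1 / 2) * ∫ y', Real.exp (-|y - y'|) * φ y'

/-- The right-hand side of
`∂ₜ (g - g_yy) = -4 g² + 4 g g_yy + y g g_yyy - y g_y g_yy`
at a fixed time (with `f = g(t, ·)` of class `C²`), tested against `ψ`. The third derivative is
moved by one integration by parts: `∫ (y f ψ) f''' = - ∫ (y f ψ)' f''`. -/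
def testedRHS (f ψ : ℝ → ℝ) : ℝ :=
  ∫ y, ((-4 * f y ^ 2 + 4 * f y * deriv (deriv f) y
            - y * deriv f y * deriv (deriv f) y) * ψ y
          - deriv (fun x => x * f x * ψ x) y * deriv (deriv f) y)

/-- `g` is a `C²` solution on the time set `I` (an interval `[0, T)` or `[0, ∞)`) of
`g_t - g_tyy + 4 g² - 4 g g_yy = y g g_yyy - y g_y g_yy`:
`g(t, ·)` is `C²`, with `g`, `g_y`, `g_yy` jointly continuous; the momentum decays quadratically,
locally uniformly in time; `g` is the potential of its momentum; and the equation, whose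
third-order terms need not exist pointwise, holds in the weak sense in `y`. -/
structure IsSolutionOn (I : Set ℝ) (g : ℝ → ℝ → ℝ) : Prop where
  contDiff : ∀ t ∈ I, ContDiff ℝ 2 (g t)
  continuousOn : ContinuousOn (fun p : ℝ × ℝ => g p.1 p.2) (I ×ˢ univ)
  continuousOn_deriv : ContinuousOn (fun p : ℝ × ℝ => deriv (g p.1) p.2) (I ×ˢ univ)
  continuousOn_deriv_deriv :
    ContinuousOn (fun p : ℝ × ℝ => deriv (deriv (g p.1)) p.2) (I ×ˢ univ)
  decay : ∀ τ ∈ I, ∃ M : ℝ, ∀ t ∈ I, t ≤ τ → ∀ y : ℝ, y ^ 2 * |momentum (g t) y| ≤ M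
  eq_potential : ∀ t ∈ I, ∀ y : ℝ, g t y = greenPotential (momentum (g t)) y
  equation : ∀ ψ : ℝ → ℝ, ContDiff ℝ 1 ψ → HasCompactSupport ψ → ∀ t ∈ I,
    HasDerivWithinAt (fun s => ∫ y, momentum (g s) y * ψ y) (testedRHS (g t) ψ) I t

end

/-! In terms of the momentum `φ = g - g_yy` the equation is the transport equation
`φ_t + y g φ_y = (y g_y - 4 g) φ`, with `g` the Green potential of `φ`. The first term is only weakly
defined, but after one integration by parts in `testedRHS` every pairing makes sense for continuous
`φ = O((1 + y²)⁻¹)` (`testedRHS_eq`, `testedRHS_greenPotential`).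

*Uniqueness* is a Grönwall argument for the squared `H¹` norm `E(t) = ∫ v φ_v` of the difference
`v` of two solutions. The weak form extends from compactly supported tests to bounded ones
(`IsSolutionOn.integral_testedRHS`), in particular to the test `v(r)` at a fixed time `r`. As the
pairing `∫ v(r) φ_v(s)` is symmetric in `r` and `s`, the increments of `E` are integrals of
`K(r, s) + K(t, s)`, where `K(r, s)` is the difference of the two right-hand sides at time `s` tested
against `v(r)`; hence `E' = 2 K(t, t)` although `v` is not differentiable in time. On the diagonal
all second derivatives of `v` integrate away and `|K(t, t)| ≤ 20 C E(t)` (`abs_testedRHS_sub_le`).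

*Existence* is Lagrangian. Let `Y` be the flow of `y g` and `b = log Y_x`. Along the flow
`φ Y⁵ / Y_x` is conserved, so `b` alone determines the momentum and the velocity, and the problem
becomes the ordinary differential equation `b' = (y g)_y ∘ Y`, called `b' = field b` below, in the
Banach space of bounded continuous functions. Written as an integral over labels, its right-hand side
is Lipschitz on balls (`DecayingDensity.abs_rateKernel_sub_le`); the growth of the factor `Y` in
`y g_y` is compensated by the decay of `φ`. Conversely a solution of this equation gives a weak
solution of the Cauchy problem by differentiation under the integral over labels
(`DecayingDensity.hasDerivAt_integral_eulerMomentum`).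

*Global existence* needs a bound for `(y g)_y`, and this is where `φ ≥ 0` enters: then `|g_y| ≤ g`, and
it suffices to bound `√(1 + z²) g(t, z)`. For a weight `w` with `0 ≤ y w' ≤ 3 w`, the identity
`2 φ g_y = (g² - g_y²)_y` gives
`d/dt ∫ w φ = ∫ (y w' - 3 w) g φ - ∫ (y w)' (g² - g_y²) ≤ 0` (`integral_weight_nonpos`).
The weight `w(y) = R (1 + y²) / (R² + y²)` with `R = √(1 + z²)` dominates `R e^{-|z - y|} / 3`, while
`∫ w φ₀` is bounded independently of `R`. So `(y g)_y` is bounded uniformly in time, `b` grows at most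
linearly, and the integral curve never blows up. -/

noncomputable section

open Filter Topology
open scoped BoundedContinuousFunction NNReal

/-! ### The Green potential and its decay -/

theorem exp_neg_mul_mul_pow_four_le {c : ℝ} (hc : 0 < c) (s : ℝ) :
    Real.exp (-(c * |s|)) * (1 + |s|) ^ 4 ≤ 24 * Real.exp c / c ^ 4 := by
  have h := Real.pow_div_factorial_le_exp (x := c * (1 + |s|)) (by positivity) 4
  have h4 : ((Nat.factorial 4 : ℕ) : ℝ) = 24 := by norm_num [Nat.factorial]
  rw [h4, mul_pow, div_le_iff₀ (by norm_num), mul_add, Real.exp_add, mul_one] at h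
  rw [le_div_iff₀ (by positivity)]
  have : Real.exp (-(c * |s|)) * Real.exp (c * |s|) = 1 := by
    rw [← Real.exp_add]; simp
  calc Real.exp (-(c * |s|)) * (1 + |s|) ^ 4 * c ^ 4
      = Real.exp (-(c * |s|)) * (c ^ 4 * (1 + |s|) ^ 4) := by ring
    _ ≤ Real.exp (-(c * |s|)) * (Real.exp c * Real.exp (c * |s|) * 24) := by gcongr
    _ = 24 * Real.exp c * (Real.exp (-(c * |s|)) * Real.exp (c * |s|)) := by ring
    _ = 24 * Real.exp c := by rw [this, mul_one]

theorem exp_neg_mul_mul_sq_le {c : ℝ} (hc : 0 < c) (s : ℝ) :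
    Real.exp (-(c * |s|)) * (1 + |s|) ^ 2 ≤ 24 * Real.exp c / c ^ 4 * (1 + s ^ 2)⁻¹ := by
  have h := exp_neg_mul_mul_pow_four_le hc s
  rw [← div_eq_mul_inv, le_div_iff₀ (by positivity)]
  refine le_trans ?_ h
  have h1 : 1 + s ^ 2 ≤ (1 + |s|) ^ 2 := by
    nlinarith [abs_nonneg s, sq_abs s]
  calc Real.exp (-(c * |s|)) * (1 + |s|) ^ 2 * (1 + s ^ 2)
      ≤ Real.exp (-(c * |s|)) * (1 + |s|) ^ 2 * (1 + |s|) ^ 2 := by gcongr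
    _ = _ := by ring

theorem exp_neg_abs_le (s : ℝ) : Real.exp (-|s|) ≤ 24 * Real.exp 1 * (1 + s ^ 2)⁻¹ := by
  have h := exp_neg_mul_mul_sq_le one_pos s
  simp only [one_mul, one_pow, div_one] at h
  refine le_trans ?_ h
  exact le_mul_of_one_le_right (Real.exp_nonneg _) (one_le_pow₀ (by linarith [abs_nonneg s]))

theorem integrable_exp_neg_abs : Integrable fun s : ℝ => Real.exp (-|s|) := by
  refine (integrable_inv_one_add_sq.const_mul (24 * Real.exp 1)).mono'
    (by fun_prop) (ae_of_all _ fun s => ?_)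
  rw [Real.norm_eq_abs, abs_of_nonneg (Real.exp_nonneg _)]
  exact exp_neg_abs_le s

theorem integrable_exp_neg_abs_sub (y : ℝ) :
    Integrable fun s : ℝ => Real.exp (-|y - s|) :=
  integrable_exp_neg_abs.comp_sub_left y

theorem integrable_of_decay {f : ℝ → ℝ} {M : ℝ} (hf : AEStronglyMeasurable f)
    (h : ∀ y, |f y| ≤ M * (1 + y ^ 2)⁻¹) : Integrable f :=
  (integrable_inv_one_add_sq.const_mul M).mono' hf (ae_of_all _ h)

theorem le_of_decay {a C y : ℝ} (h : |a| ≤ C * (1 + y ^ 2)⁻¹) : |a| ≤ C := by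
  have hC : 0 ≤ C := by
    by_contra hC
    have : C * (1 + y ^ 2)⁻¹ < 0 := mul_neg_of_neg_of_pos (not_le.1 hC) (by positivity)
    linarith [abs_nonneg a]
  refine h.trans (mul_le_of_le_one_right hC (inv_le_one_of_one_le₀ ?_))
  nlinarith [sq_nonneg y]

/-- Quadratic decay away from the origin and a bound near the origin, in a single inequality. -/
theorem abs_le_of_sq_mul_abs_le {a M M' y : ℝ} (h : y ^ 2 * |a| ≤ M) (h' : |y| ≤ 1 → |a| ≤ M') :
    |a| ≤ 2 * (|M| + |M'|) * (1 + y ^ 2)⁻¹ := by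
  rw [← div_eq_mul_inv, le_div_iff₀ (by positivity)]
  rcases le_total |y| 1 with hy | hy
  · have h3 : y ^ 2 ≤ 1 := by nlinarith [sq_abs y, abs_nonneg y]
    nlinarith [h' hy, le_abs_self M', abs_nonneg M, abs_nonneg a]
  · have h3 : 1 ≤ y ^ 2 := by nlinarith [sq_abs y, abs_nonneg y]
    nlinarith [le_abs_self M, abs_nonneg M', abs_nonneg a]

theorem integral_inv_one_add_sub_sq (x : ℝ) : ∫ s : ℝ, (1 + (x - s) ^ 2)⁻¹ = Real.pi := by
  rw [integral_sub_left_eq_self (fun s : ℝ => (1 + s ^ 2)⁻¹) volume x]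
  exact integral_univ_inv_one_add_sq

section Potential

variable {φ : ℝ → ℝ} {M : ℝ}

/-- The spatial derivative of `greenPotential φ`, as an integral against the derivative
`sgn (y' - y) e^{-|y - y'|}` of the kernel. -/
def greenDeriv (φ : ℝ → ℝ) (y : ℝ) : ℝ :=
  (1 / 2) * ∫ y', (if y < y' then 1 else -1) * Real.exp (-|y - y'|) * φ y'

theorem integrable_green (hφ : Continuous φ) (hM : ∀ y, |φ y| ≤ M) (y : ℝ) :
    Integrable fun y' => Real.exp (-|y - y'|) * φ y' :=
  (integrable_exp_neg_abs_sub y).mul_bdd hφ.aestronglyMeasurable (ae_of_all _ hM)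

theorem abs_sign_kernel (y y' : ℝ) : |(if y < y' then (1 : ℝ) else -1)| = 1 := by
  split_ifs <;> simp

theorem measurable_sign_kernel (y : ℝ) :
    Measurable fun y' : ℝ => (if y < y' then (1 : ℝ) else -1) :=
  Measurable.ite measurableSet_Ioi measurable_const measurable_const

theorem integrable_greenDeriv (hφ : Continuous φ) (hM : ∀ y, |φ y| ≤ M) (y : ℝ) :
    Integrable fun y' => (if y < y' then 1 else -1) * Real.exp (-|y - y'|) * φ y' := by
  simp_rw [mul_assoc]
  refine (integrable_green hφ hM y).bdd_mul (c := 1)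
    (measurable_sign_kernel y).aestronglyMeasurable (ae_of_all _ fun y' => ?_)
  rw [Real.norm_eq_abs, abs_sign_kernel]

theorem integrableOn_exp_mul (hφ : Continuous φ) (hM : ∀ y, |φ y| ≤ M) (y : ℝ) :
    IntegrableOn (fun s => Real.exp s * φ s) (Iic y) :=
  (integrableOn_exp_Iic y).mul_bdd hφ.aestronglyMeasurable.restrict (ae_of_all _ hM)

theorem integrableOn_exp_neg_mul (hφ : Continuous φ) (hM : ∀ y, |φ y| ≤ M) (y : ℝ) :
    IntegrableOn (fun s => Real.exp (-s) * φ s) (Ioi y) :=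
  (integrableOn_exp_neg_Ioi y).mul_bdd hφ.aestronglyMeasurable.restrict (ae_of_all _ hM)

theorem setIntegral_Iic_kernel (y : ℝ) :
    ∫ s in Iic y, Real.exp (-|y - s|) * φ s = Real.exp (-y) * ∫ s in Iic y, Real.exp s * φ s := by
  rw [← integral_const_mul]
  refine setIntegral_congr_fun measurableSet_Iic fun s hs => ?_
  have hs' : s ≤ y := hs
  rw [abs_of_nonneg (by linarith), ← mul_assoc, ← Real.exp_add]
  ring_nf

theorem setIntegral_Ioi_kernel (y : ℝ) :
    ∫ s in Ioi y, Real.exp (-|y - s|) * φ s = Real.exp y * ∫ s in Ioi y, Real.exp (-s) * φ s := by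
  rw [← integral_const_mul]
  refine setIntegral_congr_fun measurableSet_Ioi fun s hs => ?_
  have hs' : y < s := hs
  rw [abs_of_neg (by linarith), ← mul_assoc, ← Real.exp_add]
  ring_nf

theorem greenPotential_eq_add (hφ : Continuous φ) (hM : ∀ y, |φ y| ≤ M) (y : ℝ) :
    greenPotential φ y = (1 / 2) * (Real.exp (-y) * (∫ s in Iic y, Real.exp s * φ s)
      + Real.exp y * ∫ s in Ioi y, Real.exp (-s) * φ s) := by
  rw [greenPotential, ← setIntegral_Iic_kernel, ← setIntegral_Ioi_kernel, ← compl_Iic,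
    integral_add_compl measurableSet_Iic (integrable_green hφ hM y)]

theorem greenDeriv_eq_sub (hφ : Continuous φ) (hM : ∀ y, |φ y| ≤ M) (y : ℝ) :
    greenDeriv φ y = (1 / 2) * (Real.exp y * (∫ s in Ioi y, Real.exp (-s) * φ s)
      - Real.exp (-y) * ∫ s in Iic y, Real.exp s * φ s) := by
  rw [greenDeriv, ← integral_add_compl measurableSet_Iic (integrable_greenDeriv hφ hM y),
    compl_Iic, ← setIntegral_Iic_kernel, ← setIntegral_Ioi_kernel, sub_eq_neg_add,
    ← integral_neg]
  congr 2
  · refine setIntegral_congr_fun measurableSet_Iic fun s hs => ?_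
    have hs' : ¬ y < s := not_lt.2 hs
    simp [hs']
  · refine setIntegral_congr_fun measurableSet_Ioi fun s hs => ?_
    have hs' : y < s := hs
    simp [hs']

theorem hasDerivAt_setIntegral_Iic {f : ℝ → ℝ} (hf : Continuous f)
    (hi : ∀ y, IntegrableOn f (Iic y)) (y : ℝ) :
    HasDerivAt (fun y => ∫ s in Iic y, f s) (f y) y := by
  have h : (fun y => ∫ s in Iic y, f s) = fun y => (∫ s in Iic 0, f s) + ∫ s in (0 : ℝ)..y, f s := by
    funext y
    rw [← intervalIntegral.integral_Iic_sub_Iic (hi 0) (hi y)]; ring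
  rw [h]
  exact (intervalIntegral.integral_hasDerivAt_right (hf.intervalIntegrable _ _)
    hf.aestronglyMeasurable.stronglyMeasurableAtFilter hf.continuousAt).const_add _

theorem hasDerivAt_setIntegral_Ioi {f : ℝ → ℝ} (hf : Continuous f)
    (hi : ∀ y, IntegrableOn f (Ioi y)) (y : ℝ) :
    HasDerivAt (fun y => ∫ s in Ioi y, f s) (-f y) y := by
  have h : (fun y => ∫ s in Ioi y, f s) = fun y => (∫ s in Ioi 0, f s) - ∫ s in (0 : ℝ)..y, f s := by
    funext y
    rw [← intervalIntegral.integral_Ioi_sub_Ioi' (hi 0) (hi y)]; ring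
  rw [h]
  exact (intervalIntegral.integral_hasDerivAt_right (hf.intervalIntegrable _ _)
    hf.aestronglyMeasurable.stronglyMeasurableAtFilter hf.continuousAt).const_sub _

theorem hasDerivAt_greenPotential (hφ : Continuous φ) (hM : ∀ y, |φ y| ≤ M) (y : ℝ) :
    HasDerivAt (greenPotential φ) (greenDeriv φ y) y := by
  have h1 := hasDerivAt_setIntegral_Iic (f := fun s => Real.exp s * φ s) (by fun_prop)
    (integrableOn_exp_mul hφ hM) y
  have h2 := hasDerivAt_setIntegral_Ioi (f := fun s => Real.exp (-s) * φ s) (by fun_prop)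
    (integrableOn_exp_neg_mul hφ hM) y
  have e1 := (hasDerivAt_neg y).exp
  have e2 := Real.hasDerivAt_exp y
  rw [funext (greenPotential_eq_add hφ hM), greenDeriv_eq_sub hφ hM]
  refine (((e1.mul h1).add (e2.mul h2)).const_mul (1 / 2)).congr_deriv ?_
  simp only [Real.exp_neg]
  field_simp
  ring

theorem hasDerivAt_greenDeriv (hφ : Continuous φ) (hM : ∀ y, |φ y| ≤ M) (y : ℝ) :
    HasDerivAt (greenDeriv φ) (greenPotential φ y - φ y) y := by
  have h1 := hasDerivAt_setIntegral_Iic (f := fun s => Real.exp s * φ s) (by fun_prop)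
    (integrableOn_exp_mul hφ hM) y
  have h2 := hasDerivAt_setIntegral_Ioi (f := fun s => Real.exp (-s) * φ s) (by fun_prop)
    (integrableOn_exp_neg_mul hφ hM) y
  have e1 := (hasDerivAt_neg y).exp
  have e2 := Real.hasDerivAt_exp y
  rw [funext (greenDeriv_eq_sub hφ hM), greenPotential_eq_add hφ hM]
  refine (((e2.mul h2).sub (e1.mul h1)).const_mul (1 / 2)).congr_deriv ?_
  simp only [Real.exp_neg]
  field_simp
  ring

theorem continuous_greenPotential (hφ : Continuous φ) (hM : ∀ y, |φ y| ≤ M) :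
    Continuous (greenPotential φ) :=
  continuous_iff_continuousAt.2 fun y => (hasDerivAt_greenPotential hφ hM y).continuousAt

theorem continuous_greenDeriv (hφ : Continuous φ) (hM : ∀ y, |φ y| ≤ M) :
    Continuous (greenDeriv φ) :=
  continuous_iff_continuousAt.2 fun y => (hasDerivAt_greenDeriv hφ hM y).continuousAt

theorem deriv_greenPotential (hφ : Continuous φ) (hM : ∀ y, |φ y| ≤ M) :
    deriv (greenPotential φ) = greenDeriv φ :=
  funext fun y => (hasDerivAt_greenPotential hφ hM y).deriv

theorem deriv_deriv_greenPotential (hφ : Continuous φ) (hM : ∀ y, |φ y| ≤ M) (y : ℝ) :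
    deriv (deriv (greenPotential φ)) y = greenPotential φ y - φ y := by
  rw [deriv_greenPotential hφ hM]
  exact (hasDerivAt_greenDeriv hφ hM y).deriv

theorem momentum_greenPotential (hφ : Continuous φ) (hM : ∀ y, |φ y| ≤ M) :
    momentum (greenPotential φ) = φ := by
  funext y
  rw [momentum, deriv_deriv_greenPotential hφ hM]
  ring

theorem contDiff_greenPotential (hφ : Continuous φ) (hM : ∀ y, |φ y| ≤ M) :
    ContDiff ℝ 2 (greenPotential φ) := by
  have h1 : ContDiff ℝ 1 (greenDeriv φ) := by
    rw [contDiff_one_iff_deriv]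
    refine ⟨fun y => (hasDerivAt_greenDeriv hφ hM y).differentiableAt, ?_⟩
    rw [funext fun y => (hasDerivAt_greenDeriv hφ hM y).deriv]
    exact (continuous_greenPotential hφ hM).sub hφ
  rw [show (2 : WithTop ℕ∞) = 1 + 1 by norm_num, contDiff_succ_iff_deriv]
  refine ⟨fun y => (hasDerivAt_greenPotential hφ hM y).differentiableAt, by simp, ?_⟩
  rwa [deriv_greenPotential hφ hM]

theorem abs_greenDeriv_le (φ : ℝ → ℝ) (y : ℝ) :
    |greenDeriv φ y| ≤ greenPotential (fun s => |φ s|) y := by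
  rw [greenDeriv, greenPotential, abs_mul, abs_of_nonneg (by norm_num : (0 : ℝ) ≤ 1 / 2)]
  gcongr
  rw [← Real.norm_eq_abs]
  refine (norm_integral_le_integral_norm _).trans_eq (integral_congr_ae (ae_of_all _ fun s => ?_))
  simp only [Real.norm_eq_abs, abs_mul, abs_sign_kernel, Real.abs_exp, one_mul]

theorem abs_greenPotential_le (φ : ℝ → ℝ) (y : ℝ) :
    |greenPotential φ y| ≤ greenPotential (fun s => |φ s|) y := by
  rw [greenPotential, greenPotential, abs_mul, abs_of_nonneg (by norm_num : (0 : ℝ) ≤ 1 / 2)]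
  gcongr
  rw [← Real.norm_eq_abs]
  refine (norm_integral_le_integral_norm _).trans_eq (integral_congr_ae (ae_of_all _ fun s => ?_))
  simp only [Real.norm_eq_abs, abs_mul, Real.abs_exp]

theorem greenPotential_nonneg (h : ∀ y, 0 ≤ φ y) (y : ℝ) : 0 ≤ greenPotential φ y :=
  mul_nonneg (by norm_num) (integral_nonneg fun s => mul_nonneg (Real.exp_nonneg _) (h s))

/-- For a nonnegative density the potential dominates its derivative. -/
theorem abs_greenDeriv_le_greenPotential (h : ∀ y, 0 ≤ φ y) (y : ℝ) :
    |greenDeriv φ y| ≤ greenPotential φ y := by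
  simpa only [abs_of_nonneg (h _)] using abs_greenDeriv_le φ y

/-- The constant by which `greenPotential` and `greenDeriv` enlarge bounds of the form
`M (1 + y²)⁻¹`. -/
def decayConst : ℝ := 24 * Real.exp 1 * Real.pi

theorem greenPotential_abs_le_of_decay (hφ : Continuous φ)
    (h : ∀ y, |φ y| ≤ M * (1 + y ^ 2)⁻¹) (y : ℝ) :
    greenPotential (fun s => |φ s|) y ≤ decayConst * M * (1 + y ^ 2)⁻¹ := by
  have hM0 : 0 ≤ M := by simpa using (abs_nonneg _).trans (h 0)
  have hM : ∀ s, |φ s| ≤ M := fun s => le_of_decay (h s)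
  have key : ∀ s, Real.exp (-|y - s|) * |φ s| ≤
      2 * (24 * Real.exp 1) * M * (1 + y ^ 2)⁻¹ * (1 + (y - s) ^ 2)⁻¹ := fun s => by
    have h1 := exp_neg_mul_mul_sq_le one_pos (y - s)
    simp only [one_mul, one_pow, div_one] at h1
    -- the Peetre inequality `1 + y² ≤ 2 (1 + s²) (1 + |y - s|)²`
    have h2 : (1 + s ^ 2)⁻¹ ≤ 2 * (1 + |y - s|) ^ 2 * (1 + y ^ 2)⁻¹ := by
      rw [← div_eq_mul_inv, le_div_iff₀ (by positivity), inv_mul_le_iff₀ (by positivity)]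
      have : 1 + (y - s) ^ 2 ≤ (1 + |y - s|) ^ 2 := by
        nlinarith [abs_nonneg (y - s), sq_abs (y - s)]
      have h3 : (1 + s ^ 2) * (2 * (1 + (y - s) ^ 2)) ≤ (1 + s ^ 2) * (2 * (1 + |y - s|) ^ 2) := by
        gcongr
      refine le_trans ?_ h3
      nlinarith [sq_nonneg (y - 2 * s), mul_nonneg (sq_nonneg s) (sq_nonneg (y - s))]
    calc Real.exp (-|y - s|) * |φ s| ≤ Real.exp (-|y - s|) * (M * (1 + s ^ 2)⁻¹) := by
          gcongr; exact h s
      _ ≤ Real.exp (-|y - s|) * (M * (2 * (1 + |y - s|) ^ 2 * (1 + y ^ 2)⁻¹)) := by gcongr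
      _ = 2 * M * (1 + y ^ 2)⁻¹ * (Real.exp (-|y - s|) * (1 + |y - s|) ^ 2) := by ring
      _ ≤ 2 * M * (1 + y ^ 2)⁻¹ * (24 * Real.exp 1 * (1 + (y - s) ^ 2)⁻¹) := by gcongr
      _ = _ := by ring
  rw [greenPotential]
  calc (1 / 2) * ∫ s, Real.exp (-|y - s|) * |φ s|
      ≤ (1 / 2) * ∫ s, 2 * (24 * Real.exp 1) * M * (1 + y ^ 2)⁻¹ * (1 + (y - s) ^ 2)⁻¹ := by
        refine mul_le_mul_of_nonneg_left (integral_mono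
          (integrable_green (by fun_prop) (fun s => by simpa using hM s) y) ?_ key) (by norm_num)
        exact (integrable_inv_one_add_sq.comp_sub_left y).const_mul _
    _ = _ := by
        rw [integral_const_mul, integral_inv_one_add_sub_sq, decayConst]
        ring

theorem abs_greenPotential_le_of_decay (hφ : Continuous φ)
    (h : ∀ y, |φ y| ≤ M * (1 + y ^ 2)⁻¹) (y : ℝ) :
    |greenPotential φ y| ≤ decayConst * M * (1 + y ^ 2)⁻¹ :=
  (abs_greenPotential_le φ y).trans (greenPotential_abs_le_of_decay hφ h y)

theorem abs_greenDeriv_le_of_decay (hφ : Continuous φ)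
    (h : ∀ y, |φ y| ≤ M * (1 + y ^ 2)⁻¹) (y : ℝ) :
    |greenDeriv φ y| ≤ decayConst * M * (1 + y ^ 2)⁻¹ :=
  (abs_greenDeriv_le φ y).trans (greenPotential_abs_le_of_decay hφ h y)

end Potential

/-! ### Decaying profiles and the weak form as a transport equation -/

/-- `f` is of class `C²` and `f`, `f'`, `f''` are bounded by `C (1 + y²)⁻¹`. -/
structure DecayingProfile (C : ℝ) (f : ℝ → ℝ) : Prop where
  contDiff : ContDiff ℝ 2 f
  le_zero : ∀ y, |f y| ≤ C * (1 + y ^ 2)⁻¹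
  le_one : ∀ y, |deriv f y| ≤ C * (1 + y ^ 2)⁻¹
  le_two : ∀ y, |deriv (deriv f) y| ≤ C * (1 + y ^ 2)⁻¹

namespace DecayingProfile

variable {C : ℝ} {f : ℝ → ℝ}

theorem contDiff_deriv (h : DecayingProfile C f) : ContDiff ℝ 1 (deriv f) := by
  have := h.contDiff
  rw [show (2 : WithTop ℕ∞) = 1 + 1 by norm_num, contDiff_succ_iff_deriv] at this
  exact this.2.2

theorem hasDerivAt (h : DecayingProfile C f) (y : ℝ) : HasDerivAt f (deriv f y) y :=
  (h.contDiff.differentiable (by norm_num) y).hasDerivAt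

theorem hasDerivAt_deriv (h : DecayingProfile C f) (y : ℝ) :
    HasDerivAt (deriv f) (deriv (deriv f) y) y :=
  (h.contDiff_deriv.differentiable (by norm_num) y).hasDerivAt

theorem continuous_zero (h : DecayingProfile C f) : Continuous f := h.contDiff.continuous

theorem continuous_one (h : DecayingProfile C f) : Continuous (deriv f) :=
  h.contDiff_deriv.continuous

theorem continuous_two (h : DecayingProfile C f) : Continuous (deriv (deriv f)) :=
  h.contDiff_deriv.continuous_deriv (by norm_num)

theorem nonneg (h : DecayingProfile C f) : 0 ≤ C := by
  simpa using (abs_nonneg _).trans (h.le_zero 0)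

theorem sub {g : ℝ → ℝ} {C' : ℝ} (h : DecayingProfile C f) (h' : DecayingProfile C' g) :
    DecayingProfile (C + C') (f - g) := by
  have e1 : deriv (f - g) = deriv f - deriv g :=
    funext fun y => ((h.hasDerivAt y).sub (h'.hasDerivAt y)).deriv
  have e2 : deriv (deriv (f - g)) = deriv (deriv f) - deriv (deriv g) := by
    rw [e1]
    exact funext fun y => ((h.hasDerivAt_deriv y).sub (h'.hasDerivAt_deriv y)).deriv
  refine ⟨h.contDiff.sub h'.contDiff, fun y => ?_, fun y => ?_, fun y => ?_⟩
  · rw [add_mul]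
    exact (abs_sub _ _).trans (add_le_add (h.le_zero y) (h'.le_zero y))
  · rw [e1, add_mul]
    exact (abs_sub _ _).trans (add_le_add (h.le_one y) (h'.le_one y))
  · rw [e2, add_mul]
    exact (abs_sub _ _).trans (add_le_add (h.le_two y) (h'.le_two y))

end DecayingProfile

theorem abs_mul_le_of_decay {a C y : ℝ} (h : |a| ≤ C * (1 + y ^ 2)⁻¹) : |y * a| ≤ C := by
  rw [← div_eq_mul_inv, le_div_iff₀ (by positivity)] at h
  rw [abs_mul]
  have h1 : |y| ≤ 1 + y ^ 2 := by nlinarith [sq_abs y, sq_nonneg (|y| - 1), abs_nonneg y]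
  calc |y| * |a| ≤ (1 + y ^ 2) * |a| := by gcongr
    _ ≤ C := by linarith

theorem momentum_sub {C C' : ℝ} {f g : ℝ → ℝ} (h : DecayingProfile C f)
    (h' : DecayingProfile C' g) (y : ℝ) :
    momentum (f - g) y = momentum f y - momentum g y := by
  have e1 : deriv (f - g) = deriv f - deriv g :=
    funext fun y => ((h.hasDerivAt y).sub (h'.hasDerivAt y)).deriv
  simp only [momentum, e1, Pi.sub_apply,
    ((h.hasDerivAt_deriv y).sub (h'.hasDerivAt_deriv y)).deriv]
  ring

theorem integrable_decay_mul {f u : ℝ → ℝ} {C K : ℝ} (hf : Continuous f)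
    (hC : ∀ y, |f y| ≤ C * (1 + y ^ 2)⁻¹) (hu : Continuous u) (hK : ∀ y, |u y| ≤ K) :
    Integrable fun y => f y * u y :=
  (integrable_of_decay hf.aestronglyMeasurable hC).mul_bdd hu.aestronglyMeasurable (ae_of_all _ hK)

/-- Pairing a profile with a momentum is the `H¹` inner product; in particular it is symmetric. -/
theorem integral_mul_momentum {C C' : ℝ} {u w : ℝ → ℝ} (hu : DecayingProfile C u)
    (hw : DecayingProfile C' w) :
    ∫ y, u y * momentum w y = ∫ y, (u y * w y + deriv u y * deriv w y) := by
  have b0 := fun y => le_of_decay (hw.le_zero y)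
  have b1 := fun y => le_of_decay (hw.le_one y)
  have b2 := fun y => le_of_decay (hw.le_two y)
  have i00 := integrable_decay_mul hu.continuous_zero hu.le_zero hw.continuous_zero b0
  have i01 := integrable_decay_mul hu.continuous_zero hu.le_zero hw.continuous_one b1
  have i02 := integrable_decay_mul hu.continuous_zero hu.le_zero hw.continuous_two b2
  have i11 := integrable_decay_mul hu.continuous_one hu.le_one hw.continuous_one b1
  have key := integral_eq_zero_of_hasDerivAt_of_integrable
    (fun y => (hu.hasDerivAt y).mul (hw.hasDerivAt_deriv y)) (i11.add i02) i01
  have : ∫ y, (u y * momentum w y - (u y * w y + deriv u y * deriv w y)) = 0 := by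
    rw [← neg_eq_zero, ← integral_neg, ← key]
    refine integral_congr_ae (ae_of_all _ fun y => ?_)
    simp only [momentum]
    ring
  have im : Integrable fun y => u y * momentum w y := by
    simp only [momentum, mul_sub]
    exact i00.sub i02
  rw [integral_sub (f := fun y => u y * momentum w y) im
    (show Integrable fun y => u y * w y + deriv u y * deriv w y from i00.add i11)] at this
  linarith

section TestedRHS

variable {C K : ℝ} {f ψ : ℝ → ℝ}

theorem testedRHS_integrand_eq (hf : DecayingProfile C f) (hψ : Differentiable ℝ ψ) (y : ℝ) :
    (-4 * f y ^ 2 + 4 * f y * deriv (deriv f) y - y * deriv f y * deriv (deriv f) y) * ψ y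
      - deriv (fun x => x * f x * ψ x) y * deriv (deriv f) y
    = (-4 * f y ^ 2 + 3 * f y * deriv (deriv f) y - 2 * y * deriv f y * deriv (deriv f) y) * ψ y
      - y * f y * deriv (deriv f) y * deriv ψ y := by
  have h := ((hasDerivAt_id y).mul (hf.hasDerivAt y)).mul (hψ y).hasDerivAt
  rw [show (fun x => x * f x * ψ x) = id * f * ψ from rfl, h.deriv]
  simp only [id, Pi.mul_apply]
  ring

theorem testedRHS_eq (hf : DecayingProfile C f) (hψ : Differentiable ℝ ψ) :
    testedRHS f ψ = ∫ y, ((-4 * f y ^ 2 + 3 * f y * deriv (deriv f) y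
      - 2 * y * deriv f y * deriv (deriv f) y) * ψ y
      - y * f y * deriv (deriv f) y * deriv ψ y) :=
  integral_congr_ae (ae_of_all _ fun y => testedRHS_integrand_eq hf hψ y)

theorem abs_testedRHS_integrand_le (hf : DecayingProfile C f) {y a b : ℝ} (ha : |a| ≤ K)
    (hb : |b| ≤ K) :
    |(-4 * f y ^ 2 + 3 * f y * deriv (deriv f) y - 2 * y * deriv f y * deriv (deriv f) y) * a
      - y * f y * deriv (deriv f) y * b| ≤ 10 * C ^ 2 * K * (1 + y ^ 2)⁻¹ := by
  have hC := hf.nonneg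
  have hK : 0 ≤ K := (abs_nonneg _).trans ha
  have h0 := le_of_decay (hf.le_zero y)
  have h1 := abs_mul_le_of_decay (hf.le_one y)
  have h0' := abs_mul_le_of_decay (hf.le_zero y)
  have d0 := hf.le_zero y
  have d2 := hf.le_two y
  set w := (1 + y ^ 2)⁻¹
  have hw : 0 ≤ w := by positivity
  have e1 : |-4 * f y ^ 2| ≤ 4 * C ^ 2 * w := by
    rw [show -4 * f y ^ 2 = -(4 * (f y * f y)) by ring, abs_neg, abs_mul, abs_mul (f y),
      abs_of_pos (by norm_num : (0 : ℝ) < 4)]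
    nlinarith [mul_le_mul h0 d0 (abs_nonneg _) hC]
  have e2 : |3 * f y * deriv (deriv f) y| ≤ 3 * C ^ 2 * w := by
    rw [abs_mul, abs_mul, abs_of_pos (by norm_num : (0 : ℝ) < 3)]
    nlinarith [mul_le_mul h0 d2 (abs_nonneg _) hC]
  have e3 : |2 * y * deriv f y * deriv (deriv f) y| ≤ 2 * C ^ 2 * w := by
    rw [show 2 * y * deriv f y * deriv (deriv f) y
      = 2 * ((y * deriv f y) * deriv (deriv f) y) by ring, abs_mul, abs_mul (y * _),
      abs_of_pos (by norm_num : (0 : ℝ) < 2)]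
    nlinarith [mul_le_mul h1 d2 (abs_nonneg _) hC]
  have e4 : |y * f y * deriv (deriv f) y| ≤ C ^ 2 * w := by
    rw [abs_mul]
    nlinarith [mul_le_mul h0' d2 (abs_nonneg _) hC]
  have e5 : |-4 * f y ^ 2 + 3 * f y * deriv (deriv f) y
      - 2 * y * deriv f y * deriv (deriv f) y| ≤ 9 * C ^ 2 * w :=
    (abs_sub _ _).trans (by linarith [abs_add_le (-4 * f y ^ 2) (3 * f y * deriv (deriv f) y)])
  refine (abs_sub _ _).trans ?_
  rw [abs_mul, abs_mul _ b]
  have := mul_le_mul e5 ha (abs_nonneg _) (by positivity)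
  have := mul_le_mul e4 hb (abs_nonneg _) (by positivity)
  nlinarith

theorem continuous_testedRHS_integrand (hf : DecayingProfile C f) (hψ : ContDiff ℝ 1 ψ) :
    Continuous fun y => (-4 * f y ^ 2 + 3 * f y * deriv (deriv f) y
      - 2 * y * deriv f y * deriv (deriv f) y) * ψ y
      - y * f y * deriv (deriv f) y * deriv ψ y := by
  have h0 := hf.continuous_zero
  have h1 := hf.continuous_one
  have h2 := hf.continuous_two
  have h3 := hψ.continuous
  have h4 := hψ.continuous_deriv le_rfl
  fun_prop

theorem integrable_testedRHS_integrand (hf : DecayingProfile C f) (hψ : ContDiff ℝ 1 ψ)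
    (h0 : ∀ y, |ψ y| ≤ K) (h1 : ∀ y, |deriv ψ y| ≤ K) :
    Integrable fun y => (-4 * f y ^ 2 + 3 * f y * deriv (deriv f) y
      - 2 * y * deriv f y * deriv (deriv f) y) * ψ y
      - y * f y * deriv (deriv f) y * deriv ψ y :=
  integrable_of_decay (continuous_testedRHS_integrand hf hψ).aestronglyMeasurable
    fun y => abs_testedRHS_integrand_le hf (h0 y) (h1 y)

theorem abs_testedRHS_le (hf : DecayingProfile C f) (hψ : ContDiff ℝ 1 ψ)
    (h0 : ∀ y, |ψ y| ≤ K) (h1 : ∀ y, |deriv ψ y| ≤ K) :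
    |testedRHS f ψ| ≤ 10 * C ^ 2 * K * Real.pi := by
  rw [testedRHS_eq hf (hψ.differentiable (by norm_num)), ← Real.norm_eq_abs]
  refine (norm_integral_le_of_norm_le (integrable_inv_one_add_sq.const_mul _)
    (ae_of_all _ fun y => abs_testedRHS_integrand_le hf (h0 y) (h1 y))).trans_eq ?_
  rw [integral_const_mul, integral_univ_inv_one_add_sq]

end TestedRHS

/-- The energy estimate: the difference of two right-hand sides, tested against the difference
of the profiles, is controlled by the squared `H¹` norm of that difference. The second
derivatives of the difference are removed by one integration by parts. -/
theorem abs_testedRHS_sub_le {C : ℝ} {f₁ f₂ : ℝ → ℝ} (h₁ : DecayingProfile C f₁)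
    (h₂ : DecayingProfile C f₂) :
    |testedRHS f₁ (f₁ - f₂) - testedRHS f₂ (f₁ - f₂)| ≤
      20 * C * ∫ y, ((f₁ - f₂) y * (f₁ - f₂) y + deriv (f₁ - f₂) y * deriv (f₁ - f₂) y) := by
  have hv := h₁.sub h₂
  have hC := h₁.nonneg
  set v := f₁ - f₂ with hv_def
  have hv1 : ContDiff ℝ 1 v := hv.contDiff.of_le (by norm_num)
  have e1 : deriv v = deriv f₁ - deriv f₂ :=
    funext fun y => ((h₁.hasDerivAt y).sub (h₂.hasDerivAt y)).deriv
  have e2 : deriv (deriv v) = deriv (deriv f₁) - deriv (deriv f₂) := by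
    rw [e1]
    exact funext fun y => ((h₁.hasDerivAt_deriv y).sub (h₂.hasDerivAt_deriv y)).deriv
  have i1 := integrable_testedRHS_integrand h₁ hv1 (fun y => le_of_decay (hv.le_zero y))
    (fun y => le_of_decay (hv.le_one y))
  have i2 := integrable_testedRHS_integrand h₂ hv1 (fun y => le_of_decay (hv.le_zero y))
    (fun y => le_of_decay (hv.le_one y))
  have ha := h₁.continuous_zero
  have ha1 := h₁.continuous_one
  have ha2 := h₁.continuous_two
  have hb := h₂.continuous_zero
  have hb1 := h₂.continuous_one
  have hb2 := h₂.continuous_two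
  have hvc := hv.continuous_zero
  have hvc1 := hv.continuous_one
  have hvc2 := hv.continuous_two
  -- the flux removed by the integration by parts
  set Q : ℝ → ℝ := fun y => 3 * f₂ y * v y * deriv v y
    - y * v y * (deriv f₁ y ^ 2 - deriv f₂ y ^ 2) - 1 / 2 * (y * f₂ y * deriv v y ^ 2) with hQ
  set R : ℝ → ℝ := fun y => -4 * v y ^ 2 * (f₁ y + f₂ y) + 3 * v y ^ 2 * deriv (deriv f₁) y
    - 3 * deriv f₂ y * v y * deriv v y - 3 * f₂ y * deriv v y ^ 2
    + (v y + y * deriv v y) * deriv v y * (deriv f₁ y + deriv f₂ y)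
    - y * v y * deriv v y * deriv (deriv f₁) y
    + 1 / 2 * (f₂ y + y * deriv f₂ y) * deriv v y ^ 2 with hR
  have hR_le : ∀ y, |R y| ≤ 20 * C * (v y * v y + deriv v y * deriv v y) := fun y => by
    have a0 := abs_le.1 (le_of_decay (h₁.le_zero y))
    have a2 := abs_le.1 (le_of_decay (h₁.le_two y))
    have a1 := abs_le.1 (le_of_decay (h₁.le_one y))
    have b0 := abs_le.1 (le_of_decay (h₂.le_zero y))
    have b1 := abs_le.1 (le_of_decay (h₂.le_one y))
    have ya1 := abs_le.1 (abs_mul_le_of_decay (h₁.le_one y))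
    have ya2 := abs_le.1 (abs_mul_le_of_decay (h₁.le_two y))
    have yb1 := abs_le.1 (abs_mul_le_of_decay (h₂.le_one y))
    have hsplit : R y = (-4 * (f₁ y + f₂ y) + 3 * deriv (deriv f₁) y) * v y ^ 2
        + (-3 * deriv f₂ y + (deriv f₁ y + deriv f₂ y) - y * deriv (deriv f₁) y)
          * (v y * deriv v y)
        + (-3 * f₂ y + (y * deriv f₁ y + y * deriv f₂ y)
          + 1 / 2 * (f₂ y + y * deriv f₂ y)) * deriv v y ^ 2 := by
      simp only [hR]; ring
    have c1 : |-4 * (f₁ y + f₂ y) + 3 * deriv (deriv f₁) y| ≤ 11 * C :=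
      abs_le.2 ⟨by linarith, by linarith⟩
    have c2 : |-3 * deriv f₂ y + (deriv f₁ y + deriv f₂ y) - y * deriv (deriv f₁) y| ≤ 6 * C :=
      abs_le.2 ⟨by linarith, by linarith⟩
    have c3 : |-3 * f₂ y + (y * deriv f₁ y + y * deriv f₂ y)
        + 1 / 2 * (f₂ y + y * deriv f₂ y)| ≤ 6 * C :=
      abs_le.2 ⟨by linarith, by linarith⟩
    have c4 : |v y * deriv v y| ≤ (v y ^ 2 + deriv v y ^ 2) / 2 := by
      rw [abs_le]
      constructor <;> nlinarith [sq_nonneg (v y - deriv v y), sq_nonneg (v y + deriv v y)]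
    rw [hsplit]
    refine (abs_add_three _ _ _).trans ?_
    rw [abs_mul _ (v y ^ 2), abs_mul _ (v y * deriv v y), abs_mul _ (deriv v y ^ 2),
      abs_of_nonneg (sq_nonneg (v y)), abs_of_nonneg (sq_nonneg (deriv v y))]
    have d1 := mul_le_mul_of_nonneg_right c1 (sq_nonneg (v y))
    have d2 := mul_le_mul c2 c4 (abs_nonneg _) (by positivity)
    have d3 := mul_le_mul_of_nonneg_right c3 (sq_nonneg (deriv v y))
    have d4 := mul_nonneg hC (sq_nonneg (v y))
    have d5 := mul_nonneg hC (sq_nonneg (deriv v y))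
    nlinarith
  have hvv : Integrable fun y => v y * v y + deriv v y * deriv v y :=
    (integrable_decay_mul hvc hv.le_zero hvc fun y => le_of_decay (hv.le_zero y)).add
      (integrable_decay_mul hvc1 hv.le_one hvc1 fun y => le_of_decay (hv.le_one y))
  have iR : Integrable R :=
    (hvv.const_mul (20 * C)).mono' (by simp only [hR]; fun_prop) (ae_of_all _ hR_le)
  have iQ : Integrable Q := by
    have q1 := integrable_decay_mul hvc hv.le_zero
      (u := fun y => 3 * f₂ y * deriv v y - (y * deriv f₁ y * deriv f₁ y
        - y * deriv f₂ y * deriv f₂ y)) (K := 3 * C * (C + C) + (C * C + C * C))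
      (by fun_prop) fun y => by
        have b0 := le_of_decay (h₂.le_zero y)
        have a1 := le_of_decay (h₁.le_one y)
        have b1 := le_of_decay (h₂.le_one y)
        have v1 := le_of_decay (hv.le_one y)
        have ya1 := abs_mul_le_of_decay (h₁.le_one y)
        have yb1 := abs_mul_le_of_decay (h₂.le_one y)
        refine (abs_sub _ _).trans (add_le_add ?_ ((abs_sub _ _).trans (add_le_add ?_ ?_)))
        · rw [abs_mul, abs_mul, abs_of_nonneg (by norm_num : (0 : ℝ) ≤ 3)]
          gcongr
        · rw [abs_mul]; gcongr
        · rw [abs_mul]; gcongr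
    have q2 := integrable_decay_mul hvc1 hv.le_one
      (u := fun y => y * f₂ y * deriv v y) (K := C * (C + C)) (by fun_prop) fun y => by
        have b0 := abs_mul_le_of_decay (h₂.le_zero y)
        have v1 := le_of_decay (hv.le_one y)
        rw [abs_mul]; gcongr
    refine (q1.sub (q2.const_mul (1 / 2))).congr (ae_of_all _ fun y => ?_)
    simp only [hQ, Pi.sub_apply]
    ring
  set I : ℝ → ℝ := fun y => ((-4 * f₁ y ^ 2 + 3 * f₁ y * deriv (deriv f₁) y
      - 2 * y * deriv f₁ y * deriv (deriv f₁) y) * v y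
      - y * f₁ y * deriv (deriv f₁) y * deriv v y)
      - ((-4 * f₂ y ^ 2 + 3 * f₂ y * deriv (deriv f₂) y
      - 2 * y * deriv f₂ y * deriv (deriv f₂) y) * v y
      - y * f₂ y * deriv (deriv f₂) y * deriv v y) with hI
  have iI : Integrable I := i1.sub i2
  have hQ' : ∀ y, HasDerivAt Q (I y - R y) y := fun y => by
    have hy := hasDerivAt_id y
    have t1 := (((h₂.hasDerivAt y).const_mul 3).mul (hv.hasDerivAt y)).mul (hv.hasDerivAt_deriv y)
    have t2 := (hy.mul (hv.hasDerivAt y)).mul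
      (((h₁.hasDerivAt_deriv y).pow 2).sub ((h₂.hasDerivAt_deriv y).pow 2))
    have t3 := ((hy.mul (h₂.hasDerivAt y)).mul ((hv.hasDerivAt_deriv y).pow 2)).const_mul (1 / 2)
    refine ((t1.sub t2).sub t3).congr_deriv ?_
    have E0 : v y = f₁ y - f₂ y := rfl
    have E1 : deriv v y = deriv f₁ y - deriv f₂ y := by rw [e1]; rfl
    have E2 : deriv (deriv v) y = deriv (deriv f₁) y - deriv (deriv f₂) y := by rw [e2]; rfl
    simp only [hI, hR, E2, E1, E0, Pi.sub_apply, Pi.mul_apply, Pi.pow_apply, id]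
    push_cast
    ring
  have hzero := integral_eq_zero_of_hasDerivAt_of_integrable hQ' (iI.sub iR) iQ
  rw [integral_sub iI iR, sub_eq_zero] at hzero
  have hdiff : Differentiable ℝ v := hv1.differentiable (by norm_num)
  rw [testedRHS_eq h₁ hdiff, testedRHS_eq h₂ hdiff, ← integral_sub i1 i2]
  change |∫ y, I y| ≤ _
  rw [hzero, ← integral_const_mul, ← Real.norm_eq_abs]
  exact norm_integral_le_of_norm_le (hvv.const_mul _) (ae_of_all _ hR_le)

/-! ### The integrated weak form against non-compactly supported tests -/

/-- A family of profiles, jointly continuous with two spatial derivatives and decaying uniformly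
on a set `S` of times. -/
structure ProfileFamily (S : Set ℝ) (C : ℝ) (g : ℝ → ℝ → ℝ) : Prop where
  profile : ∀ t ∈ S, DecayingProfile C (g t)
  cont_zero : ContinuousOn (fun p : ℝ × ℝ => g p.1 p.2) (S ×ˢ univ)
  cont_one : ContinuousOn (fun p : ℝ × ℝ => deriv (g p.1) p.2) (S ×ˢ univ)
  cont_two : ContinuousOn (fun p : ℝ × ℝ => deriv (deriv (g p.1)) p.2) (S ×ˢ univ)

/-- A family of `C¹` test functions, jointly continuous with its spatial derivative and bounded
uniformly on a set `S` of times. -/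
structure TestFamily (S : Set ℝ) (K : ℝ) (u : ℝ → ℝ → ℝ) : Prop where
  contDiff : ∀ t ∈ S, ContDiff ℝ 1 (u t)
  le_zero : ∀ t ∈ S, ∀ y, |u t y| ≤ K
  le_one : ∀ t ∈ S, ∀ y, |deriv (u t) y| ≤ K
  cont_zero : ContinuousOn (fun p : ℝ × ℝ => u p.1 p.2) (S ×ˢ univ)
  cont_one : ContinuousOn (fun p : ℝ × ℝ => deriv (u p.1) p.2) (S ×ˢ univ)

theorem TestFamily.const {ψ : ℝ → ℝ} {K : ℝ} (hψ : ContDiff ℝ 1 ψ) (h0 : ∀ y, |ψ y| ≤ K)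
    (h1 : ∀ y, |deriv ψ y| ≤ K) (S : Set ℝ) : TestFamily S K fun _ => ψ := by
  have c0 := hψ.continuous
  have c1 := hψ.continuous_deriv le_rfl
  exact ⟨fun _ _ => hψ, fun _ _ => h0, fun _ _ => h1, by fun_prop, by fun_prop⟩

theorem continuousOn_slice {S : Set ℝ} {h : ℝ → ℝ → ℝ}
    (hh : ContinuousOn (fun p : ℝ × ℝ => h p.1 p.2) (S ×ˢ univ)) (y : ℝ) {f : ℝ × ℝ → ℝ}
    (hf : Continuous f) {A : Set (ℝ × ℝ)} (hA : MapsTo f A S) :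
    ContinuousOn (fun p : ℝ × ℝ => h (f p) y) A :=
  hh.comp (f := fun p : ℝ × ℝ => (f p, y)) (by fun_prop) fun _ hp => ⟨hA hp, mem_univ _⟩

/-- Joint continuity of the tested right-hand side in the time of the test function and the time
of the profile. -/
theorem continuousOn_testedRHS {S S' : Set ℝ} {C K : ℝ} {g u : ℝ → ℝ → ℝ}
    (hg : ProfileFamily S C g) (hu : TestFamily S' K u) :
    ContinuousOn (fun p : ℝ × ℝ => testedRHS (g p.2) (u p.1)) (S' ×ˢ S) := by
  have : ContinuousOn (fun p : ℝ × ℝ => ∫ y, ((-4 * g p.2 y ^ 2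
      + 3 * g p.2 y * deriv (deriv (g p.2)) y
      - 2 * y * deriv (g p.2) y * deriv (deriv (g p.2)) y) * u p.1 y
      - y * g p.2 y * deriv (deriv (g p.2)) y * deriv (u p.1) y)) (S' ×ˢ S) := by
    refine continuousOn_of_dominated (bound := fun y => 10 * C ^ 2 * K * (1 + y ^ 2)⁻¹)
      (fun p hp => ?_) (fun p hp => ae_of_all _ fun y => ?_)
      (integrable_inv_one_add_sq.const_mul _) (ae_of_all _ fun y => ?_)
    · exact (continuous_testedRHS_integrand (hg.profile _ hp.2)
        (hu.contDiff _ hp.1)).aestronglyMeasurable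
    · exact abs_testedRHS_integrand_le (hg.profile _ hp.2) (hu.le_zero _ hp.1 y)
        (hu.le_one _ hp.1 y)
    · have m1 : MapsTo (Prod.fst : ℝ × ℝ → ℝ) (S' ×ˢ S) S' := fun p hp => hp.1
      have m2 : MapsTo (Prod.snd : ℝ × ℝ → ℝ) (S' ×ˢ S) S := fun p hp => hp.2
      have c0 := continuousOn_slice hg.cont_zero y continuous_snd m2
      have c1 := continuousOn_slice (h := fun t => deriv (g t)) hg.cont_one y
        continuous_snd m2
      have c2 := continuousOn_slice (h := fun t => deriv (deriv (g t))) hg.cont_two y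
        continuous_snd m2
      have d0 := continuousOn_slice hu.cont_zero y continuous_fst m1
      have d1 := continuousOn_slice (h := fun t => deriv (u t)) hu.cont_one y
        continuous_fst m1
      exact ((((continuousOn_const.mul (c0.pow 2)).add
        ((continuousOn_const.mul c0).mul c2)).sub ((continuousOn_const.mul c1).mul c2)).mul
        d0).sub (((continuousOn_const.mul c0).mul c2).mul d1)
  refine this.congr fun p hp => ?_
  exact testedRHS_eq (hg.profile _ hp.2) ((hu.contDiff _ hp.1).differentiable (by norm_num))

theorem continuousOn_testedRHS_const {S : Set ℝ} {C K : ℝ} {g : ℝ → ℝ → ℝ} {ψ : ℝ → ℝ}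
    (hg : ProfileFamily S C g) (hψ : ContDiff ℝ 1 ψ) (h0 : ∀ y, |ψ y| ≤ K)
    (h1 : ∀ y, |deriv ψ y| ≤ K) : ContinuousOn (fun s => testedRHS (g s) ψ) S :=
  (continuousOn_testedRHS hg (TestFamily.const hψ h0 h1 univ)).comp
    (f := fun s : ℝ => ((0 : ℝ), s)) (by fun_prop) fun _ hs => ⟨mem_univ _, hs⟩

theorem DecayingProfile.abs_momentum_le {C : ℝ} {f : ℝ → ℝ} (h : DecayingProfile C f) (y : ℝ) :
    |momentum f y| ≤ 2 * C * (1 + y ^ 2)⁻¹ :=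
  (abs_sub _ _).trans (by linarith [h.le_zero y, h.le_two y])

theorem DecayingProfile.continuous_momentum {C : ℝ} {f : ℝ → ℝ} (h : DecayingProfile C f) :
    Continuous (momentum f) := h.continuous_zero.sub h.continuous_two

theorem decayingProfile_greenPotential {φ : ℝ → ℝ} {M : ℝ} (hφ : Continuous φ)
    (h : ∀ y, |φ y| ≤ M * (1 + y ^ 2)⁻¹) :
    DecayingProfile ((decayConst + 1) * M) (greenPotential φ) := by
  have hM : 0 ≤ M := by simpa using (abs_nonneg _).trans (h 0)
  have hb := fun y => le_of_decay (h y)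
  have e1 := deriv_greenPotential hφ hb
  refine ⟨contDiff_greenPotential hφ hb, fun y => ?_, fun y => ?_, fun y => ?_⟩
  · refine (abs_greenPotential_le_of_decay hφ h y).trans ?_
    gcongr
    linarith
  · rw [e1]
    refine (abs_greenDeriv_le_of_decay hφ h y).trans ?_
    gcongr
    linarith
  · rw [deriv_deriv_greenPotential hφ hb]
    refine (abs_sub _ _).trans ((add_le_add (abs_greenPotential_le_of_decay hφ h y)
      (h y)).trans_eq ?_)
    ring

/-- The solution restricted to a compact time interval is a uniformly decaying family. -/
theorem IsSolutionOn.exists_profileFamily {I : Set ℝ} {g : ℝ → ℝ → ℝ} (hg : IsSolutionOn I g)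
    {τ : ℝ} (hτ : τ ∈ I) (hI : Icc 0 τ ⊆ I) : ∃ C, ProfileFamily (Icc 0 τ) C g := by
  obtain ⟨M, hM⟩ := hg.decay τ hτ
  have c0 := hg.continuousOn.mono (prod_mono_left (t := univ) hI)
  have c1 := hg.continuousOn_deriv.mono (prod_mono_left (t := univ) hI)
  have c2 := hg.continuousOn_deriv_deriv.mono (prod_mono_left (t := univ) hI)
  have cm : ContinuousOn (fun p : ℝ × ℝ => momentum (g p.1) p.2) (Icc 0 τ ×ˢ univ) := c0.sub c2
  obtain ⟨M', hM'⟩ := (isCompact_Icc (a := (0 : ℝ)) (b := τ)).prod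
    (isCompact_Icc (a := (-1 : ℝ)) (b := 1)) |>.exists_bound_of_continuousOn
    (cm.mono (prod_mono_right (subset_univ _)))
  have hφ : ∀ t ∈ Icc 0 τ, ∀ y, |momentum (g t) y| ≤ 2 * (|M| + |M'|) * (1 + y ^ 2)⁻¹ :=
    fun t ht y => abs_le_of_sq_mul_abs_le (hM t (hI ht) ht.2 y) fun hy =>
      hM' (t, y) ⟨ht, abs_le.1 hy⟩
  have hcont : ∀ t ∈ Icc 0 τ, Continuous (momentum (g t)) := fun t ht =>
    (cm.comp_continuous (f := fun y : ℝ => (t, y)) (by fun_prop) fun y => ⟨ht, mem_univ _⟩)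
  refine ⟨(decayConst + 1) * (2 * (|M| + |M'|)), fun t ht => ?_, c0, c1, c2⟩
  rw [show g t = greenPotential (momentum (g t)) from funext (hg.eq_potential t (hI ht))]
  exact decayingProfile_greenPotential (hcont t ht) (hφ t ht)

/-- The equation in integrated form, for compactly supported test functions. -/
theorem IsSolutionOn.integral_testedRHS_of_hasCompactSupport {T τ C K : ℝ} {g : ℝ → ℝ → ℝ}
    (hg : IsSolutionOn (Ico 0 T) g) (hτ : τ < T) (hC : ProfileFamily (Icc 0 τ) C g)
    {ψ : ℝ → ℝ} (hψ : ContDiff ℝ 1 ψ) (hc : HasCompactSupport ψ) (h0 : ∀ y, |ψ y| ≤ K)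
    (h1 : ∀ y, |deriv ψ y| ≤ K) {s₁ s₂ : ℝ} (hs₁ : 0 ≤ s₁) (hs : s₁ ≤ s₂) (hs₂ : s₂ ≤ τ) :
    ∫ s in s₁..s₂, testedRHS (g s) ψ =
      (∫ y, momentum (g s₂) y * ψ y) - ∫ y, momentum (g s₁) y * ψ y := by
  have hd := hg.equation ψ hψ hc
  have hsub : Icc s₁ s₂ ⊆ Icc 0 τ := Icc_subset_Icc hs₁ hs₂
  have hmem : ∀ s ∈ Icc s₁ s₂, s ∈ Ico 0 T := fun s h => ⟨hs₁.trans h.1, by linarith [h.2]⟩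
  refine intervalIntegral.integral_eq_sub_of_hasDeriv_right_of_le
    (f := fun s => ∫ y, momentum (g s) y * ψ y) hs (fun s h => ?_) (fun s h => ?_) ?_
  · exact ((hd s (hmem s h)).continuousWithinAt).mono hmem
  · refine (hd s (hmem s (Ioo_subset_Icc_self h))).mono_of_mem_nhdsWithin ?_
    refine mem_of_superset (Ioo_mem_nhdsGT (show s < T by linarith [h.2])) fun r hr => ?_
    exact ⟨by linarith [h.1, hr.1], hr.2⟩
  · refine ContinuousOn.intervalIntegrable ?_
    rw [uIcc_of_le hs]
    exact (continuousOn_testedRHS_const hC hψ h0 h1).mono hsub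

/-- The equation in integrated form, for bounded test functions with bounded derivative: the
compact support is removed by a cut-off at scale `n → ∞`. -/
theorem IsSolutionOn.integral_testedRHS {T τ C K : ℝ} {g : ℝ → ℝ → ℝ}
    (hg : IsSolutionOn (Ico 0 T) g) (hτ : τ < T) (hC : ProfileFamily (Icc 0 τ) C g)
    {ψ : ℝ → ℝ} (hψ : ContDiff ℝ 1 ψ) (h0 : ∀ y, |ψ y| ≤ K)
    (h1 : ∀ y, |deriv ψ y| ≤ K) {s₁ s₂ : ℝ} (hs₁ : 0 ≤ s₁) (hs : s₁ ≤ s₂) (hs₂ : s₂ ≤ τ) :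
    ∫ s in s₁..s₂, testedRHS (g s) ψ =
      (∫ y, momentum (g s₂) y * ψ y) - ∫ y, momentum (g s₁) y * ψ y := by
  have hK : 0 ≤ K := (abs_nonneg _).trans (h0 0)
  let χ : ContDiffBump (0 : ℝ) := ⟨1, 2, by norm_num, by norm_num⟩
  have hχ : ContDiff ℝ 1 (χ : ℝ → ℝ) := χ.contDiff
  obtain ⟨D, hD⟩ := (χ.hasCompactSupport.deriv).exists_bound_of_continuous
    (hχ.continuous_deriv le_rfl)
  simp only [Real.norm_eq_abs] at hD
  have hD0 : 0 ≤ D := (abs_nonneg _).trans (hD 0)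
  have hχ1 : ∀ y, |χ y| ≤ 1 := fun y => by rw [abs_of_nonneg χ.nonneg]; exact χ.le_one
  set ε : ℕ → ℝ := fun n => 1 / ((n : ℝ) + 1) with hε
  have hε0 : ∀ n, 0 < ε n := fun n => by simp only [hε]; positivity
  have hε1 : ∀ n, ε n ≤ 1 := fun n => by
    simp only [hε]
    rw [div_le_one (by positivity)]
    linarith [(Nat.cast_nonneg n : (0 : ℝ) ≤ n)]
  have hεt : Tendsto ε atTop (𝓝 0) := tendsto_one_div_add_atTop_nhds_zero_nat
  set Ψ : ℕ → ℝ → ℝ := fun n y => ψ y * χ (ε n * y) with hΨ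
  have hΨd : ∀ n y, HasDerivAt (Ψ n) (deriv ψ y * χ (ε n * y)
      + ψ y * (deriv χ (ε n * y) * ε n)) y := fun n y => by
    have a := (hψ.differentiable (by norm_num) y).hasDerivAt
    have b := (hχ.differentiable (by norm_num) (ε n * y)).hasDerivAt
    have c : HasDerivAt (fun y => ε n * y) (ε n) y := by
      simpa using (hasDerivAt_id y).const_mul (ε n)
    exact a.mul (b.comp y c)
  have hΨ1 : ∀ n, ContDiff ℝ 1 (Ψ n) := fun n =>
    hψ.mul (hχ.comp (contDiff_const.mul contDiff_id))
  have hΨc : ∀ n, HasCompactSupport (Ψ n) := fun n => by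
    have := χ.hasCompactSupport.comp_homeomorph (Homeomorph.mulLeft₀ (ε n) (hε0 n).ne')
    exact HasCompactSupport.mul_left this
  have b0 : ∀ n y, |Ψ n y| ≤ K * (1 + D) := fun n y => by
    simp only [hΨ]
    rw [abs_mul]
    exact mul_le_mul (h0 y) ((hχ1 _).trans (by linarith)) (abs_nonneg _) hK
  have b1 : ∀ n y, |deriv (Ψ n) y| ≤ K * (1 + D) := fun n y => by
    rw [(hΨd n y).deriv]
    refine (abs_add_le _ _).trans ?_
    rw [abs_mul, abs_mul, abs_mul, abs_of_pos (hε0 n), mul_add]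
    gcongr
    · exact h1 y
    · exact hχ1 _
    · exact h0 y
    · calc |deriv χ (ε n * y)| * ε n ≤ D * 1 := by gcongr; exacts [hD _, hε1 n]
        _ = D := mul_one D
  have hsmall : ∀ y, Tendsto (fun n => ε n * y) atTop (𝓝 0) := fun y => by
    simpa using hεt.mul_const y
  have t0 : ∀ y, Tendsto (fun n => Ψ n y) atTop (𝓝 (ψ y)) := fun y => by
    have a : Tendsto (fun n => χ (ε n * y)) atTop (𝓝 (χ 0)) :=
      (hχ.continuous.tendsto 0).comp (hsmall y)
    rw [χ.one_of_mem_closedBall (by simp [χ])] at a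
    simpa using a.const_mul (ψ y)
  have t1 : ∀ y, Tendsto (fun n => deriv (Ψ n) y) atTop (𝓝 (deriv ψ y)) := fun y => by
    have a : Tendsto (fun n => χ (ε n * y)) atTop (𝓝 (χ 0)) :=
      (hχ.continuous.tendsto 0).comp (hsmall y)
    have b : Tendsto (fun n => deriv χ (ε n * y)) atTop (𝓝 (deriv χ 0)) :=
      ((hχ.continuous_deriv le_rfl).tendsto 0).comp (hsmall y)
    rw [χ.one_of_mem_closedBall (by simp [χ])] at a
    simpa [(hΨd _ y).deriv] using (a.const_mul (deriv ψ y)).add ((b.mul hεt).const_mul (ψ y))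
  have hP : ∀ s ∈ Icc 0 τ, DecayingProfile C (g s) := hC.profile
  have lim_l : ∀ s ∈ Icc 0 τ, Tendsto (fun n => ∫ y, momentum (g s) y * Ψ n y) atTop
      (𝓝 (∫ y, momentum (g s) y * ψ y)) := fun s hs' => by
    have hc := (hP s hs').continuous_momentum
    refine tendsto_integral_of_dominated_convergence
      (fun y => 2 * C * (K * (1 + D)) * (1 + y ^ 2)⁻¹)
      (fun n => (hc.mul (hΨ1 n).continuous).aestronglyMeasurable)
      (integrable_inv_one_add_sq.const_mul _) (fun n => ae_of_all _ fun y => ?_)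
      (ae_of_all _ fun y => (t0 y).const_mul _)
    rw [Real.norm_eq_abs, abs_mul]
    have := mul_le_mul ((hP s hs').abs_momentum_le y) (b0 n y) (abs_nonneg _)
      ((abs_nonneg _).trans ((hP s hs').abs_momentum_le y))
    linarith
  have lim_r : ∀ s ∈ Icc 0 τ, Tendsto (fun n => testedRHS (g s) (Ψ n)) atTop
      (𝓝 (testedRHS (g s) ψ)) := fun s hs' => by
    simp only [fun n => testedRHS_eq (hP s hs') ((hΨ1 n).differentiable (by norm_num)),
      testedRHS_eq (hP s hs') (hψ.differentiable (by norm_num))]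
    refine tendsto_integral_of_dominated_convergence
      (fun y => 10 * C ^ 2 * (K * (1 + D)) * (1 + y ^ 2)⁻¹)
      (fun n => (continuous_testedRHS_integrand (hP s hs') (hΨ1 n)).aestronglyMeasurable)
      (integrable_inv_one_add_sq.const_mul _)
      (fun n => ae_of_all _ fun y => abs_testedRHS_integrand_le (hP s hs') (b0 n y) (b1 n y))
      (ae_of_all _ fun y => ((t0 y).const_mul _).sub ((t1 y).const_mul _))
  have hsub : uIoc s₁ s₂ ⊆ Icc 0 τ := by
    rw [uIoc_of_le hs]
    exact Ioc_subset_Icc_self.trans (Icc_subset_Icc hs₁ hs₂)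
  have lim_int : Tendsto (fun n => ∫ s in s₁..s₂, testedRHS (g s) (Ψ n)) atTop
      (𝓝 (∫ s in s₁..s₂, testedRHS (g s) ψ)) := by
    refine intervalIntegral.tendsto_integral_filter_of_dominated_convergence
      (fun _ => 10 * C ^ 2 * (K * (1 + D)) * Real.pi) (Eventually.of_forall fun n => ?_)
      (Eventually.of_forall fun n => ae_of_all _ fun s hs' => ?_)
      intervalIntegrable_const (ae_of_all _ fun s hs' => lim_r s (hsub hs'))
    · exact ((continuousOn_testedRHS_const hC (hΨ1 n) (b0 n) (b1 n)).mono
        hsub).aestronglyMeasurable measurableSet_uIoc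
    · exact abs_testedRHS_le (hP s (hsub hs')) (hΨ1 n) (b0 n) (b1 n)
  refine tendsto_nhds_unique lim_int ?_
  simp only [fun n => hg.integral_testedRHS_of_hasCompactSupport hτ hC (hΨ1 n) (hΨc n) (b0 n)
    (b1 n) hs₁ hs hs₂]
  exact (lim_l s₂ ⟨hs₁.trans hs, hs₂⟩).sub (lim_l s₁ ⟨hs₁, hs.trans hs₂⟩)

/-! ### Uniqueness -/

theorem ProfileFamily.sub {S : Set ℝ} {C C' : ℝ} {g g' : ℝ → ℝ → ℝ} (h : ProfileFamily S C g)
    (h' : ProfileFamily S C' g') : ProfileFamily S (C + C') (fun t => g t - g' t) := by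
  have e1 : ∀ t ∈ S, deriv (g t - g' t) = deriv (g t) - deriv (g' t) := fun t ht =>
    funext fun y => (((h.profile t ht).hasDerivAt y).sub ((h'.profile t ht).hasDerivAt y)).deriv
  have e2 : ∀ t ∈ S, deriv (deriv (g t - g' t)) = deriv (deriv (g t)) - deriv (deriv (g' t)) :=
    fun t ht => by
      rw [e1 t ht]
      exact funext fun y => (((h.profile t ht).hasDerivAt_deriv y).sub
        ((h'.profile t ht).hasDerivAt_deriv y)).deriv
  refine ⟨fun t ht => (h.profile t ht).sub (h'.profile t ht), h.cont_zero.sub h'.cont_zero,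
    (h.cont_one.sub h'.cont_one).congr fun p hp => ?_,
    (h.cont_two.sub h'.cont_two).congr fun p hp => ?_⟩
  · rw [e1 _ hp.1]; rfl
  · rw [e2 _ hp.1]; rfl

theorem ProfileFamily.testFamily {S : Set ℝ} {C : ℝ} {g : ℝ → ℝ → ℝ} (h : ProfileFamily S C g) :
    TestFamily S C g :=
  ⟨fun t ht => (h.profile t ht).contDiff.of_le (by norm_num),
    fun t ht y => le_of_decay ((h.profile t ht).le_zero y),
    fun t ht y => le_of_decay ((h.profile t ht).le_one y), h.cont_zero, h.cont_one⟩

theorem DecayingProfile.weaken {C C' : ℝ} {f : ℝ → ℝ} (h : DecayingProfile C f) (hC : C ≤ C') :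
    DecayingProfile C' f := by
  refine ⟨h.contDiff, fun y => (h.le_zero y).trans ?_, fun y => (h.le_one y).trans ?_,
    fun y => (h.le_two y).trans ?_⟩ <;> gcongr

theorem ProfileFamily.weaken {S : Set ℝ} {C C' : ℝ} {g : ℝ → ℝ → ℝ} (h : ProfileFamily S C g)
    (hC : C ≤ C') : ProfileFamily S C' g :=
  ⟨fun t ht => (h.profile t ht).weaken hC, h.cont_zero, h.cont_one, h.cont_two⟩

/-- If `K` is continuous on the square `[0, τ]²`, the increments `∫ₜʳ (K r s + K t s) ds` have right
derivative `2 K t t` at `r = t`. -/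
theorem hasDerivWithinAt_of_eq_integral_diag {τ t : ℝ} {K : ℝ → ℝ → ℝ} {E : ℝ → ℝ}
    (hK : ContinuousOn (fun p : ℝ × ℝ => K p.1 p.2) (Icc 0 τ ×ˢ Icc 0 τ)) (ht : t ∈ Ico 0 τ)
    (hE : ∀ r ∈ Icc t τ, E r - E t = ∫ s in t..r, (K r s + K t s)) :
    HasDerivWithinAt E (2 * K t t) (Ici t) t := by
  rw [hasDerivWithinAt_iff_isLittleO, Asymptotics.isLittleO_iff]
  intro ε hε
  have htt : (t, t) ∈ Icc 0 τ ×ˢ Icc 0 τ := ⟨⟨ht.1, ht.2.le⟩, ⟨ht.1, ht.2.le⟩⟩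
  obtain ⟨δ, hδ, hball⟩ := Metric.continuousOn_iff.1 hK (t, t) htt (ε / 2) (half_pos hε)
  have hnear : Ico t (min τ (t + δ)) ∈ 𝓝[≥] t :=
    Ico_mem_nhdsGE (lt_min ht.2 (by linarith))
  filter_upwards [hnear] with r hr
  have hrτ : r < τ := hr.2.trans_le (min_le_left _ _)
  have hrδ : r < t + δ := hr.2.trans_le (min_le_right _ _)
  have hclose : ∀ a ∈ Icc t r, ∀ s ∈ Icc t r, |K a s - K t t| ≤ ε / 2 := fun a ha s hs => by
    have h := hball (a, s) ⟨⟨ht.1.trans ha.1, ha.2.trans hrτ.le⟩,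
      ⟨ht.1.trans hs.1, hs.2.trans hrτ.le⟩⟩ (by
        rw [Prod.dist_eq, max_lt_iff, Real.dist_eq, Real.dist_eq, abs_lt, abs_lt]
        simp only
        refine ⟨⟨?_, ?_⟩, ⟨?_, ?_⟩⟩ <;> linarith [ha.1, ha.2, hs.1, hs.2])
    rw [Real.dist_eq] at h
    exact h.le
  have hcont : ∀ a ∈ Icc t r, IntervalIntegrable (K a) volume t r := fun a ha => by
    refine ContinuousOn.intervalIntegrable ?_
    rw [uIcc_of_le hr.1]
    refine hK.comp (f := fun s : ℝ => (a, s)) (by fun_prop) fun s hs => ?_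
    exact ⟨⟨ht.1.trans ha.1, ha.2.trans hrτ.le⟩, ⟨ht.1.trans hs.1, hs.2.trans hrτ.le⟩⟩
  have hr_mem : r ∈ Icc t r := right_mem_Icc.2 hr.1
  have ht_mem : t ∈ Icc t r := left_mem_Icc.2 hr.1
  have hrew : E r - E t - (r - t) • (2 * K t t)
      = ∫ s in t..r, ((K r s + K t s) - 2 * K t t) := by
    rw [intervalIntegral.integral_sub ((hcont r hr_mem).add (hcont t ht_mem))
      intervalIntegrable_const, intervalIntegral.integral_const, hE r ⟨hr.1, hrτ.le⟩]
  rw [hrew]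
  refine intervalIntegral.norm_integral_le_of_norm_le_const fun s hs => ?_
  rw [uIoc_of_le hr.1] at hs
  have a := hclose r hr_mem s (Ioc_subset_Icc_self hs)
  have b := hclose t ht_mem s (Ioc_subset_Icc_self hs)
  rw [Real.norm_eq_abs, show K r s + K t s - 2 * K t t
    = (K r s - K t t) + (K t s - K t t) by ring]
  exact (abs_add_le _ _).trans (by linarith)

/-- Uniqueness: two solutions with the same initial data coincide. The squared `H¹` norm of the
difference satisfies a Grönwall inequality. -/
theorem IsSolutionOn.unique {T : ℝ} {g h : ℝ → ℝ → ℝ} (hg : IsSolutionOn (Ico 0 T) g)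
    (hh : IsSolutionOn (Ico 0 T) h) (h0 : g 0 = h 0) : ∀ t ∈ Ico 0 T, g t = h t := by
  intro τ hτ
  have hsub : Icc 0 τ ⊆ Ico 0 T := fun s hs => ⟨hs.1, hs.2.trans_lt hτ.2⟩
  obtain ⟨C₁, hC₁⟩ := hg.exists_profileFamily hτ hsub
  obtain ⟨C₂, hC₂⟩ := hh.exists_profileFamily hτ hsub
  set C := max C₁ C₂
  have pg : ProfileFamily (Icc 0 τ) C g := hC₁.weaken (le_max_left _ _)
  have ph : ProfileFamily (Icc 0 τ) C h := hC₂.weaken (le_max_right _ _)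
  set v : ℝ → ℝ → ℝ := fun t => g t - h t with hv_def
  have pv : ProfileFamily (Icc 0 τ) (C + C) v := pg.sub ph
  have tv := pv.testFamily
  set K : ℝ → ℝ → ℝ := fun t s => testedRHS (g s) (v t) - testedRHS (h s) (v t) with hK
  have cKg := continuousOn_testedRHS pg tv
  have cKh := continuousOn_testedRHS ph tv
  have cK : ContinuousOn (fun p : ℝ × ℝ => K p.1 p.2) (Icc 0 τ ×ˢ Icc 0 τ) := cKg.sub cKh
  -- the `H¹` pairing of the difference at two times
  set B : ℝ → ℝ → ℝ := fun t s => ∫ y, v t y * momentum (v s) y with hB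
  set E : ℝ → ℝ := fun t => B t t with hE
  have hE_eq : ∀ t ∈ Icc 0 τ, E t = ∫ y, (v t y * v t y + deriv (v t) y * deriv (v t) y) :=
    fun t ht => integral_mul_momentum (pv.profile t ht) (pv.profile t ht)
  have hsymm : ∀ t ∈ Icc 0 τ, ∀ s ∈ Icc 0 τ, B t s = B s t := fun t ht s hs => by
    simp only [hB]
    rw [integral_mul_momentum (pv.profile t ht) (pv.profile s hs),
      integral_mul_momentum (pv.profile s hs) (pv.profile t ht)]
    simp only [mul_comm]
  have hB_eq : ∀ t ∈ Icc 0 τ, ∀ s ∈ Icc 0 τ,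
      B t s = (∫ y, momentum (g s) y * v t y) - ∫ y, momentum (h s) y * v t y :=
    fun t ht s hs => by
      have i1 := integrable_decay_mul (pg.profile s hs).continuous_momentum
        (pg.profile s hs).abs_momentum_le (pv.profile t ht).continuous_zero
        (fun y => le_of_decay ((pv.profile t ht).le_zero y))
      have i2 := integrable_decay_mul (ph.profile s hs).continuous_momentum
        (ph.profile s hs).abs_momentum_le (pv.profile t ht).continuous_zero
        (fun y => le_of_decay ((pv.profile t ht).le_zero y))
      rw [← integral_sub i1 i2]
      refine integral_congr_ae (ae_of_all _ fun y => ?_)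
      simp only [hv_def, momentum_sub (pg.profile s hs) (ph.profile s hs)]
      ring
  have hslice : ∀ t ∈ Icc 0 τ, ∀ s₁ s₂, 0 ≤ s₁ → s₁ ≤ s₂ → s₂ ≤ τ →
      IntervalIntegrable (K t) volume s₁ s₂ ∧ B t s₂ - B t s₁ = ∫ s in s₁..s₂, K t s :=
    fun t ht s₁ s₂ h1 h2 h3 => by
      have hm : MapsTo (fun s : ℝ => (t, s)) (uIcc s₁ s₂) (Icc 0 τ ×ˢ Icc 0 τ) := fun s hs => by
        rw [uIcc_of_le h2] at hs
        exact ⟨ht, h1.trans hs.1, hs.2.trans h3⟩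
      have i1 : IntervalIntegrable (fun s => testedRHS (g s) (v t)) volume s₁ s₂ :=
        (cKg.comp (f := fun s : ℝ => (t, s)) (by fun_prop) hm).intervalIntegrable
      have i2 : IntervalIntegrable (fun s => testedRHS (h s) (v t)) volume s₁ s₂ :=
        (cKh.comp (f := fun s : ℝ => (t, s)) (by fun_prop) hm).intervalIntegrable
      refine ⟨i1.sub i2, ?_⟩
      simp only [hK]
      rw [intervalIntegral.integral_sub i1 i2,
        hg.integral_testedRHS hτ.2 pg (tv.contDiff t ht) (tv.le_zero t ht) (tv.le_one t ht) h1 h2 h3,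
        hh.integral_testedRHS hτ.2 ph (tv.contDiff t ht) (tv.le_zero t ht) (tv.le_one t ht) h1 h2 h3,
        hB_eq t ht s₂ ⟨h1.trans h2, h3⟩, hB_eq t ht s₁ ⟨h1, h2.trans h3⟩]
      ring
  -- `E r - E t = (B r r - B r t) + (B t r - B t t)` by symmetry
  have hinc : ∀ t ∈ Icc 0 τ, ∀ r ∈ Icc t τ, E r - E t = ∫ s in t..r, (K r s + K t s) :=
    fun t ht r hr => by
      have hr' : r ∈ Icc 0 τ := ⟨ht.1.trans hr.1, hr.2⟩
      obtain ⟨i1, e1⟩ := hslice r hr' t r ht.1 hr.1 hr.2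
      obtain ⟨i2, e2⟩ := hslice t ht t r ht.1 hr.1 hr.2
      rw [intervalIntegral.integral_add i1 i2, ← e1, ← e2, hsymm r hr' t ht]
      simp only [hE]
      ring
  have hEd : ∀ t ∈ Ico 0 τ, HasDerivWithinAt E (2 * K t t) (Ici t) t := fun t ht =>
    hasDerivWithinAt_of_eq_integral_diag cK ht (hinc t (Ico_subset_Icc_self ht))
  have hEc : ContinuousOn E (Icc 0 τ) := by
    have : ContinuousOn (fun t => ∫ y, (v t y * v t y + deriv (v t) y * deriv (v t) y))
        (Icc 0 τ) := by
      refine continuousOn_of_dominated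
        (bound := fun y => 2 * (C + C) * (C + C) * (1 + y ^ 2)⁻¹) (fun t ht => ?_)
        (fun t ht => ae_of_all _ fun y => ?_) (integrable_inv_one_add_sq.const_mul _)
        (ae_of_all _ fun y => ?_)
      · have c0 := (pv.profile t ht).continuous_zero
        have c1 := (pv.profile t ht).continuous_one
        exact (by fun_prop : Continuous _).aestronglyMeasurable
      · have p := pv.profile t ht
        have n := p.nonneg
        have a0 := mul_le_mul (le_of_decay (p.le_zero y)) (p.le_zero y) (abs_nonneg _) n
        have a1 := mul_le_mul (le_of_decay (p.le_one y)) (p.le_one y) (abs_nonneg _) n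
        refine (abs_add_le _ _).trans ?_
        rw [abs_mul, abs_mul]
        linarith
      · have hm : MapsTo (fun t : ℝ => (t, y)) (Icc 0 τ) (Icc 0 τ ×ˢ univ) :=
          fun t ht => ⟨ht, mem_univ _⟩
        have c0 := pv.cont_zero.comp (f := fun t : ℝ => (t, y)) (by fun_prop) hm
        have c1 := pv.cont_one.comp (f := fun t : ℝ => (t, y)) (by fun_prop) hm
        exact (c0.mul c0).add (c1.mul c1)
    exact this.congr hE_eq
  have hv0 : v 0 = 0 := by simp only [hv_def]; rw [h0, sub_self]
  have hE0 : E 0 = 0 := by simp [hE, hB, hv0]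
  have hE_nonneg : ∀ t ∈ Icc 0 τ, 0 ≤ E t := fun t ht => by
    rw [hE_eq t ht]
    exact integral_nonneg fun y => add_nonneg (mul_self_nonneg _) (mul_self_nonneg _)
  have hEτ := eq_zero_of_abs_deriv_le_mul_abs_self_of_eq_zero_right (K := 40 * C) hEc hEd hE0
    (fun t ht => by
      have ht' := Ico_subset_Icc_self ht
      have key := abs_testedRHS_sub_le (pg.profile t ht') (ph.profile t ht')
      change |K t t| ≤ 20 * C * ∫ y, (v t y * v t y + deriv (v t) y * deriv (v t) y) at key
      rw [← hE_eq t ht'] at key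
      rw [Real.norm_eq_abs, Real.norm_eq_abs, abs_mul, abs_of_nonneg (hE_nonneg t ht'),
        abs_of_pos (by norm_num : (0 : ℝ) < 2)]
      linarith) τ (right_mem_Icc.2 hτ.1)
  have hτ' : τ ∈ Icc 0 τ := right_mem_Icc.2 hτ.1
  have p := pv.profile τ hτ'
  have c0 := p.continuous_zero
  have c1 := p.continuous_one
  have hint : Integrable fun y => v τ y * v τ y + deriv (v τ) y * deriv (v τ) y :=
    (integrable_decay_mul c0 p.le_zero c0 fun y => le_of_decay (p.le_zero y)).add
      (integrable_decay_mul c1 p.le_one c1 fun y => le_of_decay (p.le_one y))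
  rw [hE_eq τ hτ', integral_eq_zero_iff_of_nonneg
    (fun y => add_nonneg (mul_self_nonneg _) (mul_self_nonneg _)) hint] at hEτ
  have hae := (Continuous.ae_eq_iff_eq volume ((c0.mul c0).add (c1.mul c1))
    continuous_zero).1 hEτ
  funext y
  have hy : v τ y * v τ y + deriv (v τ) y * deriv (v τ) y = 0 := congrFun hae y
  have : v τ y = 0 := by
    nlinarith [mul_self_nonneg (v τ y), mul_self_nonneg (deriv (v τ) y)]
  exact sub_eq_zero.1 this

/-! ### The flow map and the transported momentum -/

theorem abs_exp_sub_exp_le {a b N : ℝ} (ha : a ≤ N) (hb : b ≤ N) :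
    |Real.exp a - Real.exp b| ≤ Real.exp N * |a - b| := by
  have key : ∀ {a b : ℝ}, a ≤ N → b ≤ N → b ≤ a →
      |Real.exp a - Real.exp b| ≤ Real.exp N * |a - b| := fun {a b} ha _ hab => by
    rw [abs_of_nonneg (sub_nonneg.2 (Real.exp_le_exp.2 hab)), abs_of_nonneg (sub_nonneg.2 hab)]
    have h1 := Real.add_one_le_exp (b - a)
    have h2 : Real.exp b = Real.exp a * Real.exp (b - a) := by rw [← Real.exp_add]; ring_nf
    have h3 := Real.exp_le_exp.2 ha
    have h4 := Real.exp_pos a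
    calc Real.exp a - Real.exp b = Real.exp a * (1 - Real.exp (b - a)) := by rw [h2]; ring
      _ ≤ Real.exp a * (a - b) := mul_le_mul_of_nonneg_left (by linarith) h4.le
      _ ≤ Real.exp N * (a - b) := mul_le_mul_of_nonneg_right h3 (by linarith)
  rcases le_total b a with h | h
  · exact key ha hb h
  · rw [abs_sub_comm, abs_sub_comm a]
    exact key hb ha h

/-- The flow map `Y` with logarithmic stretching rate `b = log Y_x` and `Y 0 = 0`. -/
def flowMap (b : ℝ →ᵇ ℝ) (x : ℝ) : ℝ := ∫ u in (0 : ℝ)..x, Real.exp (b u)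

/-- The ratio `Y x / x` of the flow map, extended continuously to `x = 0`. -/
def flowRatio (b : ℝ →ᵇ ℝ) (x : ℝ) : ℝ := ∫ s in (0 : ℝ)..1, Real.exp (b (s * x))

section Flow

variable {N : ℝ} {b b₁ b₂ : ℝ →ᵇ ℝ}

theorem flowMap_eq (b : ℝ →ᵇ ℝ) (x : ℝ) : flowMap b x = x * flowRatio b x := by
  rw [flowMap, flowRatio,
    intervalIntegral.mul_integral_comp_mul_right (f := fun u => Real.exp (b u))]
  simp

theorem abs_apply_le (hb : ‖b‖ ≤ N) (x : ℝ) : |b x| ≤ N := (b.norm_coe_le_norm x).trans hb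

theorem exp_apply_le (hb : ‖b‖ ≤ N) (x : ℝ) : Real.exp (b x) ≤ Real.exp N :=
  Real.exp_le_exp.2 (abs_le.1 (abs_apply_le hb x)).2

theorem le_exp_apply (hb : ‖b‖ ≤ N) (x : ℝ) : (Real.exp N)⁻¹ ≤ Real.exp (b x) := by
  rw [← Real.exp_neg]
  exact Real.exp_le_exp.2 (abs_le.1 (abs_apply_le hb x)).1

theorem continuous_exp_apply (b : ℝ →ᵇ ℝ) : Continuous fun x => Real.exp (b x) :=
  Real.continuous_exp.comp b.continuous

theorem hasDerivAt_flowMap (b : ℝ →ᵇ ℝ) (x : ℝ) :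
    HasDerivAt (flowMap b) (Real.exp (b x)) x :=
  intervalIntegral.integral_hasDerivAt_right ((continuous_exp_apply b).intervalIntegrable _ _)
    (continuous_exp_apply b).aestronglyMeasurable.stronglyMeasurableAtFilter
    (continuous_exp_apply b).continuousAt

theorem continuous_flowMap (b : ℝ →ᵇ ℝ) : Continuous (flowMap b) :=
  continuous_iff_continuousAt.2 fun x => (hasDerivAt_flowMap b x).continuousAt

theorem strictMono_flowMap (b : ℝ →ᵇ ℝ) : StrictMono (flowMap b) :=
  strictMono_of_deriv_pos fun x => by rw [(hasDerivAt_flowMap b x).deriv]; exact Real.exp_pos _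

theorem flowMap_sub (b : ℝ →ᵇ ℝ) (x x' : ℝ) :
    flowMap b x - flowMap b x' = ∫ u in x'..x, Real.exp (b u) :=
  intervalIntegral.integral_interval_sub_left ((continuous_exp_apply b).intervalIntegrable _ _)
    ((continuous_exp_apply b).intervalIntegrable _ _)

theorem le_abs_flowMap_sub (hb : ‖b‖ ≤ N) (x x' : ℝ) :
    (Real.exp N)⁻¹ * |x - x'| ≤ |flowMap b x - flowMap b x'| := by
  have key : ∀ {x x' : ℝ}, x' ≤ x →
      (Real.exp N)⁻¹ * |x - x'| ≤ |flowMap b x - flowMap b x'| := fun {x x'} h => by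
    rw [abs_of_nonneg (sub_nonneg.2 h),
      abs_of_nonneg (sub_nonneg.2 ((strictMono_flowMap b).monotone h)), flowMap_sub]
    have := intervalIntegral.integral_mono_on (μ := volume) (f := fun _ => (Real.exp N)⁻¹) h
      intervalIntegrable_const ((continuous_exp_apply b).intervalIntegrable _ _)
      fun u _ => le_exp_apply hb u
    rw [intervalIntegral.integral_const, smul_eq_mul] at this
    linarith
  rcases le_total x' x with h | h
  · exact key h
  · rw [abs_sub_comm, abs_sub_comm (flowMap b x)]
    exact key h

theorem abs_flowMap_sub_sub_le (h₁ : ‖b₁‖ ≤ N) (h₂ : ‖b₂‖ ≤ N) (x x' : ℝ) :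
    |(flowMap b₁ x - flowMap b₁ x') - (flowMap b₂ x - flowMap b₂ x')|
      ≤ Real.exp N * ‖b₁ - b₂‖ * |x - x'| := by
  rw [flowMap_sub, flowMap_sub, ← intervalIntegral.integral_sub
    ((continuous_exp_apply b₁).intervalIntegrable _ _)
    ((continuous_exp_apply b₂).intervalIntegrable _ _)]
  refine (Real.norm_eq_abs _).symm.trans_le (intervalIntegral.norm_integral_le_of_norm_le_const
    (C := Real.exp N * ‖b₁ - b₂‖) fun u _ => ?_)
  rw [Real.norm_eq_abs]
  refine (abs_exp_sub_exp_le (abs_le.1 (abs_apply_le h₁ u)).2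
    (abs_le.1 (abs_apply_le h₂ u)).2).trans ?_
  gcongr
  exact (b₁ - b₂).norm_coe_le_norm u

theorem flowMap_zero (b : ℝ →ᵇ ℝ) : flowMap b 0 = 0 := by simp [flowMap]

theorem continuous_exp_mul (b : ℝ →ᵇ ℝ) (x : ℝ) : Continuous fun s : ℝ => Real.exp (b (s * x)) :=
  (continuous_exp_apply b).comp (by fun_prop)

theorem flowRatio_le (hb : ‖b‖ ≤ N) (x : ℝ) : flowRatio b x ≤ Real.exp N := by
  have := intervalIntegral.integral_mono_on (μ := volume) (g := fun _ => Real.exp N) zero_le_one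
    ((continuous_exp_mul b x).intervalIntegrable 0 1) intervalIntegrable_const
    fun u _ => exp_apply_le hb (u * x)
  simpa [flowRatio] using this

theorem le_flowRatio (hb : ‖b‖ ≤ N) (x : ℝ) : (Real.exp N)⁻¹ ≤ flowRatio b x := by
  have := intervalIntegral.integral_mono_on (μ := volume) (f := fun _ => (Real.exp N)⁻¹) zero_le_one
    intervalIntegrable_const ((continuous_exp_mul b x).intervalIntegrable 0 1)
    fun u _ => le_exp_apply hb (u * x)
  simpa [flowRatio] using this

theorem flowRatio_pos (b : ℝ →ᵇ ℝ) (x : ℝ) : 0 < flowRatio b x :=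
  lt_of_lt_of_le (by positivity) (le_flowRatio le_rfl x)

theorem abs_flowRatio_sub_le (h₁ : ‖b₁‖ ≤ N) (h₂ : ‖b₂‖ ≤ N) (x : ℝ) :
    |flowRatio b₁ x - flowRatio b₂ x| ≤ Real.exp N * ‖b₁ - b₂‖ := by
  rw [flowRatio, flowRatio, ← intervalIntegral.integral_sub
    ((continuous_exp_mul b₁ x).intervalIntegrable _ _)
    ((continuous_exp_mul b₂ x).intervalIntegrable _ _)]
  refine (Real.norm_eq_abs _).symm.trans_le ((intervalIntegral.norm_integral_le_of_norm_le_const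
    (C := Real.exp N * ‖b₁ - b₂‖) fun u _ => ?_).trans_eq (by simp))
  rw [Real.norm_eq_abs]
  refine (abs_exp_sub_exp_le (abs_le.1 (abs_apply_le h₁ _)).2
    (abs_le.1 (abs_apply_le h₂ _)).2).trans ?_
  gcongr
  exact (b₁ - b₂).norm_coe_le_norm _

theorem abs_flowMap_le (hb : ‖b‖ ≤ N) (x : ℝ) : |flowMap b x| ≤ Real.exp N * |x| := by
  rw [flowMap_eq, abs_mul, abs_of_pos (flowRatio_pos b x), mul_comm]
  gcongr
  exact flowRatio_le hb x

theorem surjective_flowMap (b : ℝ →ᵇ ℝ) : Function.Surjective (flowMap b) := by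
  have hpos : 0 < (Real.exp ‖b‖)⁻¹ := by positivity
  refine (continuous_flowMap b).surjective ?_ ?_
  · refine tendsto_atTop_mono' _ ?_ (tendsto_id.const_mul_atTop hpos)
    filter_upwards [eventually_ge_atTop 0] with x hx
    rw [flowMap_eq, mul_comm, id]
    gcongr
    exact le_flowRatio le_rfl x
  · refine tendsto_atBot_mono' _ ?_ (tendsto_id.const_mul_atBot hpos)
    filter_upwards [eventually_le_atBot 0] with x hx
    rw [flowMap_eq, mul_comm, id]
    exact mul_le_mul_of_nonpos_right (le_flowRatio le_rfl x) hx

/-- The inverse of the flow map, from positions back to labels. -/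
def flowLabel (b : ℝ →ᵇ ℝ) : ℝ → ℝ :=
  ((strictMono_flowMap b).orderIsoOfSurjective _ (surjective_flowMap b)).symm

theorem flowLabel_flowMap (b : ℝ →ᵇ ℝ) (x : ℝ) : flowLabel b (flowMap b x) = x :=
  ((strictMono_flowMap b).orderIsoOfSurjective _ (surjective_flowMap b)).symm_apply_apply x

theorem flowMap_flowLabel (b : ℝ →ᵇ ℝ) (y : ℝ) : flowMap b (flowLabel b y) = y :=
  ((strictMono_flowMap b).orderIsoOfSurjective _ (surjective_flowMap b)).apply_symm_apply y

end Flow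

theorem continuous_flowRatio_uncurry :
    Continuous fun p : (ℝ →ᵇ ℝ) × ℝ => flowRatio p.1 p.2 := by
  refine intervalIntegral.continuous_parametric_intervalIntegral_of_continuous'
    (f := fun (p : (ℝ →ᵇ ℝ) × ℝ) (s : ℝ) => Real.exp (p.1 (s * p.2))) ?_ 0 1
  have : Continuous fun q : ((ℝ →ᵇ ℝ) × ℝ) × ℝ => (q.1.1, q.2 * q.1.2) := by fun_prop
  exact Real.continuous_exp.comp ((continuous_eval (F := ℝ →ᵇ ℝ)).comp this)

theorem continuous_flowMap_uncurry :
    Continuous fun p : (ℝ →ᵇ ℝ) × ℝ => flowMap p.1 p.2 := by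
  simp only [flowMap_eq]
  exact continuous_snd.mul continuous_flowRatio_uncurry

theorem continuous_flowLabel_uncurry :
    Continuous fun p : (ℝ →ᵇ ℝ) × ℝ => flowLabel p.1 p.2 := by
  rw [continuous_iff_continuousAt]
  rintro ⟨b₀, y₀⟩
  rw [ContinuousAt, tendsto_iff_dist_tendsto_zero]
  set x₀ := flowLabel b₀ y₀
  have hlim : Tendsto (fun p : (ℝ →ᵇ ℝ) × ℝ => Real.exp ‖p.1‖ * |p.2 - flowMap p.1 x₀|)
      (𝓝 (b₀, y₀)) (𝓝 0) := by
    have hc : Continuous fun p : (ℝ →ᵇ ℝ) × ℝ => Real.exp ‖p.1‖ * |p.2 - flowMap p.1 x₀| := by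
      have := continuous_flowMap_uncurry.comp
        (by fun_prop : Continuous fun p : (ℝ →ᵇ ℝ) × ℝ => (p.1, x₀))
      exact (by fun_prop : Continuous fun p : (ℝ →ᵇ ℝ) × ℝ => Real.exp ‖p.1‖).mul
        (continuous_snd.sub this).abs
    have := hc.tendsto (b₀, y₀)
    simpa [x₀, flowMap_flowLabel] using this
  refine squeeze_zero (fun _ => dist_nonneg) (fun p => ?_) hlim
  have h := le_abs_flowMap_sub (b := p.1) le_rfl (flowLabel p.1 p.2) x₀
  rw [flowMap_flowLabel, inv_mul_le_iff₀ (Real.exp_pos _)] at h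
  exact h

/-- A continuous function of size `O((1 + x²)⁻¹)`, with the constant: the class of initial
momenta. -/
structure DecayingDensity where
  /-- the underlying function -/
  val : ℝ → ℝ
  /-- the constant in the decay estimate -/
  bound : ℝ
  continuous_val : Continuous val
  abs_val_le : ∀ x, |val x| ≤ bound * (1 + x ^ 2)⁻¹

namespace DecayingDensity

variable (d : DecayingDensity) {N : ℝ} {b b₁ b₂ : ℝ →ᵇ ℝ}

theorem bound_nonneg : 0 ≤ d.bound := by
  simpa using (abs_nonneg _).trans (d.abs_val_le 0)

/-- The momentum per label, `φ(Y) Y_x`; the transport equation makes `φ(Y) Y⁵ / Y_x` constant in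
time, so that this is `φ₀ Y_x² (x / Y)⁵`. -/
def labelDensity (b : ℝ →ᵇ ℝ) (x : ℝ) : ℝ :=
  d.val x * Real.exp (2 * b x) * (flowRatio b x)⁻¹ ^ 5

/-- The momentum at the position `y` when the flow map has logarithmic stretching rate `b`. -/
def eulerMomentum (b : ℝ →ᵇ ℝ) (y : ℝ) : ℝ :=
  d.labelDensity b (flowLabel b y) * Real.exp (-b (flowLabel b y))

/-- The velocity profile `g` when the flow map has logarithmic stretching rate `b`. -/
def velocity (b : ℝ →ᵇ ℝ) : ℝ → ℝ := greenPotential (d.eulerMomentum b)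

theorem continuous_labelDensity_uncurry :
    Continuous fun p : (ℝ →ᵇ ℝ) × ℝ => d.labelDensity p.1 p.2 := by
  have h1 : Continuous fun p : (ℝ →ᵇ ℝ) × ℝ => p.1 p.2 := (continuous_eval (F := ℝ →ᵇ ℝ))
  have h2 := continuous_flowRatio_uncurry
  have h3 : Continuous fun p : (ℝ →ᵇ ℝ) × ℝ => (flowRatio p.1 p.2)⁻¹ :=
    h2.inv₀ fun p => (flowRatio_pos p.1 p.2).ne'
  have h4 := d.continuous_val
  unfold labelDensity
  fun_prop

theorem continuous_labelDensity (b : ℝ →ᵇ ℝ) : Continuous (d.labelDensity b) :=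
  Continuous.comp (g := fun p : (ℝ →ᵇ ℝ) × ℝ => d.labelDensity p.1 p.2) (f := fun x : ℝ => (b, x))
    d.continuous_labelDensity_uncurry (by fun_prop)

theorem continuous_eulerMomentum_uncurry :
    Continuous fun p : (ℝ →ᵇ ℝ) × ℝ => d.eulerMomentum p.1 p.2 := by
  have h : Continuous fun p : (ℝ →ᵇ ℝ) × ℝ => (p.1, flowLabel p.1 p.2) :=
    continuous_fst.prodMk continuous_flowLabel_uncurry
  exact (d.continuous_labelDensity_uncurry.comp h).mul
    (Real.continuous_exp.comp ((continuous_eval (F := ℝ →ᵇ ℝ)).comp h).neg)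

theorem continuous_eulerMomentum (b : ℝ →ᵇ ℝ) : Continuous (d.eulerMomentum b) :=
  Continuous.comp (g := fun p : (ℝ →ᵇ ℝ) × ℝ => d.eulerMomentum p.1 p.2) (f := fun x : ℝ => (b, x))
    d.continuous_eulerMomentum_uncurry (by fun_prop)

theorem inv_flowRatio_le (hb : ‖b‖ ≤ N) (x : ℝ) : (flowRatio b x)⁻¹ ≤ Real.exp N := by
  rw [inv_le_comm₀ (flowRatio_pos b x) (Real.exp_pos _)]
  exact le_flowRatio hb x

theorem abs_labelDensity_le (hb : ‖b‖ ≤ N) (x : ℝ) :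
    |d.labelDensity b x| ≤ Real.exp N ^ 7 * |d.val x| := by
  have hq := flowRatio_pos b x
  rw [labelDensity, abs_mul, abs_mul, Real.abs_exp, abs_of_pos (pow_pos (inv_pos.2 hq) 5),
    two_mul, Real.exp_add]
  have h1 := exp_apply_le hb x
  have h2 := inv_flowRatio_le hb x
  calc |d.val x| * (Real.exp (b x) * Real.exp (b x)) * (flowRatio b x)⁻¹ ^ 5
      ≤ |d.val x| * (Real.exp N * Real.exp N) * Real.exp N ^ 5 := by gcongr
    _ = _ := by ring

theorem abs_labelDensity_sub_le (h₁ : ‖b₁‖ ≤ N) (h₂ : ‖b₂‖ ≤ N) (x : ℝ) :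
    |d.labelDensity b₁ x - d.labelDensity b₂ x|
      ≤ 7 * Real.exp N ^ 9 * ‖b₁ - b₂‖ * |d.val x| := by
  have hN : 1 ≤ Real.exp N := Real.one_le_exp ((norm_nonneg _).trans h₁)
  have q1 := inv_flowRatio_le h₁ x
  have q2 := inv_flowRatio_le h₂ x
  have p1 := flowRatio_pos b₁ x
  have p2 := flowRatio_pos b₂ x
  have i1 := inv_pos.2 p1
  have i2 := inv_pos.2 p2
  have hinv : |(flowRatio b₁ x)⁻¹ - (flowRatio b₂ x)⁻¹| ≤ Real.exp N ^ 3 * ‖b₁ - b₂‖ := by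
    rw [show (flowRatio b₁ x)⁻¹ - (flowRatio b₂ x)⁻¹
      = (flowRatio b₂ x - flowRatio b₁ x) * (flowRatio b₁ x)⁻¹ * (flowRatio b₂ x)⁻¹ by
        field_simp, abs_mul, abs_mul, abs_of_pos i1, abs_of_pos i2, abs_sub_comm]
    calc _ ≤ Real.exp N * ‖b₁ - b₂‖ * Real.exp N * Real.exp N := by
          gcongr; exact abs_flowRatio_sub_le h₁ h₂ x
      _ = _ := by ring
  have hpow : |(flowRatio b₁ x)⁻¹ ^ 5 - (flowRatio b₂ x)⁻¹ ^ 5|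
      ≤ 5 * Real.exp N ^ 7 * ‖b₁ - b₂‖ := by
    refine (abs_pow_sub_pow_le _ _ 5).trans ?_
    rw [abs_of_pos i1, abs_of_pos i2]
    calc _ ≤ (Real.exp N ^ 3 * ‖b₁ - b₂‖) * (5 : ℕ) * Real.exp N ^ (5 - 1) := by
          gcongr; exact max_le q1 q2
      _ = _ := by push_cast; ring
  have hexp : |Real.exp (2 * b₁ x) - Real.exp (2 * b₂ x)| ≤ 2 * Real.exp N ^ 2 * ‖b₁ - b₂‖ := by
    refine (abs_exp_sub_exp_le (N := 2 * N) ?_ ?_).trans ?_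
    · linarith [(abs_le.1 (abs_apply_le h₁ x)).2]
    · linarith [(abs_le.1 (abs_apply_le h₂ x)).2]
    · rw [← mul_sub, abs_mul, abs_of_pos (by norm_num : (0 : ℝ) < 2), two_mul, Real.exp_add]
      have := (b₁ - b₂).norm_coe_le_norm x
      calc Real.exp N * Real.exp N * (2 * |b₁ x - b₂ x|)
          ≤ Real.exp N * Real.exp N * (2 * ‖b₁ - b₂‖) := by gcongr; exact this
        _ = _ := by ring
  have hexp2 : Real.exp (2 * b₂ x) ≤ Real.exp N ^ 2 := by
    rw [two_mul, Real.exp_add, pow_two]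
    have := exp_apply_le h₂ x
    gcongr
  rw [labelDensity, labelDensity, show d.val x * Real.exp (2 * b₁ x) * (flowRatio b₁ x)⁻¹ ^ 5
    - d.val x * Real.exp (2 * b₂ x) * (flowRatio b₂ x)⁻¹ ^ 5
    = d.val x * ((Real.exp (2 * b₁ x) - Real.exp (2 * b₂ x)) * (flowRatio b₁ x)⁻¹ ^ 5
      + Real.exp (2 * b₂ x) * ((flowRatio b₁ x)⁻¹ ^ 5 - (flowRatio b₂ x)⁻¹ ^ 5)) by ring,
    abs_mul, mul_comm]
  gcongr
  refine (abs_add_le _ _).trans ?_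
  rw [abs_mul, abs_mul, Real.abs_exp, abs_of_pos (pow_pos i1 5)]
  have hD := norm_nonneg (b₁ - b₂)
  calc _ ≤ (2 * Real.exp N ^ 2 * ‖b₁ - b₂‖) * Real.exp N ^ 5
        + Real.exp N ^ 2 * (5 * Real.exp N ^ 7 * ‖b₁ - b₂‖) := by gcongr
    _ = 2 * ‖b₁ - b₂‖ * Real.exp N ^ 7 + 5 * ‖b₁ - b₂‖ * Real.exp N ^ 9 := by ring
    _ ≤ 2 * ‖b₁ - b₂‖ * Real.exp N ^ 9 + 5 * ‖b₁ - b₂‖ * Real.exp N ^ 9 := by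
        gcongr 2 * ‖b₁ - b₂‖ * ?_ + _
        exact pow_le_pow_right₀ hN (by norm_num)
    _ = _ := by ring

theorem abs_eulerMomentum_le (hb : ‖b‖ ≤ N) (y : ℝ) :
    |d.eulerMomentum b y| ≤ d.bound * Real.exp N ^ 10 * (1 + y ^ 2)⁻¹ := by
  have hN : 1 ≤ Real.exp N := Real.one_le_exp ((norm_nonneg _).trans hb)
  obtain ⟨x, rfl⟩ := surjective_flowMap b y
  rw [eulerMomentum, flowLabel_flowMap, abs_mul, Real.abs_exp]
  have h1 := d.abs_labelDensity_le hb x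
  have h2 : Real.exp (-b x) ≤ Real.exp N :=
    Real.exp_le_exp.2 (by linarith [(abs_le.1 (abs_apply_le hb x)).1])
  have h3 := d.abs_val_le x
  have h4 : (1 + x ^ 2)⁻¹ ≤ Real.exp N ^ 2 * (1 + flowMap b x ^ 2)⁻¹ := by
    rw [← div_eq_mul_inv, le_div_iff₀ (by positivity), inv_mul_le_iff₀ (by positivity)]
    have h5 := pow_le_pow_left₀ (abs_nonneg _) (abs_flowMap_le hb x) 2
    rw [sq_abs, mul_pow, sq_abs] at h5
    nlinarith [one_le_pow₀ (n := 2) hN]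
  have hM := d.bound_nonneg
  calc |d.labelDensity b x| * Real.exp (-b x)
      ≤ Real.exp N ^ 7 * |d.val x| * Real.exp N := by gcongr
    _ ≤ Real.exp N ^ 7 * (d.bound * (Real.exp N ^ 2 * (1 + flowMap b x ^ 2)⁻¹)) * Real.exp N := by
        gcongr; exact h3.trans (by gcongr)
    _ = _ := by ring

theorem eulerMomentum_bdd (hb : ‖b‖ ≤ N) (y : ℝ) :
    |d.eulerMomentum b y| ≤ d.bound * Real.exp N ^ 10 := le_of_decay (d.abs_eulerMomentum_le hb y)

/-- Change of variables between positions and labels. -/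
theorem integral_mul_eulerMomentum (b : ℝ →ᵇ ℝ) (k : ℝ → ℝ) :
    ∫ y, k y * d.eulerMomentum b y = ∫ x, k (flowMap b x) * d.labelDensity b x := by
  have h := integral_image_eq_integral_abs_deriv_smul MeasurableSet.univ
    (fun x _ => (hasDerivAt_flowMap b x).hasDerivWithinAt)
    (strictMono_flowMap b).injective.injOn (fun y => k y * d.eulerMomentum b y)
  rw [image_univ, (surjective_flowMap b).range_eq, setIntegral_univ, setIntegral_univ] at h
  rw [h]
  refine integral_congr_ae (ae_of_all _ fun x => ?_)
  simp only [eulerMomentum, flowLabel_flowMap, smul_eq_mul, Real.abs_exp]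
  rw [Real.exp_neg]
  field_simp

end DecayingDensity

/-! ### The stretching rate as a Lipschitz vector field -/

theorem greenPotential_eq_translate (φ : ℝ → ℝ) (y : ℝ) :
    greenPotential φ y = (1 / 2) * ∫ z, Real.exp (-|z|) * φ (y + z) := by
  rw [greenPotential, ← integral_add_left_eq_self _ y]
  simp

theorem greenDeriv_eq_translate (φ : ℝ → ℝ) (y : ℝ) :
    greenDeriv φ y = (1 / 2) * ∫ z, (if 0 < z then 1 else -1) * Real.exp (-|z|) * φ (y + z) := by
  rw [greenDeriv, ← integral_add_left_eq_self _ y]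
  simp

section Parameter

variable {X : Type*} [TopologicalSpace X] [FirstCountableTopology X] {Φ : X → ℝ → ℝ}

theorem continuous_integral_kernel_mul_translate (hΦ : Continuous fun p : X × ℝ => Φ p.1 p.2)
    (hb : ∀ x₀, ∃ K, ∀ᶠ x in 𝓝 x₀, ∀ y, |Φ x y| ≤ K) {k : ℝ → ℝ} (hk : Integrable k) :
    Continuous fun p : X × ℝ => ∫ z, k z * Φ p.1 (p.2 + z) := by
  rw [continuous_iff_continuousAt]
  rintro ⟨x₀, y₀⟩
  obtain ⟨K, hK⟩ := hb x₀
  have hK' : ∀ᶠ p : X × ℝ in 𝓝 (x₀, y₀), ∀ y, |Φ p.1 y| ≤ K :=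
    (continuous_fst.tendsto (x₀, y₀)).eventually hK
  have hc : ∀ z, Continuous fun p : X × ℝ => Φ p.1 (p.2 + z) := fun z =>
    hΦ.comp (f := fun p : X × ℝ => (p.1, p.2 + z)) (by fun_prop)
  have hc' : ∀ p : X × ℝ, Continuous fun z => Φ p.1 (p.2 + z) := fun p =>
    hΦ.comp (f := fun z : ℝ => (p.1, p.2 + z)) (by fun_prop)
  refine continuousAt_of_dominated (bound := fun z => |k z| * K)
    (Eventually.of_forall fun p => hk.aestronglyMeasurable.mul (hc' p).aestronglyMeasurable)
    (hK'.mono fun p hp => ae_of_all _ fun z => ?_) (hk.abs.mul_const K)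
    (ae_of_all _ fun z => ((hc z).const_mul _).continuousAt)
  rw [Real.norm_eq_abs, abs_mul]
  gcongr
  exact hp _

theorem continuous_greenPotential_param (hΦ : Continuous fun p : X × ℝ => Φ p.1 p.2)
    (hb : ∀ x₀, ∃ K, ∀ᶠ x in 𝓝 x₀, ∀ y, |Φ x y| ≤ K) :
    Continuous fun p : X × ℝ => greenPotential (Φ p.1) p.2 := by
  simp only [greenPotential_eq_translate]
  exact (continuous_integral_kernel_mul_translate hΦ hb integrable_exp_neg_abs).const_mul _

theorem continuous_greenDeriv_param (hΦ : Continuous fun p : X × ℝ => Φ p.1 p.2)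
    (hb : ∀ x₀, ∃ K, ∀ᶠ x in 𝓝 x₀, ∀ y, |Φ x y| ≤ K) :
    Continuous fun p : X × ℝ => greenDeriv (Φ p.1) p.2 := by
  simp only [greenDeriv_eq_translate]
  refine (continuous_integral_kernel_mul_translate hΦ hb ?_).const_mul _
  refine integrable_exp_neg_abs.bdd_mul (c := 1) (measurable_sign_kernel 0).aestronglyMeasurable
    (ae_of_all _ fun z => ?_)
  rw [Real.norm_eq_abs, abs_sign_kernel]

end Parameter

theorem BoundedContinuousFunction.eventually_norm_le (b₀ : ℝ →ᵇ ℝ) :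
    ∀ᶠ b in 𝓝 b₀, ‖b‖ ≤ ‖b₀‖ + 1 :=
  (continuous_norm.tendsto b₀).eventually (eventually_le_nhds (by linarith))

namespace DecayingDensity

variable (d : DecayingDensity) {N : ℝ} {b b₁ b₂ : ℝ →ᵇ ℝ}

theorem exists_eventually_eulerMomentum_le (b₀ : ℝ →ᵇ ℝ) :
    ∃ K, ∀ᶠ b in 𝓝 b₀, ∀ y, |d.eulerMomentum b y| ≤ K :=
  ⟨_, b₀.eventually_norm_le.mono fun _ h y => d.eulerMomentum_bdd h y⟩

theorem continuous_velocity_uncurry :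
    Continuous fun p : (ℝ →ᵇ ℝ) × ℝ => d.velocity p.1 p.2 :=
  continuous_greenPotential_param d.continuous_eulerMomentum_uncurry
    d.exists_eventually_eulerMomentum_le

theorem continuous_velocityDeriv_uncurry :
    Continuous fun p : (ℝ →ᵇ ℝ) × ℝ => greenDeriv (d.eulerMomentum p.1) p.2 :=
  continuous_greenDeriv_param d.continuous_eulerMomentum_uncurry
    d.exists_eventually_eulerMomentum_le

/-- The stretching rate `(y g)'` at the position of the label `x`. -/
def rate (b : ℝ →ᵇ ℝ) (x : ℝ) : ℝ :=
  d.velocity b (flowMap b x) + flowMap b x * greenDeriv (d.eulerMomentum b) (flowMap b x)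

/-- The integrand of the stretching rate in label coordinates. -/
def rateKernel (b : ℝ →ᵇ ℝ) (x x' : ℝ) : ℝ :=
  (1 + flowMap b x * (if x < x' then 1 else -1)) * Real.exp (-|flowMap b x - flowMap b x'|)
    * d.labelDensity b x'

theorem rate_eq (b : ℝ →ᵇ ℝ) (x : ℝ) : d.rate b x = (1 / 2) * ∫ x', d.rateKernel b x x' := by
  have hc := d.continuous_eulerMomentum b
  have hM := d.eulerMomentum_bdd (b := b) le_rfl
  have h := d.integral_mul_eulerMomentum b fun y' =>
    (1 + flowMap b x * (if flowMap b x < y' then 1 else -1)) * Real.exp (-|flowMap b x - y'|)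
  simp only [(strictMono_flowMap b).lt_iff_lt] at h
  rw [show (∫ x', d.rateKernel b x x') = _ from h.symm, rate, velocity, greenPotential, greenDeriv,
    mul_left_comm (flowMap b x), ← mul_add, ← integral_const_mul,
    ← integral_add (integrable_green hc hM _) ((integrable_greenDeriv hc hM _).const_mul _)]
  congr 2
  funext y'
  ring

theorem continuous_rate (b : ℝ →ᵇ ℝ) : Continuous (d.rate b) := by
  have hc := d.continuous_eulerMomentum b
  have hM := d.eulerMomentum_bdd (b := b) le_rfl
  have h1 := continuous_flowMap b
  have h2 : Continuous (d.velocity b) := continuous_greenPotential hc hM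
  have h3 := continuous_greenDeriv hc hM
  exact (h2.comp h1).add (h1.mul (h3.comp h1))

theorem measurable_rateKernel (b : ℝ →ᵇ ℝ) (x : ℝ) : Measurable (d.rateKernel b x) := by
  have h1 := (continuous_flowMap b).measurable
  have h2 := (d.continuous_labelDensity b).measurable
  have h3 := measurable_sign_kernel x
  unfold rateKernel
  fun_prop

theorem abs_one_add_mul_sign_le (hb : ‖b‖ ≤ N) (x x' : ℝ) :
    |1 + flowMap b x * (if x < x' then 1 else -1)| ≤ Real.exp N * (1 + |x|) := by
  have hN : 1 ≤ Real.exp N := Real.one_le_exp ((norm_nonneg _).trans hb)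
  refine (abs_add_le _ _).trans ?_
  rw [abs_one, abs_mul, abs_sign_kernel, mul_one]
  linarith [abs_flowMap_le hb x]

theorem exp_neg_abs_flowMap_sub_le (hb : ‖b‖ ≤ N) (x x' : ℝ) :
    Real.exp (-|flowMap b x - flowMap b x'|) ≤ Real.exp (-((Real.exp N)⁻¹ * |x - x'|)) :=
  Real.exp_le_exp.2 (neg_le_neg (le_abs_flowMap_sub hb x x'))

/-- The growth of `1 + |x|` is absorbed by the decay of the density near `x`. -/
theorem one_add_abs_mul_abs_val_le (x x' : ℝ) :
    (1 + |x|) * |d.val x'| ≤ 2 * d.bound * (1 + |x - x'|) := by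
  have h1 : |x| ≤ |x - x'| + |x'| := by
    have := abs_add_le (x - x') x'
    simpa using this
  have h2 : (1 + |x'|) * (1 + x' ^ 2)⁻¹ ≤ 2 := by
    rw [← div_eq_mul_inv, div_le_iff₀ (by positivity)]
    nlinarith [sq_abs x', sq_nonneg (|x'| - 1)]
  have hM := d.bound_nonneg
  calc (1 + |x|) * |d.val x'|
      ≤ ((1 + |x - x'|) * (1 + |x'|)) * (d.bound * (1 + x' ^ 2)⁻¹) := by
        gcongr
        · nlinarith [abs_nonneg (x - x'), abs_nonneg x']
        · exact d.abs_val_le x'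
    _ = d.bound * (1 + |x - x'|) * ((1 + |x'|) * (1 + x' ^ 2)⁻¹) := by ring
    _ ≤ d.bound * (1 + |x - x'|) * 2 := by gcongr
    _ = _ := by ring

/-- The constant in `e^{-c|s|} (1 + |s|)² ≤ A (1 + s²)⁻¹` for `c = e^{-N}`. -/
def kernelConst (N : ℝ) : ℝ := 24 * Real.exp (Real.exp N)⁻¹ / (Real.exp N)⁻¹ ^ 4

theorem kernelConst_pos (N : ℝ) : 0 < kernelConst N := by
  unfold kernelConst; positivity

theorem exp_neg_mul_sq_le_kernelConst (N s : ℝ) :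
    Real.exp (-((Real.exp N)⁻¹ * |s|)) * (1 + |s|) ^ 2 ≤ kernelConst N * (1 + s ^ 2)⁻¹ :=
  exp_neg_mul_mul_sq_le (inv_pos.2 (Real.exp_pos N)) s

theorem abs_rateKernel_le (hb : ‖b‖ ≤ N) (x x' : ℝ) :
    |d.rateKernel b x x'|
      ≤ 2 * d.bound * Real.exp N ^ 8 * kernelConst N * (1 + (x - x') ^ 2)⁻¹ := by
  have hM := d.bound_nonneg
  have h1 := abs_one_add_mul_sign_le hb x x'
  have h2 := exp_neg_abs_flowMap_sub_le hb x x'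
  have h3 := d.abs_labelDensity_le hb x'
  have h4 := d.one_add_abs_mul_abs_val_le x x'
  have h5 := exp_neg_mul_sq_le_kernelConst N (x - x')
  set e := Real.exp (-((Real.exp N)⁻¹ * |x - x'|))
  have he : 0 ≤ e := Real.exp_nonneg _
  have hs : 1 + |x - x'| ≤ (1 + |x - x'|) ^ 2 := by nlinarith [abs_nonneg (x - x')]
  rw [rateKernel, abs_mul, abs_mul, Real.abs_exp]
  calc _ ≤ (Real.exp N * (1 + |x|)) * e * (Real.exp N ^ 7 * |d.val x'|) := by gcongr
    _ = Real.exp N ^ 8 * e * ((1 + |x|) * |d.val x'|) := by ring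
    _ ≤ Real.exp N ^ 8 * e * (2 * d.bound * (1 + |x - x'|) ^ 2) :=
        mul_le_mul_of_nonneg_left (h4.trans (by gcongr)) (by positivity)
    _ = 2 * d.bound * Real.exp N ^ 8 * (e * (1 + |x - x'|) ^ 2) := by ring
    _ ≤ 2 * d.bound * Real.exp N ^ 8 * (kernelConst N * (1 + (x - x') ^ 2)⁻¹) := by gcongr
    _ = _ := by ring

theorem abs_rateKernel_sub_le (h₁ : ‖b₁‖ ≤ N) (h₂ : ‖b₂‖ ≤ N) (x x' : ℝ) :
    |d.rateKernel b₁ x x' - d.rateKernel b₂ x x'|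
      ≤ 18 * d.bound * Real.exp N ^ 10 * kernelConst N * ‖b₁ - b₂‖ * (1 + (x - x') ^ 2)⁻¹ := by
  have hN : 1 ≤ Real.exp N := Real.one_le_exp ((norm_nonneg _).trans h₁)
  have hM := d.bound_nonneg
  have hD := norm_nonneg (b₁ - b₂)
  have a2 := abs_one_add_mul_sign_le h₂ x x'
  have e1 := exp_neg_abs_flowMap_sub_le h₁ x x'
  have e2 := exp_neg_abs_flowMap_sub_le h₂ x x'
  have r1 := d.abs_labelDensity_le h₁ x'
  have r12 := d.abs_labelDensity_sub_le h₁ h₂ x'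
  have h4 := d.one_add_abs_mul_abs_val_le x x'
  have h5 := exp_neg_mul_sq_le_kernelConst N (x - x')
  have hY : |flowMap b₁ x - flowMap b₂ x| ≤ Real.exp N * ‖b₁ - b₂‖ * (1 + |x|) := by
    have := abs_flowMap_sub_sub_le h₁ h₂ x 0
    simp only [flowMap_zero, sub_zero] at this
    exact this.trans (by gcongr; linarith)
  have he12 : |Real.exp (-|flowMap b₁ x - flowMap b₁ x'|)
      - Real.exp (-|flowMap b₂ x - flowMap b₂ x'|)|
      ≤ Real.exp (-((Real.exp N)⁻¹ * |x - x'|)) * (Real.exp N * ‖b₁ - b₂‖ * |x - x'|) := by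
    refine (abs_exp_sub_exp_le (neg_le_neg (le_abs_flowMap_sub h₁ x x'))
      (neg_le_neg (le_abs_flowMap_sub h₂ x x'))).trans ?_
    gcongr
    rw [neg_sub_neg, abs_sub_comm]
    exact (abs_abs_sub_abs_le_abs_sub _ _).trans (abs_flowMap_sub_sub_le h₁ h₂ x x')
  rw [rateKernel, rateKernel]
  have hσ := abs_sign_kernel x x'
  set σ : ℝ := if x < x' then 1 else -1
  set e := Real.exp (-((Real.exp N)⁻¹ * |x - x'|))
  set E₁ := Real.exp (-|flowMap b₁ x - flowMap b₁ x'|)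
  set E₂ := Real.exp (-|flowMap b₂ x - flowMap b₂ x'|)
  have he : 0 ≤ e := Real.exp_nonneg _
  have hE₁ : 0 ≤ E₁ := Real.exp_nonneg _
  have hE₂ : 0 ≤ E₂ := Real.exp_nonneg _
  have hx := abs_nonneg (x - x')
  rw [show (1 + flowMap b₁ x * σ) * E₁ * d.labelDensity b₁ x'
      - (1 + flowMap b₂ x * σ) * E₂ * d.labelDensity b₂ x'
      = (flowMap b₁ x - flowMap b₂ x) * σ * E₁ * d.labelDensity b₁ x'
        + (1 + flowMap b₂ x * σ) * (E₁ - E₂) * d.labelDensity b₁ x'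
        + (1 + flowMap b₂ x * σ) * E₂ * (d.labelDensity b₁ x' - d.labelDensity b₂ x') by ring]
  refine (abs_add_three _ _ _).trans ?_
  simp only [abs_mul, hσ, mul_one, abs_of_nonneg hE₁, abs_of_nonneg hE₂]
  have hs1 : 1 + |x - x'| ≤ (1 + |x - x'|) ^ 2 := by nlinarith
  have hs2 : (1 + |x - x'|) * |x - x'| ≤ (1 + |x - x'|) ^ 2 := by nlinarith
  set D := ‖b₁ - b₂‖
  set L := Real.exp N
  set S := (1 + |x - x'|) ^ 2
  have hS : 0 ≤ S := sq_nonneg _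
  have h4S : (1 + |x|) * |d.val x'| ≤ 2 * d.bound * S := h4.trans (by gcongr)
  have t1 : |flowMap b₁ x - flowMap b₂ x| * E₁ * |d.labelDensity b₁ x'|
      ≤ 2 * d.bound * L ^ 10 * D * (e * S) :=
    calc _ ≤ (L * D * (1 + |x|)) * e * (L ^ 7 * |d.val x'|) := by gcongr
      _ = L ^ 8 * D * e * ((1 + |x|) * |d.val x'|) := by ring
      _ ≤ L ^ 8 * D * e * (2 * d.bound * S) :=
          mul_le_mul_of_nonneg_left h4S (by positivity)
      _ ≤ L ^ 10 * D * e * (2 * d.bound * S) := by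
          gcongr ?_ * D * e * (2 * d.bound * S)
          exact pow_le_pow_right₀ hN (by norm_num)
      _ = _ := by ring
  have t2 : |1 + flowMap b₂ x * σ| * |E₁ - E₂| * |d.labelDensity b₁ x'|
      ≤ 2 * d.bound * L ^ 10 * D * (e * S) :=
    calc _ ≤ (L * (1 + |x|)) * (e * (L * D * |x - x'|)) * (L ^ 7 * |d.val x'|) := by gcongr
      _ = L ^ 9 * D * e * (((1 + |x|) * |d.val x'|) * |x - x'|) := by ring
      _ ≤ L ^ 9 * D * e * (2 * d.bound * (1 + |x - x'|) * |x - x'|) :=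
          mul_le_mul_of_nonneg_left (mul_le_mul_of_nonneg_right h4 hx) (by positivity)
      _ ≤ L ^ 10 * D * e * (2 * d.bound * (1 + |x - x'|) * |x - x'|) := by
          gcongr ?_ * D * e * (2 * d.bound * (1 + |x - x'|) * |x - x'|)
          exact pow_le_pow_right₀ hN (by norm_num)
      _ = 2 * d.bound * L ^ 10 * D * (e * ((1 + |x - x'|) * |x - x'|)) := by ring
      _ ≤ _ := by gcongr
  have t3 : |1 + flowMap b₂ x * σ| * E₂ * |d.labelDensity b₁ x' - d.labelDensity b₂ x'|
      ≤ 14 * d.bound * L ^ 10 * D * (e * S) :=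
    calc _ ≤ (L * (1 + |x|)) * e * (7 * L ^ 9 * D * |d.val x'|) := by gcongr
      _ = 7 * L ^ 10 * D * e * ((1 + |x|) * |d.val x'|) := by ring
      _ ≤ 7 * L ^ 10 * D * e * (2 * d.bound * S) :=
          mul_le_mul_of_nonneg_left h4S (by positivity)
      _ = _ := by ring
  calc _ ≤ 18 * d.bound * L ^ 10 * D * (e * S) := by linarith
    _ ≤ 18 * d.bound * L ^ 10 * D * (kernelConst N * (1 + (x - x') ^ 2)⁻¹) := by gcongr
    _ = _ := by ring

theorem integrable_rateKernel (b : ℝ →ᵇ ℝ) (x : ℝ) : Integrable (d.rateKernel b x) :=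
  ((integrable_inv_one_add_sq.comp_sub_left x).const_mul _).mono'
    (d.measurable_rateKernel b x).aestronglyMeasurable
    (ae_of_all _ fun x' => d.abs_rateKernel_le le_rfl x x')

/-- A bound for the stretching rate on the ball of radius `N`. -/
def rateBound (N : ℝ) : ℝ := d.bound * Real.exp N ^ 8 * kernelConst N * Real.pi

/-- A Lipschitz constant for the stretching rate on the ball of radius `N`. -/
def rateLipschitz (N : ℝ) : ℝ := 9 * d.bound * Real.exp N ^ 10 * kernelConst N * Real.pi

theorem rateBound_nonneg (N : ℝ) : 0 ≤ d.rateBound N := by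
  have := d.bound_nonneg
  have := kernelConst_pos N
  unfold rateBound
  positivity

theorem rateLipschitz_nonneg (N : ℝ) : 0 ≤ d.rateLipschitz N := by
  have := d.bound_nonneg
  have := kernelConst_pos N
  unfold rateLipschitz
  positivity

theorem abs_rate_le (hb : ‖b‖ ≤ N) (x : ℝ) : |d.rate b x| ≤ d.rateBound N := by
  rw [rate_eq, abs_mul, abs_of_pos (by norm_num : (0 : ℝ) < 1 / 2)]
  have h := norm_integral_le_of_norm_le (f := d.rateKernel b x)
    ((integrable_inv_one_add_sq.comp_sub_left x).const_mul _)
    (ae_of_all volume fun x' => d.abs_rateKernel_le hb x x')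
  rw [integral_const_mul, integral_inv_one_add_sub_sq, Real.norm_eq_abs] at h
  unfold rateBound
  linarith

theorem abs_rate_sub_le (h₁ : ‖b₁‖ ≤ N) (h₂ : ‖b₂‖ ≤ N) (x : ℝ) :
    |d.rate b₁ x - d.rate b₂ x| ≤ d.rateLipschitz N * ‖b₁ - b₂‖ := by
  rw [rate_eq, rate_eq, ← mul_sub,
    ← integral_sub (d.integrable_rateKernel b₁ x) (d.integrable_rateKernel b₂ x),
    abs_mul, abs_of_pos (by norm_num : (0 : ℝ) < 1 / 2)]
  have h := norm_integral_le_of_norm_le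
    (f := fun x' => d.rateKernel b₁ x x' - d.rateKernel b₂ x x')
    ((integrable_inv_one_add_sq.comp_sub_left x).const_mul _)
    (ae_of_all volume fun x' => d.abs_rateKernel_sub_le h₁ h₂ x x')
  rw [integral_const_mul, integral_inv_one_add_sub_sq, Real.norm_eq_abs] at h
  unfold rateLipschitz
  linarith

/-- The stretching rate as a vector field on the space of bounded continuous functions: a solution
of `b' = field b` is the logarithm of the spatial derivative of the flow of `y g`. -/
def field (b : ℝ →ᵇ ℝ) : ℝ →ᵇ ℝ :=
  BoundedContinuousFunction.ofNormedAddCommGroup (d.rate b) (d.continuous_rate b)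
    (d.rateBound ‖b‖) fun x => d.abs_rate_le le_rfl x

@[simp]
theorem field_apply (b : ℝ →ᵇ ℝ) (x : ℝ) : d.field b x = d.rate b x := rfl

theorem norm_field_le (hb : ‖b‖ ≤ N) : ‖d.field b‖ ≤ d.rateBound N :=
  (BoundedContinuousFunction.norm_le (d.rateBound_nonneg N)).2 fun x => d.abs_rate_le hb x

theorem norm_field_sub_le (h₁ : ‖b₁‖ ≤ N) (h₂ : ‖b₂‖ ≤ N) :
    ‖d.field b₁ - d.field b₂‖ ≤ d.rateLipschitz N * ‖b₁ - b₂‖ :=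
  (BoundedContinuousFunction.norm_le (mul_nonneg (d.rateLipschitz_nonneg N) (norm_nonneg _))).2
    fun x => d.abs_rate_sub_le h₁ h₂ x

theorem continuous_field : Continuous d.field := by
  rw [continuous_iff_continuousAt]
  intro b₀
  rw [ContinuousAt, tendsto_iff_norm_sub_tendsto_zero]
  have hlim : Tendsto (fun b => d.rateLipschitz (‖b₀‖ + 1) * ‖b - b₀‖) (𝓝 b₀) (𝓝 0) := by
    have := ((continuous_id.sub continuous_const).norm.const_mul
      (d.rateLipschitz (‖b₀‖ + 1))).tendsto b₀ (f := fun b : ℝ →ᵇ ℝ =>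
        d.rateLipschitz (‖b₀‖ + 1) * ‖b - b₀‖)
    simpa using this
  refine squeeze_zero' (Eventually.of_forall fun _ => norm_nonneg _) ?_ hlim
  filter_upwards [b₀.eventually_norm_le] with b hb
  exact d.norm_field_sub_le hb (by linarith)

end DecayingDensity

/-! ### Time derivatives along a trajectory -/

/-- The derivative of `flowRatio` at `b` in the direction `v`. -/
def flowRatioDeriv (b v : ℝ →ᵇ ℝ) (x : ℝ) : ℝ :=
  ∫ s in (0 : ℝ)..1, Real.exp (b (s * x)) * v (s * x)

theorem hasDerivAt_apply {b V : ℝ → ℝ →ᵇ ℝ} {t : ℝ} (h : HasDerivAt b (V t) t) (x : ℝ) :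
    HasDerivAt (fun t => b t x) (V t x) t :=
  ((BoundedContinuousFunction.evalCLM ℝ x : (ℝ →ᵇ ℝ) →L[ℝ] ℝ).hasFDerivAt
    (x := b t)).comp_hasDerivAt t h

theorem eventually_norm_le_of_hasDerivAt {b V : ℝ → ℝ →ᵇ ℝ} (hb : ∀ t, HasDerivAt b (V t) t)
    (hV : Continuous V) (t : ℝ) :
    ∃ N, {r | ‖b r‖ ≤ N ∧ ‖V r‖ ≤ N} ∈ 𝓝 t := by
  have hc : Continuous b := continuous_iff_continuousAt.2 fun t => (hb t).continuousAt
  refine ⟨max ‖b t‖ ‖V t‖ + 1, ?_⟩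
  filter_upwards [(hc.norm.tendsto t).eventually (eventually_le_nhds (lt_add_one _)),
    (hV.norm.tendsto t).eventually (eventually_le_nhds (lt_add_one _))] with r h1 h2
  exact ⟨h1.trans (by gcongr; exact le_max_left _ _), h2.trans (by gcongr; exact le_max_right _ _)⟩

theorem abs_flowRatioDeriv_le {b v : ℝ →ᵇ ℝ} {N : ℝ} (hb : ‖b‖ ≤ N) (hv : ‖v‖ ≤ N) (x : ℝ) :
    |flowRatioDeriv b v x| ≤ Real.exp N * N := by
  rw [flowRatioDeriv, ← Real.norm_eq_abs]
  refine (intervalIntegral.norm_integral_le_of_norm_le_const (C := Real.exp N * N)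
    fun s _ => ?_).trans_eq (by simp)
  rw [Real.norm_eq_abs, abs_mul, Real.abs_exp]
  have := exp_apply_le hb (s * x)
  have := abs_apply_le hv (s * x)
  gcongr

theorem continuous_exp_mul_apply (b v : ℝ →ᵇ ℝ) (x : ℝ) :
    Continuous fun s : ℝ => Real.exp (b (s * x)) * v (s * x) :=
  (continuous_exp_mul b x).mul (v.continuous.comp (by fun_prop))

theorem hasDerivAt_flowRatio {b V : ℝ → ℝ →ᵇ ℝ} (hb : ∀ t, HasDerivAt b (V t) t)
    (hV : Continuous V) (t x : ℝ) :
    HasDerivAt (fun t => flowRatio (b t) x) (flowRatioDeriv (b t) (V t) x) t := by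
  obtain ⟨N, hN⟩ := eventually_norm_le_of_hasDerivAt hb hV t
  refine (intervalIntegral.hasDerivAt_integral_of_dominated_loc_of_deriv_le (μ := volume)
    (F := fun t s => Real.exp (b t (s * x)))
    (F' := fun t s => Real.exp (b t (s * x)) * V t (s * x)) (bound := fun _ => Real.exp N * N)
    hN (Eventually.of_forall fun r => (continuous_exp_mul (b r) x).aestronglyMeasurable)
    ((continuous_exp_mul (b t) x).intervalIntegrable _ _)
    (continuous_exp_mul_apply _ _ x).aestronglyMeasurable
    (ae_of_all _ fun s _ r hr => ?_) intervalIntegrable_const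
    (ae_of_all _ fun s _ r _ => (hasDerivAt_apply (hb r) _).exp)).2
  rw [Real.norm_eq_abs, abs_mul, Real.abs_exp]
  have := exp_apply_le hr.1 (s * x)
  have := abs_apply_le hr.2 (s * x)
  gcongr

namespace DecayingDensity

variable (d : DecayingDensity) {N : ℝ} {b : ℝ →ᵇ ℝ}

theorem hasDerivAt_velocity (b : ℝ →ᵇ ℝ) (y : ℝ) :
    HasDerivAt (d.velocity b) (greenDeriv (d.eulerMomentum b) y) y :=
  hasDerivAt_greenPotential (d.continuous_eulerMomentum b) (d.eulerMomentum_bdd le_rfl) y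

/-- Along a solution of `b' = field b` the flow map moves with the velocity field `y g`. -/
theorem flowRatioDeriv_field (b : ℝ →ᵇ ℝ) (x : ℝ) :
    flowRatioDeriv b (d.field b) x = flowRatio b x * d.velocity b (flowMap b x) := by
  set m : ℝ → ℝ := fun s => ∫ r in (0 : ℝ)..s, Real.exp (b (r * x)) with hm
  have hmd : ∀ s, HasDerivAt m (Real.exp (b (s * x))) s := fun s =>
    intervalIntegral.integral_hasDerivAt_right ((continuous_exp_mul b x).intervalIntegrable _ _)
      (continuous_exp_mul b x).aestronglyMeasurable.stronglyMeasurableAtFilter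
      (continuous_exp_mul b x).continuousAt
  have hflow : ∀ s, flowMap b (s * x) = x * m s := fun s => by
    rw [flowMap, hm, intervalIntegral.mul_integral_comp_mul_right (f := fun u => Real.exp (b u))]
    simp
  -- `m s = Y (s x) / x`, and `m s * g (Y (s x))` is a primitive of the integrand
  have hd : ∀ s, HasDerivAt (fun s => m s * d.velocity b (x * m s))
      (Real.exp (b (s * x)) * d.field b (s * x)) s := fun s => by
    have h1 := (d.hasDerivAt_velocity b (x * m s)).comp s ((hmd s).const_mul x)
    refine ((hmd s).mul h1).congr_deriv ?_
    rw [field_apply, rate, hflow]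
    simp only [Function.comp]
    ring
  rw [flowRatioDeriv, intervalIntegral.integral_eq_sub_of_hasDerivAt (fun s _ => hd s)
    ((continuous_exp_mul_apply b _ x).intervalIntegrable _ _)]
  have h1 := hflow 1
  rw [one_mul] at h1
  rw [← h1, show m 0 = 0 by simp [hm], show m 1 = flowRatio b x from rfl]
  ring

theorem continuous_flowRatio (b : ℝ →ᵇ ℝ) : Continuous (flowRatio b) :=
  Continuous.comp (g := fun p : (ℝ →ᵇ ℝ) × ℝ => flowRatio p.1 p.2) (f := fun x : ℝ => (b, x))
    continuous_flowRatio_uncurry (by fun_prop)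

theorem hasDerivAt_labelDensity {b V : ℝ → ℝ →ᵇ ℝ} (hb : ∀ t, HasDerivAt b (V t) t)
    (hV : Continuous V) (t x : ℝ) :
    HasDerivAt (fun t => d.labelDensity (b t) x)
      (d.labelDensity (b t) x
        * (2 * V t x - 5 * ((flowRatio (b t) x)⁻¹ * flowRatioDeriv (b t) (V t) x))) t := by
  have hq := flowRatio_pos (b t) x
  have h1 := ((hasDerivAt_apply (hb t) x).const_mul 2).exp
  have h2 := ((hasDerivAt_flowRatio hb hV t x).inv hq.ne').pow 5
  refine ((h1.const_mul (d.val x)).mul h2).congr_deriv ?_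
  simp only [labelDensity, Pi.pow_apply, Pi.inv_apply]
  push_cast
  field_simp
  ring

theorem continuous_flowRatioDeriv (b v : ℝ →ᵇ ℝ) : Continuous (flowRatioDeriv b v) := by
  refine intervalIntegral.continuous_parametric_intervalIntegral_of_continuous'
    (f := fun (x : ℝ) (s : ℝ) => Real.exp (b (s * x)) * v (s * x)) ?_ 0 1
  have h : Continuous fun q : ℝ × ℝ => q.2 * q.1 := by fun_prop
  exact (Real.continuous_exp.comp (b.continuous.comp h)).mul (v.continuous.comp h)

theorem integrable_labelDensity_mul {b : ℝ →ᵇ ℝ} {u : ℝ → ℝ} {K : ℝ} (hu : Continuous u)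
    (hK : ∀ x, |u x| ≤ K) : Integrable fun x => u x * d.labelDensity b x := by
  refine ((integrable_of_decay (d.continuous_labelDensity b).aestronglyMeasurable
    (M := Real.exp ‖b‖ ^ 7 * d.bound) fun x => ?_).bdd_mul (c := K) hu.aestronglyMeasurable
      (ae_of_all _ hK))
  refine (d.abs_labelDensity_le le_rfl x).trans ?_
  rw [mul_assoc]
  gcongr
  exact d.abs_val_le x

/-- The time derivative of an integral over labels, for a test function `ψ` such that `ψ` and
`y ψ'` are bounded. -/
theorem hasDerivAt_integral_labelDensity {b V : ℝ → ℝ →ᵇ ℝ} (hb : ∀ t, HasDerivAt b (V t) t)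
    (hV : Continuous V) {ψ : ℝ → ℝ} {K : ℝ} (hψ : ContDiff ℝ 1 ψ) (h0 : ∀ y, |ψ y| ≤ K)
    (h1 : ∀ y, |y * deriv ψ y| ≤ K) (t : ℝ) :
    HasDerivAt (fun t => ∫ x, ψ (flowMap (b t) x) * d.labelDensity (b t) x)
      (∫ x, (flowMap (b t) x * deriv ψ (flowMap (b t) x)
          * ((flowRatio (b t) x)⁻¹ * flowRatioDeriv (b t) (V t) x)
        + ψ (flowMap (b t) x)
          * (2 * V t x - 5 * ((flowRatio (b t) x)⁻¹ * flowRatioDeriv (b t) (V t) x)))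
        * d.labelDensity (b t) x) t := by
  obtain ⟨N, hN⟩ := eventually_norm_le_of_hasDerivAt hb hV t
  have hK : 0 ≤ K := (abs_nonneg _).trans (h0 0)
  have cψ := hψ.continuous
  have cψ' := hψ.continuous_deriv le_rfl
  have cF : ∀ r, Continuous fun x => ψ (flowMap (b r) x) := fun r =>
    cψ.comp (continuous_flowMap _)
  refine (hasDerivAt_integral_of_dominated_loc_of_deriv_le
    (F := fun t x => ψ (flowMap (b t) x) * d.labelDensity (b t) x)
    (F' := fun t x => (flowMap (b t) x * deriv ψ (flowMap (b t) x)
          * ((flowRatio (b t) x)⁻¹ * flowRatioDeriv (b t) (V t) x)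
        + ψ (flowMap (b t) x)
          * (2 * V t x - 5 * ((flowRatio (b t) x)⁻¹ * flowRatioDeriv (b t) (V t) x)))
        * d.labelDensity (b t) x)
    (bound := fun x => (K * (Real.exp N * (Real.exp N * N))
      + K * (2 * N + 5 * (Real.exp N * (Real.exp N * N))))
      * (Real.exp N ^ 7 * (d.bound * (1 + x ^ 2)⁻¹)))
    hN (Eventually.of_forall fun r =>
      ((cF r).mul (d.continuous_labelDensity (b r))).aestronglyMeasurable)
    (d.integrable_labelDensity_mul (cF t) fun x => h0 _) ?_
    (ae_of_all _ fun x r hr => ?_)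
    (((integrable_inv_one_add_sq.const_mul _).const_mul _).const_mul _)
    (ae_of_all _ fun x r _ => ?_)).2
  · have c1 := continuous_flowMap (b t)
    have c2 : Continuous fun x => (flowRatio (b t) x)⁻¹ :=
      (continuous_flowRatio (b t)).inv₀ fun x => (flowRatio_pos (b t) x).ne'
    have c3 := continuous_flowRatioDeriv (b t) (V t)
    have c4 := d.continuous_labelDensity (b t)
    have c5 := (V t).continuous
    exact (by fun_prop : Continuous _).aestronglyMeasurable
  · have hq := flowRatio_pos (b r) x
    have hr1 : |(flowRatio (b r) x)⁻¹ * flowRatioDeriv (b r) (V r) x|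
        ≤ Real.exp N * (Real.exp N * N) := by
      rw [abs_mul, abs_of_pos (inv_pos.2 hq)]
      have := inv_flowRatio_le hr.1 x
      have := abs_flowRatioDeriv_le hr.1 hr.2 x
      gcongr
    set ρ := (flowRatio (b r) x)⁻¹ * flowRatioDeriv (b r) (V r) x
    have hN0 : 0 ≤ N := (norm_nonneg _).trans hr.1
    rw [Real.norm_eq_abs, abs_mul]
    refine mul_le_mul ?_ ((d.abs_labelDensity_le hr.1 x).trans ?_) (abs_nonneg _) (by positivity)
    · refine (abs_add_le _ _).trans (add_le_add ?_ ?_)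
      · rw [abs_mul]
        exact mul_le_mul (h1 _) hr1 (abs_nonneg _) hK
      · rw [abs_mul]
        refine mul_le_mul (h0 _) ?_ (abs_nonneg _) hK
        refine (abs_sub _ _).trans ?_
        rw [abs_mul, abs_mul, abs_of_pos (by norm_num : (0 : ℝ) < 2),
          abs_of_pos (by norm_num : (0 : ℝ) < 5)]
        have := abs_apply_le hr.2 x
        gcongr
    · gcongr
      exact d.abs_val_le x
  · have hq := flowRatio_pos (b r) x
    have e1 : HasDerivAt (fun t => flowMap (b t) x)
        (x * flowRatioDeriv (b r) (V r) x) r := by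
      simp only [flowMap_eq]
      exact (hasDerivAt_flowRatio hb hV r x).const_mul x
    have e2 := ((hψ.differentiable (by norm_num) (flowMap (b r) x)).hasDerivAt).comp r e1
    refine (e2.mul (d.hasDerivAt_labelDensity hb hV r x)).congr_deriv ?_
    simp only [Function.comp]
    rw [show x * flowRatioDeriv (b r) (V r) x
      = flowMap (b r) x * ((flowRatio (b r) x)⁻¹ * flowRatioDeriv (b r) (V r) x) by
        rw [flowMap_eq]; field_simp]
    ring

/-- The weak form of the transport equation, at a time at which `b' = field b`. -/
theorem hasDerivAt_integral_eulerMomentum {b V : ℝ → ℝ →ᵇ ℝ} (hb : ∀ t, HasDerivAt b (V t) t)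
    (hV : Continuous V) {ψ : ℝ → ℝ} {K : ℝ} (hψ : ContDiff ℝ 1 ψ) (h0 : ∀ y, |ψ y| ≤ K)
    (h1 : ∀ y, |y * deriv ψ y| ≤ K) {t : ℝ} (ht : V t = d.field (b t)) :
    HasDerivAt (fun t => ∫ y, ψ y * d.eulerMomentum (b t) y)
      (∫ y, (y * deriv ψ y * d.velocity (b t) y + ψ y
        * (2 * (y * greenDeriv (d.eulerMomentum (b t)) y) - 3 * d.velocity (b t) y))
        * d.eulerMomentum (b t) y) t := by
  simp only [integral_mul_eulerMomentum]
  refine (d.hasDerivAt_integral_labelDensity hb hV hψ h0 h1 t).congr_deriv ?_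
  refine integral_congr_ae (ae_of_all _ fun x => ?_)
  have hq := (flowRatio_pos (b t) x).ne'
  simp only [ht, flowRatioDeriv_field, field_apply, rate]
  rw [inv_mul_cancel_left₀ hq]
  ring

end DecayingDensity

/-! ### The a priori bound -/

/-- For the potential of a density `φ`, the weak form of the equation is that of
`φ_t + y g φ_y = (y g_y - 4 g) φ`. -/
theorem testedRHS_greenPotential {φ ψ : ℝ → ℝ} {M K : ℝ} (hφ : Continuous φ)
    (h : ∀ y, |φ y| ≤ M * (1 + y ^ 2)⁻¹) (hψ : ContDiff ℝ 1 ψ) (h0 : ∀ y, |ψ y| ≤ K)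
    (h1 : ∀ y, |deriv ψ y| ≤ K) :
    testedRHS (greenPotential φ) ψ = ∫ y, (y * deriv ψ y * greenPotential φ y
      + ψ y * (2 * (y * greenDeriv φ y) - 3 * greenPotential φ y)) * φ y := by
  have hp := decayingProfile_greenPotential hφ h
  have hb := fun y => le_of_decay (h y)
  have hC := hp.nonneg
  set C := (decayConst + 1) * M
  have e1 := deriv_greenPotential hφ hb
  have e2 := deriv_deriv_greenPotential hφ hb
  set g := greenPotential φ with hg
  have cg := hp.continuous_zero
  have cg1 := hp.continuous_one
  have l1 := hp.le_one
  have hd1 := hp.hasDerivAt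
  rw [e1] at cg1 l1 hd1
  have cψ := hψ.continuous
  have cψ1 := hψ.continuous_deriv le_rfl
  have hK : 0 ≤ K := (abs_nonneg _).trans (h0 0)
  have i1 := integrable_testedRHS_integrand hp hψ h0 h1
  have i2 : Integrable fun y => (y * deriv ψ y * g y
      + ψ y * (2 * (y * greenDeriv φ y) - 3 * g y)) * φ y := by
    have := integrable_decay_mul hφ h (u := fun y => y * deriv ψ y * g y
      + ψ y * (2 * (y * greenDeriv φ y) - 3 * g y)) (K := K * C + K * (2 * C + 3 * C))
      (by fun_prop) fun y => by
        have a0 := le_of_decay (hp.le_zero y)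
        have a1 := abs_mul_le_of_decay (hp.le_zero y)
        have a2 := abs_mul_le_of_decay (l1 y)
        refine (abs_add_le _ _).trans (add_le_add ?_ ?_)
        · rw [show y * deriv ψ y * g y = deriv ψ y * (y * g y) by ring, abs_mul]
          exact mul_le_mul (h1 y) a1 (abs_nonneg _) hK
        · rw [abs_mul]
          refine mul_le_mul (h0 y) ((abs_sub _ _).trans ?_) (abs_nonneg _) hK
          rw [abs_mul, abs_mul 3, abs_of_pos (by norm_num : (0 : ℝ) < 2),
            abs_of_pos (by norm_num : (0 : ℝ) < 3)]
          gcongr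
    simpa only [mul_comm (φ _)] using this
  have iQ : Integrable fun y => y * g y ^ 2 * ψ y := by
    have := integrable_decay_mul cg hp.le_zero (u := fun y => (y * g y) * ψ y) (K := C * K)
      (by fun_prop) fun y => by
        rw [abs_mul]
        exact mul_le_mul (abs_mul_le_of_decay (hp.le_zero y)) (h0 y) (abs_nonneg _) hC
    refine this.congr (ae_of_all _ fun y => ?_)
    simp only
    ring
  have key := integral_eq_zero_of_hasDerivAt_of_integrable (fun y => ?_) (i2.sub i1) iQ
  · rw [testedRHS_eq hp (hψ.differentiable (by norm_num))]
    simp only [Pi.sub_apply] at key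
    rw [integral_sub i2 i1] at key
    linarith
  · have := ((hasDerivAt_id y).mul ((hp.hasDerivAt y).pow 2)).mul
      (hψ.differentiable (by norm_num) y).hasDerivAt
    refine this.congr_deriv ?_
    simp only [e2]
    simp only [Pi.sub_apply, Pi.mul_apply, Pi.pow_apply, id, e1]
    push_cast
    ring

/-- The decisive sign. Since `2 φ g' = (g² - g'²)'`, one integration by parts turns the integral
into that of `(y w' - 3 w) g φ - (y w)' (g² - g'²)`, and both terms are nonpositive for a
nonnegative density and a weight with `0 ≤ y w' ≤ 3 w`. -/
theorem integral_weight_nonpos {φ w : ℝ → ℝ} {M K : ℝ} (hφ : Continuous φ)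
    (h : ∀ y, |φ y| ≤ M * (1 + y ^ 2)⁻¹) (hpos : ∀ y, 0 ≤ φ y) (hw : ContDiff ℝ 1 w)
    (h0 : ∀ y, |w y| ≤ K) (hw0 : ∀ y, 0 ≤ y * deriv w y)
    (hw1 : ∀ y, y * deriv w y ≤ 3 * w y) :
    ∫ y, (y * deriv w y * greenPotential φ y
      + w y * (2 * (y * greenDeriv φ y) - 3 * greenPotential φ y)) * φ y ≤ 0 := by
  have hp := decayingProfile_greenPotential hφ h
  have hb := fun y => le_of_decay (h y)
  have hC := hp.nonneg
  set C := (decayConst + 1) * M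
  have e1 := deriv_greenPotential hφ hb
  have hg0 := greenPotential_nonneg hpos
  have hg1 := abs_greenDeriv_le_greenPotential hpos
  have hdd := hasDerivAt_greenDeriv hφ hb
  set g := greenPotential φ with hg
  have cg := hp.continuous_zero
  have cg1 := hp.continuous_one
  have l1 := hp.le_one
  have hd1 := hp.hasDerivAt
  rw [e1] at cg1 l1 hd1
  have cw := hw.continuous
  have cw1 := hw.continuous_deriv le_rfl
  have hK : 0 ≤ K := (abs_nonneg _).trans (h0 0)
  have hyw : ∀ y, |y * deriv w y| ≤ 3 * K := fun y => by
    rw [abs_of_nonneg (hw0 y)]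
    linarith [hw1 y, (abs_le.1 (h0 y)).2]
  have hb0 := fun y => le_of_decay (hp.le_zero y)
  have hb1 := fun y => le_of_decay (l1 y)
  -- the two parts of the integrand
  have i1 : Integrable fun y => φ y * ((y * deriv w y - 3 * w y) * g y) := by
    refine integrable_decay_mul hφ h (K := (3 * K + 3 * K) * C) (by fun_prop) fun y => ?_
    rw [abs_mul]
    refine mul_le_mul ((abs_sub _ _).trans (add_le_add (hyw y) ?_)) (hb0 y) (abs_nonneg _)
      (by positivity)
    rw [abs_mul, abs_of_pos (by norm_num : (0 : ℝ) < 3)]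
    linarith [h0 y]
  have i2 : Integrable fun y => φ y * (2 * w y * (y * greenDeriv φ y)) := by
    refine integrable_decay_mul hφ h (K := 2 * K * C) (by fun_prop) fun y => ?_
    rw [abs_mul, abs_mul, abs_of_pos (by norm_num : (0 : ℝ) < 2)]
    have := h0 y
    have := abs_mul_le_of_decay (l1 y)
    gcongr
  have i3 : Integrable fun y => g y * ((w y + y * deriv w y) * g y) := by
    refine integrable_decay_mul cg hp.le_zero (K := (K + 3 * K) * C) (by fun_prop) fun y => ?_
    rw [abs_mul]
    exact mul_le_mul ((abs_add_le _ _).trans (add_le_add (h0 y) (hyw y))) (hb0 y) (abs_nonneg _)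
      (by positivity)
  have i4 : Integrable fun y => greenDeriv φ y * ((w y + y * deriv w y) * greenDeriv φ y) := by
    refine integrable_decay_mul cg1 l1 (K := (K + 3 * K) * C) (by fun_prop) fun y => ?_
    rw [abs_mul]
    exact mul_le_mul ((abs_add_le _ _).trans (add_le_add (h0 y) (hyw y))) (hb1 y) (abs_nonneg _)
      (by positivity)
  have iQ : Integrable fun y => w y * y * (g y ^ 2 - greenDeriv φ y ^ 2) := by
    have q1 := integrable_decay_mul cg hp.le_zero (u := fun y => w y * (y * g y)) (K := K * C)
      (by fun_prop) fun y => by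
        rw [abs_mul]
        exact mul_le_mul (h0 y) (abs_mul_le_of_decay (hp.le_zero y)) (abs_nonneg _) hK
    have q2 := integrable_decay_mul cg1 l1 (u := fun y => w y * (y * greenDeriv φ y)) (K := K * C)
      (by fun_prop) fun y => by
        rw [abs_mul]
        exact mul_le_mul (h0 y) (abs_mul_le_of_decay (l1 y)) (abs_nonneg _) hK
    refine (q1.sub q2).congr (ae_of_all _ fun y => ?_)
    simp only [Pi.sub_apply]
    ring
  have iQ' := (i3.sub i4).add i2
  have key := integral_eq_zero_of_hasDerivAt_of_integrable (fun y => ?_) iQ' iQ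
  · have hsplit : ∫ y, (y * deriv w y * g y
        + w y * (2 * (y * greenDeriv φ y) - 3 * g y)) * φ y
        = ∫ y, (φ y * ((y * deriv w y - 3 * w y) * g y)
          - (g y * ((w y + y * deriv w y) * g y)
            - greenDeriv φ y * ((w y + y * deriv w y) * greenDeriv φ y))) := by
      have hadd := integral_add (i1.sub (i3.sub i4)) iQ'
      rw [key, add_zero] at hadd
      refine Eq.trans (integral_congr_ae (ae_of_all _ fun y => ?_)) hadd
      simp only [Pi.sub_apply, Pi.add_apply]
      ring
    rw [hsplit]
    refine integral_nonpos fun y => ?_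
    have a1 : φ y * ((y * deriv w y - 3 * w y) * g y) ≤ 0 :=
      mul_nonpos_of_nonneg_of_nonpos (hpos y)
        (mul_nonpos_of_nonpos_of_nonneg (by linarith [hw1 y]) (hg0 y))
    have a2 : greenDeriv φ y * greenDeriv φ y ≤ g y * g y := by
      have := mul_self_le_mul_self (abs_nonneg _) (hg1 y)
      rwa [abs_mul_abs_self] at this
    have a3 : 0 ≤ w y + y * deriv w y := by linarith [hw0 y, hw1 y]
    have a4 := mul_le_mul_of_nonneg_left a2 a3
    simp only [Pi.zero_apply]
    linarith
  · have := ((hw.differentiable (by norm_num) y).hasDerivAt.mul (hasDerivAt_id y)).mul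
      (((hd1 y).pow 2).sub ((hdd y).pow 2))
    refine this.congr_deriv ?_
    simp only [Pi.sub_apply, Pi.mul_apply, Pi.pow_apply, Pi.add_apply, id]
    push_cast
    ring

/-- The weight `y ↦ R (1 + y²) / (R² + y²)`, of size `R⁻¹ (1 + y²)` for `|y| ≤ R` and of size `R`
beyond. Integrated against a density of size `(1 + y²)⁻¹` it gives a bound independent of `R`. -/
def scaleWeight (R y : ℝ) : ℝ := R * (1 + y ^ 2) / (R ^ 2 + y ^ 2)

section ScaleWeight

variable {R : ℝ}

theorem contDiff_scaleWeight (hR : 1 ≤ R) : ContDiff ℝ 1 (scaleWeight R) := by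
  unfold scaleWeight
  refine ContDiff.div (by fun_prop) (by fun_prop) fun y => ?_
  positivity

theorem mul_deriv_scaleWeight (hR : 1 ≤ R) (y : ℝ) :
    y * deriv (scaleWeight R) y = 2 * R * (R ^ 2 - 1) * y ^ 2 / (R ^ 2 + y ^ 2) ^ 2 := by
  have hne : R ^ 2 + y ^ 2 ≠ 0 := by positivity
  have h1 : HasDerivAt (fun y : ℝ => R * (1 + y ^ 2)) (R * (2 * y)) y := by
    simpa using (((hasDerivAt_id y).pow 2).const_add 1).const_mul R
  have h2 : HasDerivAt (fun y : ℝ => R ^ 2 + y ^ 2) (2 * y) y := by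
    simpa using ((hasDerivAt_id y).pow 2).const_add (R ^ 2)
  have h := h1.div h2 hne
  rw [show scaleWeight R = fun y : ℝ => R * (1 + y ^ 2) / (R ^ 2 + y ^ 2) from rfl,
    show (fun y : ℝ => R * (1 + y ^ 2) / (R ^ 2 + y ^ 2))
      = (fun y : ℝ => R * (1 + y ^ 2)) / (fun y : ℝ => R ^ 2 + y ^ 2) from rfl, h.deriv]
  field_simp
  ring

theorem mul_deriv_scaleWeight_nonneg (hR : 1 ≤ R) (y : ℝ) : 0 ≤ y * deriv (scaleWeight R) y := by
  rw [mul_deriv_scaleWeight hR]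
  have : 0 ≤ R ^ 2 - 1 := by nlinarith
  positivity

theorem mul_deriv_scaleWeight_le (hR : 1 ≤ R) (y : ℝ) :
    y * deriv (scaleWeight R) y ≤ 3 * scaleWeight R y := by
  have hpos : 0 < R ^ 2 + y ^ 2 := by positivity
  rw [mul_deriv_scaleWeight hR, scaleWeight, ← mul_div_assoc, div_le_div_iff₀ (by positivity) hpos]
  have h1 : 2 * ((R ^ 2 - 1) * y ^ 2) ≤ 3 * ((1 + y ^ 2) * (R ^ 2 + y ^ 2)) := by
    nlinarith [sq_nonneg y, sq_nonneg R, mul_nonneg (sq_nonneg R) (sq_nonneg y),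
      mul_nonneg (sq_nonneg y) (sq_nonneg y)]
  have h2 : 0 ≤ R * (R ^ 2 + y ^ 2) := by positivity
  nlinarith [mul_le_mul_of_nonneg_left h1 h2]

theorem scaleWeight_nonneg (hR : 1 ≤ R) (y : ℝ) : 0 ≤ scaleWeight R y := by
  unfold scaleWeight
  positivity

theorem scaleWeight_le (hR : 1 ≤ R) (y : ℝ) : scaleWeight R y ≤ R := by
  unfold scaleWeight
  rw [div_le_iff₀ (by positivity)]
  gcongr
  nlinarith

theorem integrable_scaleWeight_mul_inv (hR : 1 ≤ R) :
    Integrable fun y => scaleWeight R y * (1 + y ^ 2)⁻¹ := by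
  refine integrable_inv_one_add_sq.bdd_mul (c := R)
    (contDiff_scaleWeight hR).continuous.aestronglyMeasurable (ae_of_all _ fun y => ?_)
  rw [Real.norm_eq_abs, abs_of_nonneg (scaleWeight_nonneg hR y)]
  exact scaleWeight_le hR y

theorem integral_scaleWeight_mul_inv (hR : 1 ≤ R) :
    ∫ y, scaleWeight R y * (1 + y ^ 2)⁻¹ = Real.pi := by
  have hR0 : 0 < R := by linarith
  have h : ∀ y : ℝ, scaleWeight R y * (1 + y ^ 2)⁻¹ = R⁻¹ * (1 + (y / R) ^ 2)⁻¹ := fun y => by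
    unfold scaleWeight
    have : R ^ 2 + y ^ 2 ≠ 0 := by positivity
    have : (1 : ℝ) + y ^ 2 ≠ 0 := by positivity
    have : (1 : ℝ) + (y / R) ^ 2 ≠ 0 := by positivity
    field_simp
  simp_rw [h]
  rw [integral_const_mul, Measure.integral_comp_div (fun y : ℝ => (1 + y ^ 2)⁻¹) R,
    integral_univ_inv_one_add_sq, abs_of_pos hR0, smul_eq_mul, inv_mul_cancel_left₀ hR0.ne']

/-- At the scale `R = √(1 + z²)` the weight dominates the Green kernel centred at `z`. -/
theorem sqrt_mul_exp_le_scaleWeight (z y : ℝ) :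
    Real.sqrt (1 + z ^ 2) * Real.exp (-|z - y|) ≤ 3 * scaleWeight (Real.sqrt (1 + z ^ 2)) y := by
  have hsq : Real.sqrt (1 + z ^ 2) ^ 2 = 1 + z ^ 2 := Real.sq_sqrt (by positivity)
  rw [scaleWeight, hsq, mul_div_assoc, mul_left_comm]
  gcongr
  rw [← mul_div_assoc, le_div_iff₀ (by positivity)]
  have he : Real.exp (-|z - y|) * Real.exp (|z - y|) = 1 := by rw [← Real.exp_add]; simp
  have h2 := Real.quadratic_le_exp_of_nonneg (abs_nonneg (z - y))
  have h3 : 1 + z ^ 2 + y ^ 2 ≤ 3 * (1 + y ^ 2) * Real.exp |z - y| := by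
    have h4 : 1 + (z - y) ^ 2 / 2 ≤ Real.exp |z - y| := by
      rw [sq_abs] at h2
      linarith [abs_nonneg (z - y)]
    have h5 : 3 * (1 + y ^ 2) * (1 + (z - y) ^ 2 / 2) ≤ 3 * (1 + y ^ 2) * Real.exp |z - y| := by
      gcongr
    nlinarith [sq_nonneg (z - 3 * y), sq_nonneg y, mul_nonneg (sq_nonneg y) (sq_nonneg (z - y)),
      sq_nonneg (z - y), sq_nonneg (z - 2 * y)]
  calc Real.exp (-|z - y|) * (1 + z ^ 2 + y ^ 2)
      ≤ Real.exp (-|z - y|) * (3 * (1 + y ^ 2) * Real.exp |z - y|) := by gcongr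
    _ = 3 * (1 + y ^ 2) * (Real.exp (-|z - y|) * Real.exp |z - y|) := by ring
    _ = _ := by rw [he, mul_one]

end ScaleWeight

namespace DecayingDensity

variable (d : DecayingDensity)

theorem eulerMomentum_nonneg (hd : ∀ x, 0 ≤ d.val x) (b : ℝ →ᵇ ℝ) (y : ℝ) :
    0 ≤ d.eulerMomentum b y :=
  mul_nonneg (mul_nonneg (mul_nonneg (hd _) (Real.exp_nonneg _))
    (pow_nonneg (inv_nonneg.2 (flowRatio_pos _ _).le) _)) (Real.exp_nonneg _)

theorem flowMap_zero_rate (x : ℝ) : flowMap 0 x = x := by simp [flowMap]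

theorem labelDensity_zero (x : ℝ) : d.labelDensity 0 x = d.val x := by
  simp [labelDensity, flowRatio]

theorem eulerMomentum_zero : d.eulerMomentum 0 = d.val := by
  funext y
  have := flowLabel_flowMap 0 y
  rw [flowMap_zero_rate] at this
  simp [eulerMomentum, this, labelDensity_zero]

/-- The a priori estimate: along a solution of `b' = field b` starting from `b = 0` with a
nonnegative density, `√(1 + z²) g(t, z)` is bounded independently of time. -/
theorem sqrt_mul_velocity_le (hd : ∀ x, 0 ≤ d.val x) {b V : ℝ → ℝ →ᵇ ℝ}
    (hb : ∀ t, HasDerivAt b (V t) t) (hV : Continuous V) (hb0 : b 0 = 0) {T : ℝ} (hT : 0 ≤ T)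
    (hfield : ∀ t ∈ Icc 0 T, V t = d.field (b t)) (z : ℝ) :
    Real.sqrt (1 + z ^ 2) * d.velocity (b T) z ≤ 3 / 2 * d.bound * Real.pi := by
  set R := Real.sqrt (1 + z ^ 2) with hR_def
  have hR : 1 ≤ R := Real.one_le_sqrt.2 (by nlinarith [sq_nonneg z])
  have hw := contDiff_scaleWeight hR
  have hwK : ∀ y, |scaleWeight R y| ≤ 3 * R := fun y => by
    rw [abs_of_nonneg (scaleWeight_nonneg hR y)]
    linarith [scaleWeight_le hR y]
  have hwK' : ∀ y, |y * deriv (scaleWeight R) y| ≤ 3 * R := fun y => by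
    rw [abs_of_nonneg (mul_deriv_scaleWeight_nonneg hR y)]
    linarith [mul_deriv_scaleWeight_le hR y, scaleWeight_le hR y]
  set E : ℝ → ℝ := fun t => ∫ y, scaleWeight R y * d.eulerMomentum (b t) y with hE
  have hder := fun t ht => d.hasDerivAt_integral_eulerMomentum hb hV hw hwK hwK'
    (hfield t ht)
  have hanti : AntitoneOn E (Icc 0 T) := by
    refine antitoneOn_of_deriv_nonpos (convex_Icc 0 T)
      (fun t ht => (hder t ht).continuousAt.continuousWithinAt)
      (fun t ht => (hder t (interior_subset ht)).differentiableAt.differentiableWithinAt)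
      fun t ht => ?_
    rw [(hder t (interior_subset ht)).deriv]
    exact integral_weight_nonpos (d.continuous_eulerMomentum _) (d.abs_eulerMomentum_le le_rfl)
      (d.eulerMomentum_nonneg hd _) hw hwK (mul_deriv_scaleWeight_nonneg hR)
      (mul_deriv_scaleWeight_le hR)
  have h1 := hanti (left_mem_Icc.2 hT) (right_mem_Icc.2 hT) hT
  have h2 : E 0 ≤ d.bound * Real.pi := by
    simp only [hE, hb0, eulerMomentum_zero]
    rw [← integral_scaleWeight_mul_inv hR, ← integral_const_mul]
    refine integral_mono_of_nonneg
      (ae_of_all _ fun y => mul_nonneg (scaleWeight_nonneg hR y) (hd y))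
      ((integrable_scaleWeight_mul_inv hR).const_mul _) (ae_of_all _ fun y => ?_)
    have := (le_abs_self _).trans (d.abs_val_le y)
    calc scaleWeight R y * d.val y ≤ scaleWeight R y * (d.bound * (1 + y ^ 2)⁻¹) :=
          mul_le_mul_of_nonneg_left this (scaleWeight_nonneg hR y)
      _ = _ := by ring
  have hc := d.continuous_eulerMomentum (b T)
  have h3 : R * ∫ y, Real.exp (-|z - y|) * d.eulerMomentum (b T) y ≤ 3 * E T := by
    rw [hE, ← integral_const_mul, ← integral_const_mul]
    refine integral_mono ((integrable_green hc (d.eulerMomentum_bdd le_rfl) z).const_mul _) ?_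
      fun y => ?_
    · refine Integrable.const_mul ?_ 3
      have := integrable_decay_mul hc (d.abs_eulerMomentum_le le_rfl) hw.continuous hwK
      simpa only [mul_comm] using this
    · have := mul_le_mul_of_nonneg_right (sqrt_mul_exp_le_scaleWeight z y)
        (d.eulerMomentum_nonneg hd (b T) y)
      simp only
      linarith
  rw [velocity, greenPotential]
  linarith

/-- The bound for the stretching rate along solutions with nonnegative density. -/
def globalBound : ℝ := 3 * d.bound * Real.pi

theorem globalBound_nonneg : 0 ≤ d.globalBound := by
  have := d.bound_nonneg
  unfold globalBound
  positivity

theorem norm_field_le_globalBound (hd : ∀ x, 0 ≤ d.val x) {b V : ℝ → ℝ →ᵇ ℝ}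
    (hb : ∀ t, HasDerivAt b (V t) t) (hV : Continuous V) (hb0 : b 0 = 0) {T : ℝ} (hT : 0 ≤ T)
    (hfield : ∀ t ∈ Icc 0 T, V t = d.field (b t)) : ‖d.field (b T)‖ ≤ d.globalBound := by
  refine (BoundedContinuousFunction.norm_le d.globalBound_nonneg).2 fun x => ?_
  have key := d.sqrt_mul_velocity_le hd hb hV hb0 hT hfield (flowMap (b T) x)
  have hpos := d.eulerMomentum_nonneg hd (b T)
  have h1 := abs_greenDeriv_le_greenPotential hpos (flowMap (b T) x)
  have h0 : 0 ≤ d.velocity (b T) (flowMap (b T) x) := greenPotential_nonneg hpos _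
  rw [field_apply, rate, Real.norm_eq_abs]
  change |greenDeriv (d.eulerMomentum (b T)) (flowMap (b T) x)|
    ≤ d.velocity (b T) (flowMap (b T) x) at h1
  set y := flowMap (b T) x
  have s1 : 1 ≤ Real.sqrt (1 + y ^ 2) := Real.one_le_sqrt.2 (by nlinarith [sq_nonneg y])
  have s2 : |y| ≤ Real.sqrt (1 + y ^ 2) := Real.abs_le_sqrt (by linarith)
  refine (abs_add_le _ _).trans ?_
  rw [abs_of_nonneg h0, abs_mul]
  have t1 := mul_le_mul_of_nonneg_right s1 h0
  have t2 := mul_le_mul s2 h1 (abs_nonneg _) (Real.sqrt_nonneg _)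
  unfold globalBound
  linarith

theorem norm_le_globalBound_mul (hd : ∀ x, 0 ≤ d.val x) {b V : ℝ → ℝ →ᵇ ℝ}
    (hb : ∀ t, HasDerivAt b (V t) t) (hV : Continuous V) (hb0 : b 0 = 0) {T : ℝ} (hT : 0 ≤ T)
    (hfield : ∀ t ∈ Icc 0 T, V t = d.field (b t)) : ‖b T‖ ≤ d.globalBound * T := by
  have h := norm_image_sub_le_of_norm_deriv_le_segment' (f := b) (f' := V) (a := 0) (b := T)
    (C := d.globalBound) (fun t _ => (hb t).hasDerivWithinAt) (fun t ht => by
      rw [hfield t (Ico_subset_Icc_self ht)]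
      exact d.norm_field_le_globalBound hd hb hV hb0 ht.1 fun s hs =>
        hfield s ⟨hs.1, hs.2.trans ht.2.le⟩) T (right_mem_Icc.2 hT)
  simpa [hb0] using h

end DecayingDensity

/-! ### Global solvability of the Lagrangian equation -/

section BanachODE

variable {E : Type*} [NormedAddCommGroup E] [NormedSpace ℝ E] [CompleteSpace E]

theorem eqOn_integral_of_hasDerivWithinAt {α V : ℝ → E} {T : ℝ} (hV : Continuous V)
    (h0 : α 0 = 0) (hα : ∀ t ∈ Icc 0 T, HasDerivWithinAt α (V t) (Icc 0 T) t) :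
    ∀ t ∈ Icc 0 T, ∫ s in (0 : ℝ)..t, V s = α t := fun t ht => by
  rw [intervalIntegral.integral_eq_sub_of_hasDeriv_right_of_le ht.1
    (fun s hs => ((hα s ⟨hs.1, hs.2.trans ht.2⟩).continuousWithinAt).mono
      (Icc_subset_Icc_right ht.2)) (fun s hs => ?_) (hV.intervalIntegrable _ _), h0, sub_zero]
  refine (hα s ⟨hs.1.le, hs.2.le.trans ht.2⟩).mono_of_mem_nhdsWithin ?_
  exact mem_of_superset (Ioc_mem_nhdsGT (hs.2.trans_le ht.2)) fun r hr =>
    ⟨hs.1.le.trans hr.1.le, hr.2⟩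

theorem hasDerivAt_integral_of_continuous {V : ℝ → E} (hV : Continuous V) (t : ℝ) :
    HasDerivAt (fun t => ∫ s in (0 : ℝ)..t, V s) (V t) t :=
  intervalIntegral.integral_hasDerivAt_right (hV.intervalIntegrable _ _)
    hV.aestronglyMeasurable.stronglyMeasurableAtFilter hV.continuousAt

/-- A bounded, globally Lipschitz vector field has an integral curve on `[0, T]`, extended to a `C¹`
curve on the whole line. -/
theorem exists_integralCurve_of_lipschitz_of_bounded {F : E → E} {K : ℝ≥0} {C T : ℝ}
    (hF : LipschitzWith K F) (hC : ∀ x, ‖F x‖ ≤ C) (hT : 0 ≤ T) :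
    ∃ b V : ℝ → E, (∀ t, HasDerivAt b (V t) t) ∧ Continuous V ∧ b 0 = 0 ∧
      ∀ t ∈ Icc 0 T, V t = F (b t) := by
  have hC0 : 0 ≤ C := (norm_nonneg _).trans (hC 0)
  have hPL : IsPicardLindelof (fun _ : ℝ => F) (tmin := 0) (tmax := T)
      ⟨0, left_mem_Icc.2 hT⟩ (0 : E) ⟨C * T, mul_nonneg hC0 hT⟩ 0 ⟨C, hC0⟩ K :=
    { lipschitzOnWith := fun t _ => hF.lipschitzOnWith
      continuousOn := fun x _ => continuousOn_const
      norm_le := fun t _ x _ => hC x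
      mul_max_le := by
        change C * max (T - 0) (0 - 0) ≤ C * T - 0
        rw [sub_zero, sub_zero, sub_zero, max_eq_left hT] }
  obtain ⟨α, hα0, hα⟩ := hPL.exists_eq_forall_mem_Icc_hasDerivWithinAt₀
  have hα0' : α 0 = 0 := hα0
  have hαc : ContinuousOn α (Icc 0 T) := fun t ht => (hα t ht).continuousWithinAt
  set V : ℝ → E := fun t => F (IccExtend hT ((Icc 0 T).domRestrict α) t) with hV
  have hVc : Continuous V :=
    hF.continuous.comp (continuousOn_iff_continuous_domRestrict.1 hαc).Icc_extend'
  have hVα : ∀ t ∈ Icc 0 T, V t = F (α t) := fun t ht => by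
    simp only [hV]
    rw [IccExtend_of_mem hT _ ht]
    rfl
  have heq := eqOn_integral_of_hasDerivWithinAt hVc hα0' fun t ht => by
    rw [hVα t ht]; exact hα t ht
  exact ⟨fun t => ∫ s in (0 : ℝ)..t, V s, V, hasDerivAt_integral_of_continuous hVc, hVc,
    intervalIntegral.integral_same, fun t ht => (hVα t ht).trans (congrArg F (heq t ht).symm)⟩

end BanachODE

theorem lipschitzWith_clip (N : ℝ) : LipschitzWith 1 fun r : ℝ => max (-N) (min N r) :=
  (LipschitzWith.id.const_min N).const_max (-N)

/-- Pointwise truncation to `[-N, N]`. -/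
def clip (N : ℝ) : (ℝ →ᵇ ℝ) → ℝ →ᵇ ℝ :=
  BoundedContinuousFunction.comp _ (lipschitzWith_clip N)

theorem norm_clip_le {N : ℝ} (hN : 0 ≤ N) (b : ℝ →ᵇ ℝ) : ‖clip N b‖ ≤ N := by
  refine (BoundedContinuousFunction.norm_le hN).2 fun x => ?_
  change |max (-N) (min N (b x))| ≤ N
  exact abs_le.2 ⟨le_max_left _ _, max_le (by linarith) (min_le_left _ _)⟩

theorem clip_eq_self {N : ℝ} {b : ℝ →ᵇ ℝ} (hb : ‖b‖ ≤ N) : clip N b = b := by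
  ext x
  have h := abs_le.1 (abs_apply_le hb x)
  change max (-N) (min N (b x)) = b x
  rw [min_eq_right h.2, max_eq_right h.1]

namespace DecayingDensity

variable (d : DecayingDensity)

/-- Existence on `[0, T]`. A solution for the vector field truncated at a radius above the a priori
bound never reaches that radius. -/
theorem exists_integralCurve_field (hd : ∀ x, 0 ≤ d.val x) {T : ℝ} (hT : 0 ≤ T) :
    ∃ b V : ℝ → ℝ →ᵇ ℝ, (∀ t, HasDerivAt b (V t) t) ∧ Continuous V ∧ b 0 = 0 ∧
      ∀ t ∈ Icc 0 T, V t = d.field (b t) := by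
  set N := d.globalBound * T + 1 with hN_def
  have hβ := d.globalBound_nonneg
  have hN : 0 ≤ N := by positivity
  have hLip : LipschitzWith (⟨d.rateLipschitz N, d.rateLipschitz_nonneg N⟩ : ℝ≥0)
      fun b => d.field (clip N b) := by
    refine LipschitzWith.of_dist_le_mul fun b₁ b₂ => ?_
    rw [dist_eq_norm]
    refine (d.norm_field_sub_le (norm_clip_le hN b₁) (norm_clip_le hN b₂)).trans ?_
    have := (BoundedContinuousFunction.lipschitz_comp (α := ℝ) (lipschitzWith_clip N)).dist_le_mul
      b₁ b₂
    rw [NNReal.coe_one, one_mul] at this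
    rw [← dist_eq_norm]
    exact mul_le_mul_of_nonneg_left this (d.rateLipschitz_nonneg N)
  obtain ⟨b, V, hb, hV, hb0, hVb⟩ := exists_integralCurve_of_lipschitz_of_bounded hLip
    (fun b => d.norm_field_le (norm_clip_le hN b)) hT
  have hbc : Continuous b := continuous_iff_continuousAt.2 fun t => (hb t).continuousAt
  refine ⟨b, V, hb, hV, hb0, ?_⟩
  -- as long as the norm has stayed below `N`, the truncation is not felt
  have hfield : ∀ t ∈ Icc 0 T, (∀ s ∈ Icc 0 t, ‖b s‖ ≤ N) →
      ∀ s ∈ Icc 0 t, V s = d.field (b s) := fun t ht h s hs => by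
    rw [hVb s ⟨hs.1, hs.2.trans ht.2⟩, clip_eq_self (h s hs)]
  have hind : Icc 0 T ⊆ {t | ∀ r ∈ Icc (0 : ℝ) 1, ‖b (r * t)‖ ≤ N} := by
    refine IsClosed.Icc_subset_of_forall_exists_gt (IsClosed.inter ?_ isClosed_Icc) ?_ ?_
    · simp only [ofPred_forall]
      refine isClosed_iInter fun r => isClosed_iInter fun _ => ?_
      exact isClosed_le (hbc.comp (by fun_prop)).norm continuous_const
    · intro r _
      rw [mul_zero, hb0, norm_zero]
      exact hN
    · rintro t ⟨ht, ht0, htT⟩ y hy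
      have hle : ∀ s ∈ Icc 0 t, ‖b s‖ ≤ N := fun s hs => by
        rcases ht0.eq_or_lt with h | h
        · rw [show s = 0 by linarith [hs.1, hs.2], hb0, norm_zero]
          exact hN
        · have := ht (s / t) ⟨div_nonneg hs.1 h.le, (div_le_one h).2 hs.2⟩
          rwa [div_mul_cancel₀ _ h.ne'] at this
      have hlt : ‖b t‖ < N := by
        have h1 := d.norm_le_globalBound_mul hd hb hV hb0 ht0
          (hfield t ⟨ht0, htT.le⟩ hle)
        have h2 : d.globalBound * t ≤ d.globalBound * T := by gcongr
        linarith
      obtain ⟨δ, hδ, hball⟩ := Metric.eventually_nhds_iff.1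
        ((hbc.norm.tendsto t).eventually (eventually_lt_nhds hlt))
      refine ⟨min y (t + δ / 2), ?_, lt_min hy (by linarith), min_le_left _ _⟩
      intro r hr
      have hz : min y (t + δ / 2) ≤ t + δ / 2 := min_le_right _ _
      have hz0 : 0 ≤ min y (t + δ / 2) :=
        le_min (ht0.trans (le_of_lt hy)) (by linarith)
      have hrz : r * min y (t + δ / 2) ≤ min y (t + δ / 2) := mul_le_of_le_one_left hz0 hr.2
      rcases le_total (r * min y (t + δ / 2)) t with h | h
      · exact hle _ ⟨mul_nonneg hr.1 hz0, h⟩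
      · refine (hball ?_).le
        rw [Real.dist_eq, abs_of_nonneg (by linarith)]
        linarith
  intro t ht
  refine hfield t ht (fun s hs => ?_) t (right_mem_Icc.2 ht.1)
  have := hind ⟨hs.1, hs.2.trans ht.2⟩ 1 ⟨zero_le_one, le_rfl⟩
  rwa [one_mul] at this

/-- Two solutions of `b' = field b` starting from `b = 0` agree. -/
theorem integralCurve_field_unique {b₁ V₁ b₂ V₂ : ℝ → ℝ →ᵇ ℝ}
    (hb₁ : ∀ t, HasDerivAt b₁ (V₁ t) t) (hb₂ : ∀ t, HasDerivAt b₂ (V₂ t) t) (h0 : b₁ 0 = b₂ 0)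
    {T : ℝ} (h₁ : ∀ t ∈ Icc 0 T, V₁ t = d.field (b₁ t))
    (h₂ : ∀ t ∈ Icc 0 T, V₂ t = d.field (b₂ t)) : EqOn b₁ b₂ (Icc 0 T) := by
  have c₁ : Continuous b₁ := continuous_iff_continuousAt.2 fun t => (hb₁ t).continuousAt
  have c₂ : Continuous b₂ := continuous_iff_continuousAt.2 fun t => (hb₂ t).continuousAt
  obtain ⟨N₁, hN₁⟩ := (isCompact_Icc (a := (0 : ℝ)) (b := T)).exists_bound_of_continuousOn
    c₁.continuousOn
  obtain ⟨N₂, hN₂⟩ := (isCompact_Icc (a := (0 : ℝ)) (b := T)).exists_bound_of_continuousOn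
    c₂.continuousOn
  set N := max N₁ N₂
  have hLip : LipschitzOnWith (⟨d.rateLipschitz N, d.rateLipschitz_nonneg N⟩ : ℝ≥0) d.field
      {b | ‖b‖ ≤ N} := LipschitzOnWith.of_dist_le_mul fun b hb b' hb' => by
    rw [dist_eq_norm, dist_eq_norm]
    exact d.norm_field_sub_le hb hb'
  refine ODE_solution_unique_of_mem_Icc_right (v := fun _ => d.field)
    (s := fun _ => {b | ‖b‖ ≤ N}) (fun _ _ => hLip) c₁.continuousOn (fun t ht => ?_)
    (fun t ht => (hN₁ t (Ico_subset_Icc_self ht)).trans (le_max_left _ _)) c₂.continuousOn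
    (fun t ht => ?_)
    (fun t ht => (hN₂ t (Ico_subset_Icc_self ht)).trans (le_max_right _ _)) h0
  · rw [← h₁ t (Ico_subset_Icc_self ht)]
    exact (hb₁ t).hasDerivWithinAt
  · rw [← h₂ t (Ico_subset_Icc_self ht)]
    exact (hb₂ t).hasDerivWithinAt

/-- Global existence for `b' = field b`, `b 0 = 0`, with a nonnegative density. The curve is extended
to negative times as a `C¹` curve, so that time derivatives at `t = 0` are two-sided. -/
theorem exists_global_integralCurve_field (hd : ∀ x, 0 ≤ d.val x) :
    ∃ b V : ℝ → ℝ →ᵇ ℝ, (∀ t, HasDerivAt b (V t) t) ∧ Continuous V ∧ b 0 = 0 ∧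
      ∀ t, 0 ≤ t → V t = d.field (b t) := by
  choose b V hb hV hb0 hVb using fun n : ℕ =>
    d.exists_integralCurve_field hd (Nat.cast_nonneg n : (0 : ℝ) ≤ n)
  have hbc : ∀ n, Continuous (b n) := fun n =>
    continuous_iff_continuousAt.2 fun t => (hb n t).continuousAt
  have hagree : ∀ m n : ℕ, m ≤ n → EqOn (b m) (b n) (Icc 0 m) := fun m n hmn =>
    d.integralCurve_field_unique (hb m) (hb n) ((hb0 m).trans (hb0 n).symm) (hVb m)
      fun t ht => hVb n t ⟨ht.1, ht.2.trans (by exact_mod_cast hmn)⟩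
  set B : ℝ → ℝ →ᵇ ℝ := fun t => b ⌈t⌉₊ (max t 0) with hB
  have hBn : ∀ (n : ℕ) (t : ℝ), t ≤ n → B t = b n (max t 0) := fun n t ht =>
    hagree _ n (Nat.ceil_le.2 ht) ⟨le_max_right _ _, max_le (Nat.le_ceil t) (Nat.cast_nonneg _)⟩
  have hBc : Continuous B := by
    rw [continuous_iff_continuousAt]
    intro t
    obtain ⟨n, hn⟩ := exists_nat_gt t
    have hc : Continuous fun t => b n (max t 0) := (hbc n).comp (by fun_prop)
    refine hc.continuousAt.congr ?_
    filter_upwards [eventually_lt_nhds hn] with s hs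
    exact (hBn n s hs.le).symm
  have hVc : Continuous fun t => d.field (B t) := d.continuous_field.comp hBc
  refine ⟨fun t => ∫ s in (0 : ℝ)..t, d.field (B s), fun t => d.field (B t),
    hasDerivAt_integral_of_continuous hVc, hVc, intervalIntegral.integral_same, fun t ht => ?_⟩
  obtain ⟨n, hn⟩ := exists_nat_ge t
  have heq := eqOn_integral_of_hasDerivWithinAt (T := n) hVc (hb0 n) (fun s hs => by
    rw [hBn n s hs.2, max_eq_left hs.1, ← hVb n s hs]
    exact (hb n s).hasDerivWithinAt) t ⟨ht, hn⟩
  simp only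
  rw [heq, hBn n t hn, max_eq_left ht]

end DecayingDensity

/-! ### Existence of a global solution -/

namespace DecayingDensity

variable (d : DecayingDensity)

theorem momentum_velocity (b : ℝ →ᵇ ℝ) : momentum (d.velocity b) = d.eulerMomentum b :=
  momentum_greenPotential (d.continuous_eulerMomentum b) (d.eulerMomentum_bdd le_rfl)

/-- The weak form of the equation along a trajectory of `b' = field b`. -/
theorem hasDerivWithinAt_integral_velocity {b V : ℝ → ℝ →ᵇ ℝ} (hb : ∀ t, HasDerivAt b (V t) t)
    (hV : Continuous V) {t : ℝ} (ht : V t = d.field (b t)) {ψ : ℝ → ℝ} (hψ : ContDiff ℝ 1 ψ)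
    (hcs : HasCompactSupport ψ) {I : Set ℝ} :
    HasDerivWithinAt (fun s => ∫ y, momentum (d.velocity (b s)) y * ψ y)
      (testedRHS (d.velocity (b t)) ψ) I t := by
  have cψ1 := hψ.continuous_deriv le_rfl
  obtain ⟨K₀, hK₀⟩ := hcs.exists_bound_of_continuous hψ.continuous
  obtain ⟨K₁, hK₁⟩ := hcs.deriv.exists_bound_of_continuous cψ1
  obtain ⟨K₂, hK₂⟩ := (hcs.deriv.mul_left (f := id)).exists_bound_of_continuous
    (continuous_id.mul cψ1)
  set K := max K₀ (max K₁ K₂)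
  have h0 : ∀ y, |ψ y| ≤ K := fun y => (hK₀ y).trans (le_max_left _ _)
  have h1 : ∀ y, |deriv ψ y| ≤ K := fun y =>
    (hK₁ y).trans ((le_max_left _ _).trans (le_max_right _ _))
  have h2 : ∀ y, |y * deriv ψ y| ≤ K := fun y =>
    (hK₂ y).trans ((le_max_right _ _).trans (le_max_right _ _))
  have key := d.hasDerivAt_integral_eulerMomentum hb hV hψ h0 h2 ht
  simp only [momentum_velocity, mul_comm _ (ψ _)]
  rw [velocity, testedRHS_greenPotential (d.continuous_eulerMomentum (b t))
    (d.abs_eulerMomentum_le le_rfl) hψ h0 h1]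
  exact key.hasDerivWithinAt

/-- The velocity along a global solution of `b' = field b` solves the Cauchy problem. -/
theorem isSolutionOn_velocity {b V : ℝ → ℝ →ᵇ ℝ} (hb : ∀ t, HasDerivAt b (V t) t)
    (hV : Continuous V) (hfield : ∀ t, 0 ≤ t → V t = d.field (b t)) :
    IsSolutionOn (Ici 0) fun t => d.velocity (b t) := by
  have hbc : Continuous b := continuous_iff_continuousAt.2 fun t => (hb t).continuousAt
  have hcomp : ∀ F : (ℝ →ᵇ ℝ) → ℝ → ℝ, Continuous (fun p : (ℝ →ᵇ ℝ) × ℝ => F p.1 p.2) →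
      Continuous fun p : ℝ × ℝ => F (b p.1) p.2 := fun F hF =>
    hF.comp (f := fun p : ℝ × ℝ => (b p.1, p.2)) (by fun_prop)
  have hc := fun t => d.continuous_eulerMomentum (b t)
  have hM := fun t => d.eulerMomentum_bdd (b := b t) le_rfl
  have c0 : Continuous fun p : ℝ × ℝ => d.velocity (b p.1) p.2 :=
    hcomp d.velocity d.continuous_velocity_uncurry
  have c1 : Continuous fun p : ℝ × ℝ => greenDeriv (d.eulerMomentum (b p.1)) p.2 :=
    hcomp (fun b => greenDeriv (d.eulerMomentum b)) d.continuous_velocityDeriv_uncurry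
  have cφ : Continuous fun p : ℝ × ℝ => d.eulerMomentum (b p.1) p.2 :=
    hcomp d.eulerMomentum d.continuous_eulerMomentum_uncurry
  have e1 : ∀ t, deriv (d.velocity (b t)) = greenDeriv (d.eulerMomentum (b t)) := fun t =>
    deriv_greenPotential (hc t) (hM t)
  have e2 : ∀ t y, deriv (deriv (d.velocity (b t))) y
      = d.velocity (b t) y - d.eulerMomentum (b t) y := fun t =>
    deriv_deriv_greenPotential (hc t) (hM t)
  refine ⟨fun t _ => contDiff_greenPotential (hc t) (hM t), c0.continuousOn, ?_, ?_, ?_, ?_, ?_⟩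
  · simp only [e1]
    exact c1.continuousOn
  · simp only [e2]
    exact (c0.sub cφ).continuousOn
  · intro τ _
    obtain ⟨N, hN⟩ := (isCompact_Icc (a := (0 : ℝ)) (b := τ)).exists_bound_of_continuousOn
      hbc.continuousOn
    refine ⟨d.bound * Real.exp N ^ 10, fun t ht htτ y => ?_⟩
    rw [momentum_velocity]
    have h := d.abs_eulerMomentum_le (hN t ⟨ht, htτ⟩) y
    rw [← div_eq_mul_inv, le_div_iff₀ (by positivity)] at h
    linarith [abs_nonneg (d.eulerMomentum (b t) y)]
  · intro t _ y
    rw [momentum_velocity]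
    rfl
  · exact fun ψ hψ hcs t ht => d.hasDerivWithinAt_integral_velocity hb hV (hfield t ht) hψ hcs

end DecayingDensity

/-- Restriction of a solution to a smaller time set of the form `[0, T)`. -/
theorem IsSolutionOn.restrict_Ico {g : ℝ → ℝ → ℝ} (hg : IsSolutionOn (Ici 0) g) (T : ℝ) :
    IsSolutionOn (Ico 0 T) g := by
  have hsub : Ico 0 T ⊆ Ici (0 : ℝ) := fun t ht => ht.1
  refine ⟨fun t ht => hg.contDiff t (hsub ht), hg.continuousOn.mono (prod_mono_left hsub),
    hg.continuousOn_deriv.mono (prod_mono_left hsub),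
    hg.continuousOn_deriv_deriv.mono (prod_mono_left hsub), fun τ hτ => ?_,
    fun t ht => hg.eq_potential t (hsub ht),
    fun ψ hψ hc t ht => (hg.equation ψ hψ hc t (hsub ht)).mono hsub⟩
  obtain ⟨M, hM⟩ := hg.decay τ (hsub hτ)
  exact ⟨M, fun t ht => hM t (hsub ht)⟩

theorem exists_decay_of_continuous {φ : ℝ → ℝ} {M : ℝ} (hφ : Continuous φ)
    (h : ∀ y, y ^ 2 * |φ y| ≤ M) : ∃ N, ∀ y, |φ y| ≤ N * (1 + y ^ 2)⁻¹ := by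
  obtain ⟨M', hM'⟩ := (isCompact_Icc (a := (-1 : ℝ)) (b := 1)).exists_bound_of_continuousOn
    hφ.continuousOn
  exact ⟨2 * (|M| + |M'|), fun y => abs_le_of_sq_mul_abs_le (h y) fun hy => hM' y (abs_le.1 hy)⟩

theorem continuous_momentum {g : ℝ → ℝ} (hg : ContDiff ℝ 2 g) : Continuous (momentum g) := by
  have h := hg
  rw [show (2 : WithTop ℕ∞) = 1 + 1 by norm_num, contDiff_succ_iff_deriv] at h
  exact hg.continuous.sub (h.2.2.continuous_deriv le_rfl)

end

theorem theorem3p2 (g₀ : ℝ → ℝ) (hg₀ : ContDiff ℝ 2 g₀)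
    (hpot : ∀ y : ℝ, g₀ y = greenPotential (momentum g₀) y)
    (hdecay : ∃ M : ℝ, ∀ y : ℝ, y ^ 2 * |momentum g₀ y| ≤ M)
    (hpos : ∀ y : ℝ, 0 ≤ momentum g₀ y) :
    ∃ g : ℝ → ℝ → ℝ, IsSolutionOn (Ici 0) g ∧ g 0 = g₀ ∧
      ∀ (T : ℝ) (h : ℝ → ℝ → ℝ), IsSolutionOn (Ico 0 T) h → h 0 = g₀ →
        ∀ t ∈ Ico 0 T, h t = g t := by
  obtain ⟨M, hM⟩ := hdecay
  obtain ⟨N, hN⟩ := exists_decay_of_continuous (continuous_momentum hg₀) hM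
  let d : DecayingDensity := ⟨momentum g₀, N, continuous_momentum hg₀, hN⟩
  obtain ⟨b, V, hb, hV, hb0, hfield⟩ := d.exists_global_integralCurve_field hpos
  have hsol := d.isSolutionOn_velocity hb hV hfield
  have h0 : d.velocity (b 0) = g₀ := by
    rw [hb0, DecayingDensity.velocity, d.eulerMomentum_zero]
    exact (funext hpot).symm
  exact ⟨fun t => d.velocity (b t), hsol, h0, fun T h hh hh0 =>
    hh.unique (hsol.restrict_Ico T) (hh0.trans h0.symm)⟩
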